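/- Let $m\ge 3$ and let $g_0$ be the standard metric on the unit sphere $S^{m-1}$. Let $\mathrm{RS}_m$ be the class of smooth rotationally symmetric Riemannian manifolds written in geodesic polar coordinates as $g=ds^2+f(s)^2g_0$ with $f:[0,\infty)\to[0,\infty)$, where $s$ is either the distance from a pole (then $f(0)=0$, the manifold is $\mathbb R^m$, and $g$ is smooth at the pole) or the distance from the boundary (then $f(0)>0$, the manifold is $[0,\infty)\times S^{m-1}$, and $g$ is smooth up to the boundary), such that: the scalar curvature is nonnegative; there is no closed minimal hypersurface in the interior; the boundary, if there is one, is a stable minimal hypersurface; and the symmetric spheres have unbounded area. (Such manifolds are complete; two of them are identified if they have the same $f$.) The Hawking mass of the symmetric sphere at distance $s$ is $\tfrac12 f(s)^{m-2}\bigl(1-f'(s)^2\bigr)$. An admissible Hawking mass function is a nondecreasing function $\mathrm m_{\mathrm H}:[r_{\min},\infty)\to\mathbb R$, for some $r_{\min}\ge 0$, with $$\mathrm m_{\mathrm H}(r_{\min})=\tfrac12 r_{\min}^{m-2},\qquad \mathrm m_{\mathrm H}(r)<\tfrac12 r^{m-2}\quad\text{for } r>r_{\min},$$ which has the regularity of a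 smooth manifold, namely, with $\zeta(r)=\sqrt{\frac{2\mathrm m_{\mathrm H}(r)}{r^{m-2}-2\mathrm m_{\mathrm H}(r)}}$ for $r>r_{\min}$: * $\mathrm m_{\mathrm H}$ is $C^\infty$ on $(r_{\min},\infty)$; * if $r_{\min}=0$, then $\mathrm m_{\mathrm H}(r)=r^m\psi(r)$ for $r\ge0$, with $\psi:\mathbb R\to\mathbb R$ smooth and even; * if $r_{\min}>0$, then $L(r)=\int_{r_{\min}}^r\sqrt{1+\zeta(t)^2}\,dt$ is finite for all $r\ge r_{\min}$, and $r$ is a $C^\infty$ function of $L\in[0,\infty)$, up to $L=0$. Then there is a bijection from $\mathrm{RS}_m$ onto the set of admissible Hawking mass functions. It sends the manifold with warping function $f$ to its Hawking mass as a function of the area radius: $r_{\min}=f(0)$, $f$ maps $[0,\infty)$ onto $[r_{\min},\infty)$, and $\mathrm m_{\mathrm H}(f(s))=\tfrac12f(s)^{m-2}(1-f'(s)^2)$ for all $s\ge0$. The manifold is recovered from an admissible $\mathrm m_{\mathrm H}$ as a radial graph: $\zeta$ is integrable on $[r_{\min},r]$ for every $r\ge r_{\min}$, the function $z(r)=\int_{r_{\min}}^r\zeta(t)\,dt$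 satisfies $$z'(r)=\sqrt{\frac{2\mathrm m_{\mathrm H}(r)}{r^{m-2}-2\mathrm m_{\mathrm H}(r)}}\qquad (r>r_{\min}),$$ and $(s,\omega)\mapsto\bigl(f(s)\,\omega,\;z(f(s))\bigr)$ is a $C^1$ Riemannian isometric embedding of the corresponding manifold into $\mathbb R^m\times\mathbb R=\mathbb E^{m+1}$, up to the boundary, whose image is the graph $\{(y,z(|y|)) : y\in\mathbb R^m,\ |y|\ge r_{\min}\}$. -/

import Mathlib

open scoped ContDiff

noncomputable section

namespace RotSym

/-! ### Riemannian geometry in coordinates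

A Riemannian metric on a region `D` of `ℝᵐ` (open, or closed with smooth boundary) is given by its
coefficient matrix `G : ℝᵐ → Matrix`. Derivatives are taken within `D`, so that all formulas make
sense up to the boundary of `D`. -/

/-- The partial derivative `∂ᵢ F` at `x` (one-sided at boundary points of `D`). -/
def pd {m : ℕ} (D : Set (EuclideanSpace ℝ (Fin m))) (i : Fin m)
    (F : EuclideanSpace ℝ (Fin m) → ℝ) (x : EuclideanSpace ℝ (Fin m)) : ℝ :=
  fderivWithin ℝ F D x (EuclideanSpace.single i 1)

/-- `G` is a smooth Riemannian metric on `D`. -/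
def IsRiemannianMetric {m : ℕ} (D : Set (EuclideanSpace ℝ (Fin m)))
    (G : EuclideanSpace ℝ (Fin m) → Matrix (Fin m) (Fin m) ℝ) : Prop :=
  (∀ i j, ContDiffOn ℝ ∞ (fun x => G x i j) D) ∧ ∀ x ∈ D, (G x).PosDef

/-- The Christoffel symbol `Γᵏᵢⱼ = ½ ∑ₗ gᵏˡ (∂ᵢ gⱼₗ + ∂ⱼ gᵢₗ - ∂ₗ gᵢⱼ)`. -/
def christoffel {m : ℕ} (D : Set (EuclideanSpace ℝ (Fin m)))
    (G : EuclideanSpace ℝ (Fin m) → Matrix (Fin m) (Fin m) ℝ) (k i j : Fin m)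
    (x : EuclideanSpace ℝ (Fin m)) : ℝ :=
  (1 / 2) * ∑ l, (G x)⁻¹ k l *
    (pd D i (fun y => G y j l) x + pd D j (fun y => G y i l) x - pd D l (fun y => G y i j) x)

/-- The Ricci tensor
`Rᵢⱼ = ∂ₖ Γᵏᵢⱼ - ∂ⱼ Γᵏᵢₖ + Γᵏₖₗ Γˡᵢⱼ - Γᵏⱼₗ Γˡᵢₖ` (summed over repeated indices). -/
def ricci {m : ℕ} (D : Set (EuclideanSpace ℝ (Fin m)))
    (G : EuclideanSpace ℝ (Fin m) → Matrix (Fin m) (Fin m) ℝ) (i j : Fin m)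
    (x : EuclideanSpace ℝ (Fin m)) : ℝ :=
  ∑ k, (pd D k (christoffel D G k i j) x - pd D j (christoffel D G k i k) x) +
  ∑ k, ∑ l, (christoffel D G k k l x * christoffel D G l i j x -
    christoffel D G k j l x * christoffel D G l i k x)

/-- The scalar curvature `gⁱʲ Rᵢⱼ`. -/
def scalarCurvature {m : ℕ} (D : Set (EuclideanSpace ℝ (Fin m)))
    (G : EuclideanSpace ℝ (Fin m) → Matrix (Fin m) (Fin m) ℝ)
    (x : EuclideanSpace ℝ (Fin m)) : ℝ :=
  ∑ i, ∑ j, (G x)⁻¹ i j * ricci D G i j x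

/-- The inner product `gⁱʲ ∂ᵢu ∂ⱼv` of the gradients of `u` and `v`. -/
def gradInner {m : ℕ} (D : Set (EuclideanSpace ℝ (Fin m)))
    (G : EuclideanSpace ℝ (Fin m) → Matrix (Fin m) (Fin m) ℝ)
    (u v : EuclideanSpace ℝ (Fin m) → ℝ) (x : EuclideanSpace ℝ (Fin m)) : ℝ :=
  ∑ i, ∑ j, (G x)⁻¹ i j * pd D i u x * pd D j v x

/-- The components `νⁱ` of the unit normal `ν = ∇u / |∇u|` of the level sets of `u`. -/
def unitNormal {m : ℕ} (D : Set (EuclideanSpace ℝ (Fin m)))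
    (G : EuclideanSpace ℝ (Fin m) → Matrix (Fin m) (Fin m) ℝ)
    (u : EuclideanSpace ℝ (Fin m) → ℝ) (i : Fin m) (x : EuclideanSpace ℝ (Fin m)) : ℝ :=
  (∑ j, (G x)⁻¹ i j * pd D j u x) / Real.sqrt (gradInner D G u u x)

/-- The tangential part `gⁱʲ - νⁱ νʲ` of the inverse metric along the level sets of `u`. -/
def tangentialInv {m : ℕ} (D : Set (EuclideanSpace ℝ (Fin m)))
    (G : EuclideanSpace ℝ (Fin m) → Matrix (Fin m) (Fin m) ℝ)
    (u : EuclideanSpace ℝ (Fin m) → ℝ) (i j : Fin m) (x : EuclideanSpace ℝ (Fin m)) : ℝ :=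
  (G x)⁻¹ i j - unitNormal D G u i x * unitNormal D G u j x

/-- The form `(∇²u)ᵢⱼ / |∇u|`, where `(∇²u)ᵢⱼ = ∂ᵢ∂ⱼu - Γᵏᵢⱼ ∂ₖu`. On tangent vectors of a level
set of `u` it is the second fundamental form of that level set. -/
def shapeForm {m : ℕ} (D : Set (EuclideanSpace ℝ (Fin m)))
    (G : EuclideanSpace ℝ (Fin m) → Matrix (Fin m) (Fin m) ℝ)
    (u : EuclideanSpace ℝ (Fin m) → ℝ) (i j : Fin m) (x : EuclideanSpace ℝ (Fin m)) : ℝ :=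
  (pd D i (pd D j u) x - ∑ k, christoffel D G k i j x * pd D k u x) /
    Real.sqrt (gradInner D G u u x)

/-- The mean curvature (trace of the second fundamental form) of the level set of `u`
through `x`; it equals `div (∇u / |∇u|)`. -/
def meanCurvature {m : ℕ} (D : Set (EuclideanSpace ℝ (Fin m)))
    (G : EuclideanSpace ℝ (Fin m) → Matrix (Fin m) (Fin m) ℝ)
    (u : EuclideanSpace ℝ (Fin m) → ℝ) (x : EuclideanSpace ℝ (Fin m)) : ℝ :=
  ∑ i, ∑ j, tangentialInv D G u i j x * shapeForm D G u i j x

/-- The squared norm `|A|²` of the second fundamental form of the level set of `u` through `x`. -/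
def secondFormSq {m : ℕ} (D : Set (EuclideanSpace ℝ (Fin m)))
    (G : EuclideanSpace ℝ (Fin m) → Matrix (Fin m) (Fin m) ℝ)
    (u : EuclideanSpace ℝ (Fin m) → ℝ) (x : EuclideanSpace ℝ (Fin m)) : ℝ :=
  ∑ i, ∑ j, ∑ k, ∑ l, tangentialInv D G u i k x * tangentialInv D G u j l x *
    shapeForm D G u i j x * shapeForm D G u k l x

/-- `S` is a smooth embedded hypersurface of `D` with vanishing mean curvature: near each of its
points it is a regular level set `{u = 0}`, and it has mean curvature zero there. -/
def IsMinimalHypersurface {m : ℕ} (D : Set (EuclideanSpace ℝ (Fin m)))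
    (G : EuclideanSpace ℝ (Fin m) → Matrix (Fin m) (Fin m) ℝ)
    (S : Set (EuclideanSpace ℝ (Fin m))) : Prop :=
  S ⊆ D ∧ ∀ p ∈ S, ∃ (U : Set (EuclideanSpace ℝ (Fin m))) (u : EuclideanSpace ℝ (Fin m) → ℝ),
    IsOpen U ∧ p ∈ U ∧ ContDiffOn ℝ ∞ u U ∧ S ∩ U = {x | x ∈ D ∩ U ∧ u x = 0} ∧
    ∀ x ∈ S ∩ U, fderiv ℝ u x ≠ 0 ∧ meanCurvature D G u x = 0

/-- `S` is a closed minimal hypersurface (compact, without boundary, non-empty) in the interior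
of `D`. -/
def IsClosedInteriorMinimal {m : ℕ} (D : Set (EuclideanSpace ℝ (Fin m)))
    (G : EuclideanSpace ℝ (Fin m) → Matrix (Fin m) (Fin m) ℝ)
    (S : Set (EuclideanSpace ℝ (Fin m))) : Prop :=
  S.Nonempty ∧ IsCompact S ∧ S ⊆ interior D ∧ IsMinimalHypersurface D G S

/-- The stability inequality
`0 ≤ ∫ |∇^S φ|² - (|A|² + Ric(ν, ν)) φ²` for all smooth `φ`, on the unit sphere `S = {‖x‖ = 1}`.
The integral is with respect to the round measure on `S`: for the rotationally symmetric metrics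
below, the area measure of `S` is a positive constant multiple of it. -/
def IsStableUnitSphere {m : ℕ} (D : Set (EuclideanSpace ℝ (Fin m)))
    (G : EuclideanSpace ℝ (Fin m) → Matrix (Fin m) (Fin m) ℝ) : Prop :=
  ∀ φ : EuclideanSpace ℝ (Fin m) → ℝ, ContDiff ℝ ∞ φ →
    0 ≤ ∫ x : Metric.sphere (0 : EuclideanSpace ℝ (Fin m)) 1,
      (∑ i, ∑ j, tangentialInv D G (fun y => ‖y‖) i j x * pd D i φ x * pd D j φ x
        - (secondFormSq D G (fun y => ‖y‖) x
            + ∑ i, ∑ j, ricci D G i j x * unitNormal D G (fun y => ‖y‖) i x *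
                unitNormal D G (fun y => ‖y‖) j x) * φ x ^ 2)
      ∂(MeasureTheory.Measure.toSphere
          (MeasureTheory.volume : MeasureTheory.Measure (EuclideanSpace ℝ (Fin m))))

/-! ### Rotationally symmetric manifolds in geodesic polar coordinates

The metric `ds² + f(s)² g₀`, `s ∈ [0, ∞)`, is realised on a region of `ℝᵐ`. If `f(0) = 0`, there is
a pole at the origin, the manifold is `ℝᵐ` and `s = ‖x‖`. If `f(0) ≠ 0`, the manifold
`[0, ∞) × S^{m-1}` is `{‖x‖ ≥ 1}`, with boundary `{‖x‖ = 1}`, and `s = ‖x‖ - 1`. -/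

/-- The value of `‖x‖` at `s = 0`: `0` if there is a pole and `1` if there is a boundary. -/
def offset (f : Set.Ici (0 : ℝ) → ℝ) : ℝ := if f ⟨0, Set.self_mem_Ici⟩ = 0 then 0 else 1

/-- The region of `ℝᵐ` on which the manifold with warping function `f` is realised. -/
def region (m : ℕ) (f : Set.Ici (0 : ℝ) → ℝ) : Set (EuclideanSpace ℝ (Fin m)) :=
  {x | offset f ≤ ‖x‖}

/-- The warping function as a function of `x`: the value `f(s)` at `s = ‖x‖ - offset f`. -/
def areaRadius {m : ℕ} (f : Set.Ici (0 : ℝ) → ℝ) (x : EuclideanSpace ℝ (Fin m)) : ℝ :=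
  Set.IciExtend f (‖x‖ - offset f)

/-- The coefficients of `ds² + f(s)² g₀` in Cartesian coordinates: a radial part of length one, and
`(f(s) / ‖x‖)²` times the Euclidean metric on the tangent space of the sphere through `x`. -/
def metric (m : ℕ) (f : Set.Ici (0 : ℝ) → ℝ) (x : EuclideanSpace ℝ (Fin m)) :
    Matrix (Fin m) (Fin m) ℝ :=
  if ‖x‖ = 0 then 1 else
    Matrix.of fun i j => x i * x j / ‖x‖ ^ 2 +
      (areaRadius f x / ‖x‖) ^ 2 * ((if i = j then 1 else 0) - x i * x j / ‖x‖ ^ 2)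

end RotSym

open RotSym in
/-- The class `RS_m`: smooth rotationally symmetric Riemannian manifolds `ds² + f(s)² g₀`,
`s ∈ [0, ∞)`, with nonnegative scalar curvature and no closed interior minimal hypersurface, whose
boundary is empty or a stable minimal hypersurface, and whose symmetric spheres have unbounded
area. They are complete, since the distance `s` from the pole or from the boundary takes all values
in `[0, ∞)` and its sublevel sets are compact. -/
structure RS (m : ℕ) where
  /-- the warping function `f` -/
  warp : Set.Ici (0 : ℝ) → ℝ
  warp_nonneg : ∀ s, 0 ≤ warp s
  isRiemannianMetric : IsRiemannianMetric (region m warp) (metric m warp)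
  scalarCurvature_nonneg : ∀ x ∈ region m warp,
    0 ≤ scalarCurvature (region m warp) (metric m warp) x
  no_closed_interior_minimal :
    ¬ ∃ S, IsClosedInteriorMinimal (region m warp) (metric m warp) S
  boundary_minimal : warp ⟨0, Set.self_mem_Ici⟩ ≠ 0 →
    IsMinimalHypersurface (region m warp) (metric m warp) (Metric.sphere 0 1)
  boundary_stable : warp ⟨0, Set.self_mem_Ici⟩ ≠ 0 →
    IsStableUnitSphere (region m warp) (metric m warp)
  unbounded_area : ¬ BddAbove (Set.range warp)

namespace RotSym

/-- The Hawking mass `½ f(s)^{m-2} (1 - f'(s)²)` of the symmetric sphere at distance `s`. -/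
def hawkingMass (m : ℕ) (f : Set.Ici (0 : ℝ) → ℝ) (s : Set.Ici (0 : ℝ)) : ℝ :=
  f s ^ (m - 2) / 2 * (1 - derivWithin (Set.IciExtend f) (Set.Ici 0) (s : ℝ) ^ 2)

/-- The slope `z'(r) = √(2 m_H(r) / (r^{m-2} - 2 m_H(r)))`. -/
def slope (m : ℕ) {a : ℝ} (μ : Set.Ici a → ℝ) (r : ℝ) : ℝ :=
  Real.sqrt (2 * Set.IciExtend μ r / (r ^ (m - 2) - 2 * Set.IciExtend μ r))

/-- The height `z(r) = ∫ z'` of the radial graph, normalised to vanish at `r = a`. -/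
def height (m : ℕ) {a : ℝ} (μ : Set.Ici a → ℝ) (r : ℝ) : ℝ :=
  ∫ t in a..r, slope m μ t

/-- The length of the profile curve `t ↦ (t, z(t))` for `t` from `a` to `r`. -/
def arcLength (m : ℕ) {a : ℝ} (μ : Set.Ici a → ℝ) (r : ℝ) : ℝ :=
  ∫ t in a..r, Real.sqrt (1 + slope m μ t ^ 2)

/-- The radial graph `{(y, z(‖y‖)) : ‖y‖ ≥ a}` in `ℝᵐ × ℝ = ℝ^{m+1}`. -/
def radialGraph (m : ℕ) {a : ℝ} (μ : Set.Ici a → ℝ) :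
    Set (WithLp 2 (EuclideanSpace ℝ (Fin m) × ℝ)) :=
  {p | a ≤ ‖p.fst‖ ∧ p.snd = height m μ ‖p.fst‖}

/-- The rotationally symmetric map into `ℝ^{m+1}` that sends the point with polar coordinates
`(s, ω)` to the point `(f(s) ω, z(f(s)))`. -/
def graphMap (m : ℕ) (f : Set.Ici (0 : ℝ) → ℝ) {a : ℝ} (μ : Set.Ici a → ℝ)
    (x : EuclideanSpace ℝ (Fin m)) : WithLp 2 (EuclideanSpace ℝ (Fin m) × ℝ) :=
  WithLp.toLp 2 ((areaRadius f x / ‖x‖) • x, height m μ (areaRadius f x))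

end RotSym

open RotSym in
/-- Admissible Hawking mass functions. The last three fields are the regularity that belongs to a
smooth manifold: smoothness on `(r_min, ∞)`; at a pole, that `r⁻ᵐ m_H(r)` extends to a smooth even
function of `r`; at a boundary, that the profile curve has finite length near `r_min` and that `r`
is a smooth function of the arc length up to the boundary. -/
structure AdmissibleMass (m : ℕ) where
  rmin : ℝ
  mass : Set.Ici rmin → ℝ
  rmin_nonneg : 0 ≤ rmin
  monotone_mass : Monotone mass
  mass_rmin : mass ⟨rmin, Set.self_mem_Ici⟩ = rmin ^ (m - 2) / 2
  mass_lt : ∀ r : Set.Ici rmin, rmin < (r : ℝ) → mass r < (r : ℝ) ^ (m - 2) / 2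
  smooth_mass : ContDiffOn ℝ ∞ (Set.IciExtend mass) (Set.Ioi rmin)
  smooth_pole : rmin = 0 → ∃ ψ : ℝ → ℝ, ContDiff ℝ ∞ ψ ∧ (∀ t, ψ (-t) = ψ t) ∧
    ∀ r : Set.Ici rmin, mass r = (r : ℝ) ^ m * ψ r
  smooth_boundary : 0 < rmin →
    (∀ r, rmin ≤ r → IntervalIntegrable (fun t => Real.sqrt (1 + slope m mass t ^ 2))
      MeasureTheory.volume rmin r) ∧
    ∃ ρ : ℝ → ℝ, ContDiffOn ℝ ∞ ρ (Set.Ici 0) ∧ ∀ r, rmin ≤ r → ρ (arcLength m mass r) = r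

end

namespace RotSym

open Set Filter Topology MeasureTheory

/-! ### One-variable calculus -/

/-! Everything reduces to the warping function `f`. For `ds² + f² g₀` the scalar curvature is
`(m-1)/f² · B` with `B = (m-2)(1-f'²) - 2 f f''`, and the `s`-derivative of the Hawking mass is
`f^(m-3) f'/2 · B`. Where `f' > 0`, nonnegative scalar curvature and a nondecreasing Hawking mass
are therefore the same condition.

The other conditions control `f'`. A symmetric sphere with `f' = 0` is minimal, so `f'` has no zero
for `s > 0`, and `f' < 0` would bound the areas; hence `f' > 0`. Conversely, if `f' > 0`, a closed
minimal hypersurface would touch a symmetric sphere from inside at its point farthest from the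
origin and so curve at least as much as that sphere, whose mean curvature `(m-1) f'/f` is positive.
Minimality of the boundary means `f'(0) = 0`; there the second fundamental form vanishes and
`Ric(ν,ν) = -(m-1) f''(0)/f(0) ≤ 0`, which gives stability. `IsProfile` collects the conditions on
`f`; `isProfile_warp` and `IsProfile.toRS` are the two directions. The curvatures are computed in
Cartesian coordinates, where the metric is `a δᵢⱼ + b xᵢ xⱼ` with radial `a`, `b` that stay smooth
across the pole.

Since `f` is strictly increasing, `r = f(s)` is a coordinate, and the definition of the mass reads
`f'² = 1 - 2 m_H / r^(m-2) = 1 / (1 + ζ²)`. So `ds/dr = √(1 + ζ²)`: the distance `s` is the arc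
length `L(r)` of the profile curve, and `f` is the inverse of `L`. This gives injectivity
(`toAdmissibleMass_warp_injective`) and the construction of `f` from a mass
(`AdmissibleMass.exists_isProfile`). Regularity transfers because at a boundary `ρ` is `f` itself,
and at a pole `f(s) = s k(s)` with `k` smooth and even extends to an odd function with a smooth odd
inverse; division by powers of the variable turns this into `m_H = r^m ψ(r)` and back.

Along the profile curve the height has `s`-derivative `√(1 - f'²)`, so radial vectors have length
`f'² + (1 - f'²) = 1`, and spheres of radius `f` give the tangential part. The square root need not
be smooth where `f' = 1`, which is why the embedding is only claimed to be `C¹`. -/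

lemma hasDerivAt_integral_pow_mul_comp {h : ℝ → ℝ} (hh : ContDiff ℝ ∞ h) (k : ℕ) (t : ℝ) :
    HasDerivAt (fun t => ∫ s in (0 : ℝ)..1, s ^ k * h (s * t))
      (∫ s in (0 : ℝ)..1, s ^ (k + 1) * deriv h (s * t)) t := by
  have hc := hh.continuous
  have hc' : Continuous (deriv h) := hh.continuous_deriv (by simp)
  -- For `|x - t| < 1` and `0 < s ≤ 1` the point `s * x` stays in this interval, so one constant
  -- dominates all the derivatives.
  obtain ⟨C, hC⟩ := (isCompact_Icc (a := -(|t| + 1)) (b := |t| + 1)).exists_bound_of_continuousOn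
    hc'.continuousOn
  refine (intervalIntegral.hasDerivAt_integral_of_dominated_loc_of_deriv_le
    (F := fun t s => s ^ k * h (s * t)) (F' := fun t s => s ^ (k + 1) * deriv h (s * t))
    (bound := fun _ => C) (Metric.ball_mem_nhds t one_pos) ?_ ?_ ?_ ?_ ?_ ?_).2
  · exact Eventually.of_forall fun x => by
      apply Continuous.aestronglyMeasurable; fun_prop
  · apply Continuous.intervalIntegrable; fun_prop
  · apply Continuous.aestronglyMeasurable; fun_prop
  · refine Eventually.of_forall fun s hs x hx => ?_
    rw [uIoc_of_le zero_le_one] at hs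
    have hx' : |x| ≤ |t| + 1 := by
      have h1 : |x - t| < 1 := by simpa [Real.dist_eq] using hx
      have h2 := abs_sub_abs_le_abs_sub x t
      linarith
    have h1 : |s * x| ≤ |t| + 1 := by
      rw [abs_mul, abs_of_pos hs.1]
      nlinarith [abs_nonneg x, hs.2]
    have h2 := hC (s * x) (abs_le.mp h1)
    have h3 : ‖s ^ (k + 1)‖ ≤ 1 := by
      rw [norm_pow, Real.norm_eq_abs, abs_of_pos hs.1]
      exact pow_le_one₀ hs.1.le hs.2
    rw [norm_mul]
    nlinarith [norm_nonneg (deriv h (s * x)), norm_nonneg (s ^ (k + 1))]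
  · exact intervalIntegrable_const
  · refine Eventually.of_forall fun s _ x _ => ?_
    have hd := (hh.differentiable (by simp) (s * x)).hasDerivAt
    have := (hd.comp x ((hasDerivAt_id x).const_mul s)).const_mul (s ^ k)
    exact this.congr_deriv (by ring)

/-- Each derivative under the integral replaces `h` by `h'` and raises `k` by one, so the induction
runs over all `h` and `k` at once. -/
lemma contDiff_integral_pow_mul_comp (n : ℕ) : ∀ {h : ℝ → ℝ}, ContDiff ℝ ∞ h → ∀ k : ℕ,
    ContDiff ℝ n (fun t => ∫ s in (0 : ℝ)..1, s ^ k * h (s * t)) := by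
  induction n with
  | zero =>
    intro h hh k
    simp only [Nat.cast_zero, contDiff_zero]
    exact continuous_iff_continuousAt.2 fun t =>
      (hasDerivAt_integral_pow_mul_comp hh k t).continuousAt
  | succ n ih =>
    intro h hh k
    rw [Nat.cast_succ, contDiff_succ_iff_deriv]
    refine ⟨fun t => (hasDerivAt_integral_pow_mul_comp hh k t).differentiableAt, by simp, ?_⟩
    rw [funext fun t => (hasDerivAt_integral_pow_mul_comp hh k t).deriv]
    exact ih (contDiff_infty_iff_deriv.1 hh).2 (k + 1)

/-- Hadamard's lemma in one variable. -/
lemma exists_eq_mul_of_contDiff {h : ℝ → ℝ} (hh : ContDiff ℝ ∞ h) (h0 : h 0 = 0) :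
    ∃ g : ℝ → ℝ, ContDiff ℝ ∞ g ∧ (∀ t, h t = t * g t) ∧ g 0 = deriv h 0 := by
  -- The quotient is `∫₀¹ h'(st) ds`; the factor `s ^ 0` matches the form of
  -- `contDiff_integral_pow_mul_comp`.
  refine ⟨fun t => ∫ s in (0 : ℝ)..1, s ^ 0 * deriv h (s * t), ?_, fun t => ?_, by simp⟩
  · exact contDiff_infty.2 fun n =>
      contDiff_integral_pow_mul_comp n (contDiff_infty_iff_deriv.1 hh).2 0
  · have hc' : Continuous (deriv h) := hh.continuous_deriv (by simp)
    have : ∫ s in (0 : ℝ)..1, deriv h (s * t) * t = h (1 * t) - h (0 * t) :=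
      intervalIntegral.integral_eq_sub_of_hasDerivAt (f := fun s => h (s * t))
        (fun s _ => ((hh.differentiable (by simp) (s * t)).hasDerivAt.comp s
          (by simpa using (hasDerivAt_id s).mul_const t)))
        (by apply Continuous.intervalIntegrable; fun_prop)
    simp only [one_mul, zero_mul, h0, sub_zero, intervalIntegral.integral_mul_const] at this
    simp only [pow_zero, one_mul]
    rw [← this, mul_comm]

lemma deriv_neg_of_even {h : ℝ → ℝ} (he : ∀ t, h (-t) = h t) (t : ℝ) :
    deriv h (-t) = -deriv h t := by
  have : deriv (fun x => h (-x)) t = -deriv h (-t) := deriv_comp_neg h t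
  rw [funext he] at this
  linarith

lemma deriv_neg_of_odd {h : ℝ → ℝ} (he : ∀ t, h (-t) = -h t) (t : ℝ) :
    deriv h (-t) = deriv h t := by
  have : deriv (fun x => h (-x)) t = -deriv h (-t) := deriv_comp_neg h t
  rw [funext he, deriv.fun_neg] at this
  linarith

/-- The quotient of a smooth odd function by the variable is smooth and even. -/
lemma exists_even_mul_of_odd {h : ℝ → ℝ} (hh : ContDiff ℝ ∞ h) (ho : ∀ t, h (-t) = -h t) :
    ∃ g : ℝ → ℝ, ContDiff ℝ ∞ g ∧ (∀ t, g (-t) = g t) ∧ (∀ t, h t = t * g t) ∧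
      g 0 = deriv h 0 := by
  have h0 : h 0 = 0 := by have := ho 0; simp at this; linarith
  obtain ⟨g, hg, hgt, hg0⟩ := exists_eq_mul_of_contDiff hh h0
  refine ⟨g, hg, fun t => ?_, hgt, hg0⟩
  rcases eq_or_ne t 0 with rfl | ht
  · simp
  · have h1 := hgt t
    have h2 := hgt (-t)
    rw [ho, h1] at h2
    have : t * (g (-t) - g t) = 0 := by linear_combination h2
    rcases mul_eq_zero.1 this with h | h
    · exact absurd h ht
    · linarith

/-- The derivative of an even function is odd, hence divisible by `t` with even quotient. In the
form `h' = t g` the gradient of `h(‖x‖)` is `g(‖x‖) x`, which has no singularity at the origin. -/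
lemma exists_even_deriv_eq {h : ℝ → ℝ} (hh : ContDiff ℝ ∞ h) (he : ∀ t, h (-t) = h t) :
    ∃ g : ℝ → ℝ, ContDiff ℝ ∞ g ∧ (∀ t, g (-t) = g t) ∧ ∀ t, HasDerivAt h (t * g t) t := by
  obtain ⟨g, hg, hge, hgt, -⟩ :=
    exists_even_mul_of_odd (contDiff_infty_iff_deriv.1 hh).2 (deriv_neg_of_even he)
  exact ⟨g, hg, hge, fun t => hgt t ▸ (hh.differentiable (by simp) t).hasDerivAt⟩

/-- Dividing by `t` twice is possible since `h(0) = h'(0) = 0`. It is applied to `1 - k²` for the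
metric at a pole and to `1 - f'²` for the mass. -/
lemma exists_even_mul_sq_of_even {h : ℝ → ℝ} (hh : ContDiff ℝ ∞ h) (he : ∀ t, h (-t) = h t)
    (h0 : h 0 = 0) :
    ∃ g : ℝ → ℝ, ContDiff ℝ ∞ g ∧ (∀ t, g (-t) = g t) ∧ ∀ t, h t = t ^ 2 * g t := by
  obtain ⟨h1, hh1, hh1t, h10⟩ := exists_eq_mul_of_contDiff hh h0
  have hd0 : deriv h 0 = 0 := by have := deriv_neg_of_even he 0; simp at this; linarith
  have ho : ∀ t, h1 (-t) = -h1 t := fun t => by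
    rcases eq_or_ne t 0 with rfl | ht
    · simp [h10, hd0]
    · have h2 := hh1t (-t)
      rw [he, hh1t t] at h2
      have : t * (h1 (-t) + h1 t) = 0 := by linear_combination h2
      rcases mul_eq_zero.1 this with h | h
      · exact absurd h ht
      · linarith
  obtain ⟨g, hg, hge, hgt, -⟩ := exists_even_mul_of_odd hh1 ho
  exact ⟨g, hg, hge, fun t => by rw [hh1t, hgt]; ring⟩

/-- Solutions of a smooth autonomous equation are smooth. -/
lemma contDiffOn_of_hasDerivAt_comp {g Ψ : ℝ → ℝ} {U V : Set ℝ} (hU : IsOpen U)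
    (hΨ : ContDiffOn ℝ ∞ Ψ V) (hg : ∀ r ∈ U, HasDerivAt g (Ψ (g r)) r) (hUV : MapsTo g U V) :
    ContDiffOn ℝ ∞ g U := by
  rw [contDiffOn_infty]
  intro n
  induction n with
  | zero =>
    simp only [Nat.cast_zero, contDiffOn_zero]
    exact fun r hr => (hg r hr).continuousAt.continuousWithinAt
  | succ n ih =>
    rw [Nat.cast_succ, contDiffOn_succ_iff_deriv_of_isOpen hU]
    refine ⟨fun r hr => (hg r hr).differentiableAt.differentiableWithinAt, by simp, ?_⟩
    -- Bootstrap: if `g` is `Cⁿ`, so is `g' = Ψ ∘ g`, and then `g` is `Cⁿ⁺¹`.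
    exact ((hΨ.of_le (by exact_mod_cast le_top)).comp ih hUV).congr fun r hr => (hg r hr).deriv

lemma exists_continuous_inverse {F : ℝ → ℝ} {a : ℝ} (hF : ContinuousOn F (Ici a))
    (hmono : StrictMonoOn F (Ici a)) (hunb : ∀ C, ∃ s, a ≤ s ∧ C ≤ F s) :
    ∃ g : ℝ → ℝ, Continuous g ∧ StrictMono g ∧ (∀ s, a ≤ s → g (F s) = s) ∧
      ∀ r, F a ≤ r → F (g r) = r ∧ a ≤ g r := by
  -- Extending `F` to the left of `a` by a line of slope one gives an increasing bijection of `ℝ`,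
  -- so the inverse is continuous on the whole line.
  let G : ℝ → ℝ := fun t => F (max a t) + min 0 (t - a)
  have hG : Continuous G := by
    have : Continuous fun t => F (max a t) :=
      hF.comp_continuous (by fun_prop) fun t => mem_Ici.2 (le_max_left a t)
    exact this.add (by fun_prop)
  have hG1 : ∀ t, a ≤ t → G t = F t := fun t ht => by
    simp [G, max_eq_right ht, min_eq_left (sub_nonneg.2 ht)]
  have hG2 : ∀ t, t ≤ a → G t = F a + (t - a) := fun t ht => by
    simp [G, max_eq_left ht, min_eq_right (sub_nonpos.2 ht)]
  have hGm : StrictMono G := by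
    intro s t hst
    rcases le_or_gt a s with hs | hs
    · rw [hG1 s hs, hG1 t (hs.trans hst.le)]
      exact hmono hs (hs.trans hst.le) hst
    · rw [hG2 s hs.le]
      rcases le_or_gt a t with ht | ht
      · rw [hG1 t ht]
        have := hmono.monotoneOn self_mem_Ici ht ht
        linarith
      · rw [hG2 t ht.le]; linarith
  have hGs : Function.Surjective G := by
    refine hG.surjective ?_ ?_
    · refine tendsto_atTop_atTop.2 fun C => ?_
      obtain ⟨s, hs, hC⟩ := hunb C
      exact ⟨s, fun t hst => hC.trans ((hG1 s hs).symm.le.trans (hGm.monotone hst))⟩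
    · refine tendsto_atBot_atBot.2 fun C => ⟨min a (C - F a + a), fun t ht => ?_⟩
      rw [hG2 t (ht.trans (min_le_left _ _))]
      linarith [ht.trans (min_le_right _ _)]
  let e := hGm.orderIsoOfSurjective G hGs
  have he : ∀ t, e t = G t := fun t => rfl
  refine ⟨e.symm, e.symm.continuous, e.symm.strictMono, fun s hs => ?_, fun r hr => ?_⟩
  · rw [← hG1 s hs, ← he, e.symm_apply_apply]
  · have h1 : a ≤ e.symm r := by
      rw [e.le_symm_apply, he, hG1 a le_rfl]; exact hr
    exact ⟨by rw [← hG1 _ h1, ← he, e.apply_symm_apply], h1⟩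

end RotSym

namespace RotSym

open Set Filter Topology MeasureTheory

/-! ### Calculus of radial functions -/

variable {m : ℕ} {D : Set (EuclideanSpace ℝ (Fin m))}

lemma pd_eq {F : EuclideanSpace ℝ (Fin m) → ℝ} {F' : EuclideanSpace ℝ (Fin m) →L[ℝ] ℝ}
    {x : EuclideanSpace ℝ (Fin m)} (hD : UniqueDiffOn ℝ D) (hx : x ∈ D)
    (h : HasFDerivWithinAt F F' D x) (i : Fin m) :
    pd D i F x = F' (EuclideanSpace.single i 1) := by
  rw [pd, h.fderivWithin (hD x hx)]

lemma pd_congr {F F' : EuclideanSpace ℝ (Fin m) → ℝ} {x : EuclideanSpace ℝ (Fin m)}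
    (h : EqOn F F' D) (hx : x ∈ D) (i : Fin m) : pd D i F x = pd D i F' x := by
  rw [pd, pd, fderivWithin_congr h (h hx)]

/-- The derivative of `a` is `a₁(x) ⟨x, ·⟩`: if `a = α(‖x‖)`, then `a₁ = α'(‖x‖) / ‖x‖`. -/
def HasRadialDeriv (D : Set (EuclideanSpace ℝ (Fin m)))
    (a a₁ : EuclideanSpace ℝ (Fin m) → ℝ) : Prop :=
  ∀ x ∈ D, HasFDerivWithinAt a (a₁ x • innerSL ℝ x) D x

namespace HasRadialDeriv

variable {a a₁ b b₁ : EuclideanSpace ℝ (Fin m) → ℝ}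

lemma const (c : ℝ) : HasRadialDeriv D (fun _ => c) (fun _ => 0) := fun x _ => by
  simpa using hasFDerivWithinAt_const c x D

lemma normSq : HasRadialDeriv D (fun x => ‖x‖ ^ 2) (fun _ => 2) := fun x _ => by
  refine (hasStrictFDerivAt_norm_sq x).hasFDerivAt.hasFDerivWithinAt.congr_fderiv ?_
  rw [two_smul, two_smul]

lemma add (ha : HasRadialDeriv D a a₁) (hb : HasRadialDeriv D b b₁) :
    HasRadialDeriv D (fun x => a x + b x) (fun x => a₁ x + b₁ x) := fun x hx => by
  rw [add_smul]; exact (ha x hx).add (hb x hx)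

lemma sub (ha : HasRadialDeriv D a a₁) (hb : HasRadialDeriv D b b₁) :
    HasRadialDeriv D (fun x => a x - b x) (fun x => a₁ x - b₁ x) := fun x hx => by
  rw [sub_smul]; exact (ha x hx).sub (hb x hx)

lemma mul (ha : HasRadialDeriv D a a₁) (hb : HasRadialDeriv D b b₁) :
    HasRadialDeriv D (fun x => a x * b x) (fun x => a x * b₁ x + b x * a₁ x) := fun x hx => by
  rw [add_smul, mul_smul, mul_smul]; exact (ha x hx).mul (hb x hx)

lemma div (ha : HasRadialDeriv D a a₁) (hb : HasRadialDeriv D b b₁) (h0 : ∀ x ∈ D, b x ≠ 0) :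
    HasRadialDeriv D (fun x => a x / b x) (fun x => (a₁ x * b x - a x * b₁ x) / b x ^ 2) :=
  fun x hx => by
    have hi := (hasDerivAt_inv (h0 x hx)).comp_hasFDerivWithinAt x (hb x hx)
    simp only [div_eq_mul_inv]
    refine ((ha x hx).mul hi).congr_fderiv ?_
    have := h0 x hx
    ext v
    simp
    field_simp
    ring

lemma continuousOn (ha : HasRadialDeriv D a a₁) : ContinuousOn a D :=
  fun x hx => (ha x hx).continuousWithinAt

end HasRadialDeriv

lemma hasFDerivWithinAt_coord (x : EuclideanSpace ℝ (Fin m)) (i : Fin m) :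
    HasFDerivWithinAt (fun y : EuclideanSpace ℝ (Fin m) => y i)
      (EuclideanSpace.proj i : EuclideanSpace ℝ (Fin m) →L[ℝ] ℝ) D x :=
  (EuclideanSpace.proj i : EuclideanSpace ℝ (Fin m) →L[ℝ] ℝ).hasFDerivWithinAt

lemma proj_single (i l : Fin m) :
    (EuclideanSpace.proj i : EuclideanSpace ℝ (Fin m) →L[ℝ] ℝ) (EuclideanSpace.single l 1) =
      if i = l then 1 else 0 := by
  simp

lemma innerSL_single (x : EuclideanSpace ℝ (Fin m)) (l : Fin m) :
    innerSL ℝ x (EuclideanSpace.single l 1) = x l := by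
  simp [EuclideanSpace.inner_single_right]

lemma sum_mul_self_eq (x : EuclideanSpace ℝ (Fin m)) : ∑ i, x i * x i = ‖x‖ ^ 2 := by
  rw [EuclideanSpace.real_norm_sq_eq]; simp [sq]

/-! ### The curvature of a metric `a(x) δᵢⱼ + b(x) xᵢ xⱼ` with `a + ‖x‖² b = 1` -/

/-- A metric of the form `a(x) δᵢⱼ + b(x) xᵢ xⱼ`, with radial coefficients `a` and `b` and with
radial part of length one. -/
structure IsRadialMetric (D : Set (EuclideanSpace ℝ (Fin m)))
    (G : EuclideanSpace ℝ (Fin m) → Matrix (Fin m) (Fin m) ℝ)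
    (a a₁ a₂ b b₁ b₂ : EuclideanSpace ℝ (Fin m) → ℝ) : Prop where
  uniqueDiffOn : UniqueDiffOn ℝ D
  eq_of_mem : ∀ x ∈ D, ∀ i j, G x i j = a x * (if i = j then 1 else 0) + b x * (x i * x j)
  radial_length : ∀ x ∈ D, a x + ‖x‖ ^ 2 * b x = 1
  pos : ∀ x ∈ D, 0 < a x
  deriv_a : HasRadialDeriv D a a₁
  deriv_a₁ : HasRadialDeriv D a₁ a₂
  deriv_b : HasRadialDeriv D b b₁
  deriv_b₁ : HasRadialDeriv D b₁ b₂

namespace IsRadialMetric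

variable {G : EuclideanSpace ℝ (Fin m) → Matrix (Fin m) (Fin m) ℝ}
  {a a₁ a₂ b b₁ b₂ : EuclideanSpace ℝ (Fin m) → ℝ} {x : EuclideanSpace ℝ (Fin m)}

/-- Sherman–Morrison; the denominator `a + ‖x‖² b` is one. -/
lemma inv_apply (h : IsRadialMetric D G a a₁ a₂ b b₁ b₂) (hx : x ∈ D) (i j : Fin m) :
    (G x)⁻¹ i j = (if i = j then 1 else 0) / a x - b x / a x * (x i * x j) := by
  have ha := (h.pos x hx).ne'
  have hr := h.radial_length x hx
  have : (G x)⁻¹ = Matrix.of fun i j =>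
      (if i = j then 1 else 0) / a x - b x / a x * (x i * x j) := by
    refine Matrix.inv_eq_right_inv ?_
    ext i j
    rw [Matrix.mul_apply]
    -- The summand is sorted into Kronecker deltas, each of which collapses the sum, and a multiple
    -- of `x k * x k`, which sums to `‖x‖²`. The contractions below follow this pattern.
    have h1 : ∀ k, G x i k * (Matrix.of fun i j =>
        (if i = j then 1 else 0) / a x - b x / a x * (x i * x j)) k j =
        (if i = k then (if k = j then 1 else 0) else 0) +
        (if k = j then b x / a x * (x i * x k) else 0) -
        (if i = k then b x * (x k * x j) else 0) - b x ^ 2 / a x * (x i * x j) * (x k * x k) := by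
      intro k
      rw [h.eq_of_mem x hx, Matrix.of_apply]
      split_ifs <;> field_simp <;> ring
    simp only [h1, Finset.sum_add_distrib, Finset.sum_sub_distrib, Finset.sum_ite_eq,
      Finset.sum_ite_eq', Finset.mem_univ, if_true, ← Finset.mul_sum, sum_mul_self_eq,
      Matrix.one_apply]
    have h2 : b x / a x - b x - b x ^ 2 / a x * ‖x‖ ^ 2 = 0 := by
      field_simp; linear_combination (-b x) * hr
    linear_combination (x i * x j) * h2
  rw [this, Matrix.of_apply]

lemma pd_metric (h : IsRadialMetric D G a a₁ a₂ b b₁ b₂) (hx : x ∈ D) (l i j : Fin m) :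
    pd D l (fun y => G y i j) x = a₁ x * x l * (if i = j then 1 else 0) +
      b₁ x * (x l * x i * x j) +
      b x * ((if i = l then 1 else 0) * x j + (if j = l then 1 else 0) * x i) := by
  rw [pd_congr (fun y hy => h.eq_of_mem y hy i j) hx]
  refine (pd_eq h.uniqueDiffOn hx (((h.deriv_a x hx).mul_const _).add ((h.deriv_b x hx).mul
    ((hasFDerivWithinAt_coord x i).mul (hasFDerivWithinAt_coord x j)))) l).trans ?_
  simp only [add_apply, smul_apply, smul_eq_mul, innerSL_single, proj_single]
  simp only [Pi.mul_apply]
  ring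

/-- The Christoffel symbols are `p (xᵢ δⱼₖ + xⱼ δᵢₖ) + q δᵢⱼ xₖ + t xᵢ xⱼ xₖ`. -/
lemma christoffel_eq (h : IsRadialMetric D G a a₁ a₂ b b₁ b₂) (hx : x ∈ D) (k i j : Fin m) :
    christoffel D G k i j x =
      a₁ x / (2 * a x) * (x i * (if j = k then 1 else 0) + x j * (if i = k then 1 else 0)) +
      (b x - a₁ x / 2) * ((if i = j then 1 else 0) * x k) +
      (b₁ x / 2 - a₁ x * b x / a x) * (x i * x j * x k) := by
  have ha := (h.pos x hx).ne'
  have hr := h.radial_length x hx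
  have h1 : ∀ l, (G x)⁻¹ k l *
      (pd D i (fun y => G y j l) x + pd D j (fun y => G y i l) x - pd D l (fun y => G y i j) x) =
      (if k = l then a₁ x / a x * (x i * (if j = l then 1 else 0) +
        x j * (if i = l then 1 else 0)) + (2 * b x - a₁ x) / a x * (if i = j then 1 else 0) * x l
        + b₁ x / a x * (x i * x j * x l) else 0) -
      (if j = l then b x / a x * a₁ x * (x k * x l * x i) else 0) -
      (if i = l then b x / a x * a₁ x * (x k * x l * x j) else 0) -
      b x / a x * (x k * ((2 * b x - a₁ x) * (if i = j then 1 else 0) + b₁ x * (x i * x j))) *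
        (x l * x l) := by
    intro l
    rw [h.inv_apply hx, h.pd_metric hx, h.pd_metric hx, h.pd_metric hx]
    by_cases h1 : i = j
    · subst h1; by_cases h2 : i = l
      · subst h2; split_ifs <;> field_simp <;> ring
      · simp only [h2, Ne.symm h2, if_false, if_true]; split_ifs <;> field_simp <;> ring
    · simp only [h1, Ne.symm h1, if_false]
      by_cases h2 : i = l
      · subst h2; simp only [h1, Ne.symm h1, if_false]; split_ifs <;> field_simp <;> ring
      · simp only [h2, Ne.symm h2, if_false]
        by_cases h3 : j = l
        · subst h3; split_ifs <;> field_simp <;> ring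
        · simp only [h3, Ne.symm h3, if_false]; split_ifs <;> field_simp <;> ring
  rw [christoffel]
  simp only [h1, Finset.sum_sub_distrib, Finset.sum_ite_eq,
      Finset.mem_univ, if_true, ← Finset.mul_sum, sum_mul_self_eq]
  generalize (if i = j then (1 : ℝ) else 0) = d
  generalize (if j = k then (1 : ℝ) else 0) = d1
  generalize (if i = k then (1 : ℝ) else 0) = d2
  field_simp
  linear_combination (-(2 * b x - a₁ x) * d * x k - b₁ x * x i * x j * x k) * hr

end IsRadialMetric

end RotSym

/-! ### The Ricci tensor from rotationally invariant Christoffel symbols -/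

namespace RotSym

open Set Filter Topology MeasureTheory

variable {m : ℕ} {D : Set (EuclideanSpace ℝ (Fin m))}
  {G : EuclideanSpace ℝ (Fin m) → Matrix (Fin m) (Fin m) ℝ}

/-- The quadratic term `Γᵏⱼₗ Γˡᵢₖ` of the Ricci tensor, for symbols with coefficients `p`, `q`, `t`.
By rotational invariance only `δᵢⱼ` and `xᵢ xⱼ` can occur in the result. -/
lemma sum_christoffel_mul_christoffel (x : EuclideanSpace ℝ (Fin m)) (p q t : ℝ) (i j : Fin m) :
    ∑ k, ∑ l, (p * (x j * (if l = k then 1 else 0) + x l * (if j = k then 1 else 0)) +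
        q * ((if j = l then 1 else 0) * x k) + t * (x j * x l * x k)) *
      (p * (x i * (if k = l then 1 else 0) + x k * (if i = l then 1 else 0)) +
        q * ((if i = k then 1 else 0) * x l) + t * (x i * x k * x l)) =
    (if i = j then 1 else 0) * (2 * ‖x‖ ^ 2 * p * q) +
      (((m : ℝ) + 3) * p ^ 2 + 2 * p * q + 4 * ‖x‖ ^ 2 * p * t + q ^ 2 + 2 * ‖x‖ ^ 2 * q * t +
        (‖x‖ ^ 2) ^ 2 * t ^ 2) * (x i * x j) := by
  have key : ∀ k l, (p * (x j * (if l = k then 1 else 0) + x l * (if j = k then 1 else 0)) +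
        q * ((if j = l then 1 else 0) * x k) + t * (x j * x l * x k)) *
      (p * (x i * (if k = l then 1 else 0) + x k * (if i = l then 1 else 0)) +
        q * ((if i = k then 1 else 0) * x l) + t * (x i * x k * x l)) =
      (if k = l then p ^ 2 * (x i * x j) + 2 * p * t * (x i * x j) * (x l * x l) else 0) +
      (if k = l then (if i = l then p ^ 2 * x j * x l else 0) else 0) +
      (if k = l then (if i = k then p * q * x j * x l else 0) else 0) +
      (if k = l then (if j = k then p ^ 2 * x i * x l else 0) else 0) +
      (if j = k then (if i = l then p ^ 2 * x l * x k else 0) else 0) +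
      (if j = k then (if i = k then p * q * (x l * x l) else 0) else 0) +
      (if j = k then p * t * (x i * x k) * (x l * x l) else 0) +
      (if k = l then (if j = l then p * q * x i * x k else 0) else 0) +
      (if j = l then (if i = l then p * q * (x k * x k) else 0) else 0) +
      (if j = l then (if i = k then q ^ 2 * x k * x l else 0) else 0) +
      (if j = l then q * t * (x i * x l) * (x k * x k) else 0) +
      (if i = l then p * t * (x j * x l) * (x k * x k) else 0) +
      (if i = k then q * t * (x j * x k) * (x l * x l) else 0) +
      t ^ 2 * (x i * x j) * (x l * x l) * (x k * x k) := by
    intro k l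
    by_cases h1 : k = l
    · subst h1; split_ifs <;> ring
    · simp only [h1, Ne.symm h1, if_false]
      split_ifs <;> ring
  simp only [key, Finset.sum_add_distrib, Finset.sum_ite_eq, Finset.sum_ite_irrel,
    Finset.mem_univ, if_true, ← Finset.mul_sum, ← Finset.sum_mul, sum_mul_self_eq,
    Finset.sum_const_zero, Finset.sum_const, Finset.card_univ, Fintype.card_fin, nsmul_eq_mul]
  by_cases h : i = j
  · subst h; simp; ring
  · simp [h]; ring

/-- The Ricci tensor of a rotationally symmetric metric, from its Christoffel symbols. -/
lemma ricci_eq_of_christoffel_eq (hD : UniqueDiffOn ℝ D)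
    {p p₁ q q₁ t t₁ : EuclideanSpace ℝ (Fin m) → ℝ}
    (hΓ : ∀ y ∈ D, ∀ k i j, christoffel D G k i j y =
      p y * (y i * (if j = k then 1 else 0) + y j * (if i = k then 1 else 0)) +
      q y * ((if i = j then 1 else 0) * y k) + t y * (y i * y j * y k))
    (hp : HasRadialDeriv D p p₁) (hq : HasRadialDeriv D q q₁) (ht : HasRadialDeriv D t t₁)
    {x : EuclideanSpace ℝ (Fin m)} (hx : x ∈ D) (i j : Fin m) :
    ricci D G i j x =
      (if i = j then 1 else 0) * (2 * p x + ‖x‖ ^ 2 * q₁ x + m * q x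
        - ((m + 1) * p x + q x + ‖x‖ ^ 2 * t x)
        + ‖x‖ ^ 2 * q x * ((m + 1) * p x + q x + ‖x‖ ^ 2 * t x) - 2 * ‖x‖ ^ 2 * p x * q x) +
      (x i * x j) * (2 * p₁ x + ‖x‖ ^ 2 * t₁ x + (m + 2) * t x
        - ((m + 1) * p₁ x + q₁ x + ‖x‖ ^ 2 * t₁ x + 2 * t x)
        + ((m + 1) * p x + q x + ‖x‖ ^ 2 * t x) * (2 * p x + ‖x‖ ^ 2 * t x)
        - ((m + 3) * p x ^ 2 + 2 * p x * q x + 4 * ‖x‖ ^ 2 * p x * t x + q x ^ 2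
          + 2 * ‖x‖ ^ 2 * q x * t x + (‖x‖ ^ 2) ^ 2 * t x ^ 2)) := by
  have hpd : ∀ l k i j, pd D l (christoffel D G k i j) x =
      p₁ x * x l * (x i * (if j = k then 1 else 0) + x j * (if i = k then 1 else 0)) +
      p x * ((if i = l then 1 else 0) * (if j = k then 1 else 0) +
        (if j = l then 1 else 0) * (if i = k then 1 else 0)) +
      q₁ x * x l * ((if i = j then 1 else 0) * x k) +
      q x * ((if i = j then 1 else 0) * (if k = l then 1 else 0)) +
      t₁ x * x l * (x i * x j * x k) +
      t x * ((if i = l then 1 else 0) * x j * x k + (if j = l then 1 else 0) * x i * x k +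
        (if k = l then 1 else 0) * x i * x j) := by
    intro l k i j
    rw [pd_congr (fun y hy => hΓ y hy k i j) hx]
    refine (pd_eq hD hx ((((hp x hx).mul (((hasFDerivWithinAt_coord x i).mul_const _).add
      ((hasFDerivWithinAt_coord x j).mul_const _))).add ((hq x hx).mul
      ((hasFDerivWithinAt_coord x k).const_mul _))).add ((ht x hx).mul
      (((hasFDerivWithinAt_coord x i).mul (hasFDerivWithinAt_coord x j)).mul
        (hasFDerivWithinAt_coord x k)))) l).trans ?_
    simp only [add_apply, smul_apply, smul_eq_mul, innerSL_single, proj_single, Pi.mul_apply,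
      Pi.add_apply]
    ring
  have h1 : ∀ k, pd D k (christoffel D G k i j) x - pd D j (christoffel D G k i k) x =
      (if j = k then p₁ x * x i * x k else 0) + (if i = k then p₁ x * x j * x k else 0) +
      (if i = k then (if j = k then 2 * p x else 0) else 0) +
      q₁ x * (if i = j then 1 else 0) * (x k * x k) + q x * (if i = j then 1 else 0) +
      t₁ x * x i * x j * (x k * x k) + (if i = k then t x * x j * x k else 0) +
      (if j = k then t x * x i * x k else 0) + t x * x i * x j -
      p₁ x * x j * x i - (if i = k then p₁ x * x j * x k else 0) - p x * (if i = j then 1 else 0) -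
      (if j = k then (if i = k then p x else 0) else 0) -
      (if i = k then q₁ x * x j * x k else 0) -
      (if i = k then (if j = k then q x else 0) else 0) - t₁ x * x j * x i * (x k * x k) -
      t x * (if i = j then 1 else 0) * (x k * x k) - (if j = k then 2 * t x * x i * x k else 0) := by
    intro k
    rw [hpd, hpd]
    by_cases h1 : i = k
    · subst h1
      by_cases h2 : i = j
      · subst h2; simp; ring
      · simp [h2, Ne.symm h2]; ring
    · by_cases h2 : j = k
      · subst h2; simp [h1]; ring
      · simp [h1, h2, Ne.symm h2]; split_ifs <;> ring
  have h2 : ∑ k, ∑ l, (christoffel D G k k l x * christoffel D G l i j x) =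
      ((m + 1) * p x + q x + ‖x‖ ^ 2 * t x) * (2 * p x * (x i * x j) +
        q x * (if i = j then 1 else 0) * ‖x‖ ^ 2 + t x * (x i * x j) * ‖x‖ ^ 2) := by
    have h3 : ∀ l, ∑ k, christoffel D G k k l x = ((m + 1) * p x + q x + ‖x‖ ^ 2 * t x) * x l := by
      intro l
      have : ∀ k, christoffel D G k k l x = (if l = k then p x * x k else 0) + p x * x l +
          (if l = k then q x * x k else 0) + t x * x l * (x k * x k) := by
        intro k
        rw [hΓ x hx]
        by_cases h : l = k
        · subst h; simp; ring
        · simp [h, Ne.symm h]; ring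
      simp only [this, Finset.sum_add_distrib, Finset.sum_ite_eq, Finset.mem_univ, if_true,
        ← Finset.mul_sum, sum_mul_self_eq, Finset.sum_const, Finset.card_univ, Fintype.card_fin,
        nsmul_eq_mul]
      ring
    rw [Finset.sum_comm]
    simp only [← Finset.sum_mul, h3]
    have h4 : ∀ l, ((m + 1) * p x + q x + ‖x‖ ^ 2 * t x) * x l * christoffel D G l i j x =
        ((m + 1) * p x + q x + ‖x‖ ^ 2 * t x) * ((if j = l then p x * (x i * x l) else 0) +
        (if i = l then p x * (x j * x l) else 0) + q x * (if i = j then 1 else 0) * (x l * x l) +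
        t x * (x i * x j) * (x l * x l)) := by
      intro l
      rw [hΓ x hx]
      split_ifs <;> ring
    simp only [h4, ← Finset.mul_sum, Finset.sum_add_distrib, Finset.sum_ite_eq, Finset.mem_univ,
      if_true, sum_mul_self_eq]
    ring
  have h3 : ∑ k, ∑ l, (christoffel D G k j l x * christoffel D G l i k x) =
      (if i = j then 1 else 0) * (2 * ‖x‖ ^ 2 * p x * q x) +
      ((m + 3) * p x ^ 2 + 2 * p x * q x + 4 * ‖x‖ ^ 2 * p x * t x + q x ^ 2
        + 2 * ‖x‖ ^ 2 * q x * t x + (‖x‖ ^ 2) ^ 2 * t x ^ 2) * (x i * x j) := by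
    rw [← sum_christoffel_mul_christoffel]
    refine Finset.sum_congr rfl fun k _ => Finset.sum_congr rfl fun l _ => ?_
    rw [hΓ x hx, hΓ x hx]
  rw [ricci]
  have h4 : ∑ k, ∑ l, (christoffel D G k k l x * christoffel D G l i j x -
      christoffel D G k j l x * christoffel D G l i k x) =
      ∑ k, ∑ l, (christoffel D G k k l x * christoffel D G l i j x) -
      ∑ k, ∑ l, (christoffel D G k j l x * christoffel D G l i k x) := by
    simp only [Finset.sum_sub_distrib]
  rw [h4, h2, h3]
  simp only [h1, Finset.sum_add_distrib, Finset.sum_sub_distrib, Finset.sum_ite_eq,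
    Finset.mem_univ, if_true, ← Finset.mul_sum, sum_mul_self_eq, Finset.sum_const,
    Finset.card_univ, Fintype.card_fin, nsmul_eq_mul]
  by_cases h : i = j
  · subst h; simp; ring
  · simp [h, Ne.symm h]; ring

end RotSym

/-! ### Ricci and scalar curvature of a radial metric -/

namespace RotSym

open Set Filter Topology MeasureTheory

variable {m : ℕ} {D : Set (EuclideanSpace ℝ (Fin m))}
  {G : EuclideanSpace ℝ (Fin m) → Matrix (Fin m) (Fin m) ℝ}
  {a a₁ a₂ b b₁ b₂ : EuclideanSpace ℝ (Fin m) → ℝ} {x : EuclideanSpace ℝ (Fin m)}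

/-- The coefficient of `δᵢⱼ` in the Ricci tensor, from the values `ρ = ‖x‖²`, `a`, ... at `x`. -/
noncomputable def ricciCoeff (m : ℕ) (ρ a a₁ a₂ b b₁ : ℝ) : ℝ :=
  2 * (a₁ / (2 * a)) + ρ * (b₁ - a₂ / 2) + m * (b - a₁ / 2)
    - ((m + 1) * (a₁ / (2 * a)) + (b - a₁ / 2) + ρ * (b₁ / 2 - a₁ * b / a))
    + ρ * (b - a₁ / 2) * ((m + 1) * (a₁ / (2 * a)) + (b - a₁ / 2) + ρ * (b₁ / 2 - a₁ * b / a))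
    - 2 * ρ * (a₁ / (2 * a)) * (b - a₁ / 2)

/-- The coefficient of `xᵢ xⱼ` in the Ricci tensor, from the values `ρ = ‖x‖²`, `a`, ... at `x`. -/
noncomputable def ricciCoeff' (m : ℕ) (ρ a a₁ a₂ b b₁ b₂ : ℝ) : ℝ :=
  2 * ((a₂ * (2 * a) - a₁ * (2 * a₁)) / (2 * a) ^ 2)
    + ρ * (b₂ / 2 - ((a₁ * b₁ + b * a₂) * a - a₁ * b * a₁) / a ^ 2)
    + (m + 2) * (b₁ / 2 - a₁ * b / a)
    - ((m + 1) * ((a₂ * (2 * a) - a₁ * (2 * a₁)) / (2 * a) ^ 2) + (b₁ - a₂ / 2)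
      + ρ * (b₂ / 2 - ((a₁ * b₁ + b * a₂) * a - a₁ * b * a₁) / a ^ 2)
      + 2 * (b₁ / 2 - a₁ * b / a))
    + ((m + 1) * (a₁ / (2 * a)) + (b - a₁ / 2) + ρ * (b₁ / 2 - a₁ * b / a))
      * (2 * (a₁ / (2 * a)) + ρ * (b₁ / 2 - a₁ * b / a))
    - ((m + 3) * (a₁ / (2 * a)) ^ 2 + 2 * (a₁ / (2 * a)) * (b - a₁ / 2)
      + 4 * ρ * (a₁ / (2 * a)) * (b₁ / 2 - a₁ * b / a) + (b - a₁ / 2) ^ 2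
      + 2 * ρ * (b - a₁ / 2) * (b₁ / 2 - a₁ * b / a) + ρ ^ 2 * (b₁ / 2 - a₁ * b / a) ^ 2)

namespace IsRadialMetric

lemma ricci_eq (h : IsRadialMetric D G a a₁ a₂ b b₁ b₂) (hx : x ∈ D) (i j : Fin m) :
    ricci D G i j x =
      (if i = j then 1 else 0) * ricciCoeff m (‖x‖ ^ 2) (a x) (a₁ x) (a₂ x) (b x) (b₁ x) +
      (x i * x j) * ricciCoeff' m (‖x‖ ^ 2) (a x) (a₁ x) (a₂ x) (b x) (b₁ x) (b₂ x) := by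
  -- `p`, `q`, `t` are the coefficients found in `christoffel_eq`; the quotient rule gives their
  -- radial derivatives.
  have hp : HasRadialDeriv D (fun x => a₁ x / (2 * a x))
      (fun x => (a₂ x * (2 * a x) - a₁ x * (2 * a₁ x)) / (2 * a x) ^ 2) := by
    refine h.deriv_a₁.div (fun y hy => ?_) fun y hy => mul_ne_zero two_ne_zero (h.pos y hy).ne'
    simpa using ((HasRadialDeriv.const 2).mul h.deriv_a) y hy
  have hq : HasRadialDeriv D (fun x => b x - a₁ x / 2) (fun x => b₁ x - a₂ x / 2) := by
    refine h.deriv_b.sub fun y hy => ?_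
    have := (h.deriv_a₁.div (HasRadialDeriv.const 2) fun _ _ => two_ne_zero) y hy
    convert this using 2
    ring
  have ht : HasRadialDeriv D (fun x => b₁ x / 2 - a₁ x * b x / a x)
      (fun x => b₂ x / 2 - ((a₁ x * b₁ x + b x * a₂ x) * a x - a₁ x * b x * a₁ x) / a x ^ 2) := by
    refine HasRadialDeriv.sub (fun y hy => ?_)
      ((h.deriv_a₁.mul h.deriv_b).div h.deriv_a fun y hy => (h.pos y hy).ne')
    have := (h.deriv_b₁.div (HasRadialDeriv.const 2) fun _ _ => two_ne_zero) y hy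
    convert this using 2
    ring
  exact ricci_eq_of_christoffel_eq h.uniqueDiffOn (fun y hy k i j => h.christoffel_eq hy k i j)
    hp hq ht hx i j

/-- With `r`, `r'` the coefficients of `δᵢⱼ` and `xᵢ xⱼ`, the Ricci tensor has the eigenvalue `r /
a` on the `m - 1` tangential directions and `r + ‖x‖² r'` in the radial direction. -/
lemma scalarCurvature_eq (h : IsRadialMetric D G a a₁ a₂ b b₁ b₂) (hx : x ∈ D) :
    scalarCurvature D G x =
      ((m - 1) * ricciCoeff m (‖x‖ ^ 2) (a x) (a₁ x) (a₂ x) (b x) (b₁ x) / a x +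
        (ricciCoeff m (‖x‖ ^ 2) (a x) (a₁ x) (a₂ x) (b x) (b₁ x) +
          ‖x‖ ^ 2 * ricciCoeff' m (‖x‖ ^ 2) (a x) (a₁ x) (a₂ x) (b x) (b₁ x) (b₂ x))) := by
  have ha := (h.pos x hx).ne'
  have hr := h.radial_length x hx
  rw [scalarCurvature]
  simp only [h.ricci_eq hx, h.inv_apply hx]
  generalize ricciCoeff m (‖x‖ ^ 2) (a x) (a₁ x) (a₂ x) (b x) (b₁ x) = r
  generalize ricciCoeff' m (‖x‖ ^ 2) (a x) (a₁ x) (a₂ x) (b x) (b₁ x) (b₂ x) = r'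
  have key : ∀ i j, ((if i = j then 1 else 0) / a x - b x / a x * (x i * x j)) *
      ((if i = j then 1 else 0) * r + x i * x j * r') =
      (if i = j then r / a x + (r' / a x - b x / a x * r) * (x i * x i) else 0) -
        b x / a x * r' * (x i * x i) * (x j * x j) := by
    intro i j
    by_cases h : i = j
    · subst h; simp; ring
    · simp [h]; ring
  simp only [key, Finset.sum_add_distrib, Finset.sum_sub_distrib, Finset.sum_ite_eq,
    Finset.mem_univ, if_true, ← Finset.mul_sum, ← Finset.sum_mul, sum_mul_self_eq,
    Finset.sum_const, Finset.card_univ, Fintype.card_fin, nsmul_eq_mul]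
  field_simp
  linear_combination (-r - ‖x‖ ^ 2 * r') * hr

/-- Carries the sign of the scalar curvature from the open part to the pole or the boundary. -/
lemma continuousOn_scalarCurvature (h : IsRadialMetric D G a a₁ a₂ b b₁ b₂)
    (ha₂ : ContinuousOn a₂ D) (hb₂ : ContinuousOn b₂ D) :
    ContinuousOn (scalarCurvature D G) D := by
  have h1 := h.deriv_a.continuousOn
  have h2 := h.deriv_a₁.continuousOn
  have h3 := h.deriv_b.continuousOn
  have h4 := h.deriv_b₁.continuousOn
  have h5 : ∀ x ∈ D, a x ≠ 0 := fun x hx => (h.pos x hx).ne'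
  have h6 : ∀ x ∈ D, 2 * a x ≠ 0 := fun x hx => mul_ne_zero two_ne_zero (h5 x hx)
  have h7 : ∀ x ∈ D, a x ^ 2 ≠ 0 := fun x hx => pow_ne_zero 2 (h5 x hx)
  have h8 : ∀ x ∈ D, (2 * a x) ^ 2 ≠ 0 := fun x hx => pow_ne_zero 2 (h6 x hx)
  refine ContinuousOn.congr ?_ fun x hx => h.scalarCurvature_eq hx
  unfold ricciCoeff ricciCoeff'
  fun_prop (disch := assumption)

end IsRadialMetric

end RotSym

/-! ### Radial metrics warped by a function of the radius -/

namespace RotSym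

open Set Filter Topology MeasureTheory

variable {m : ℕ} {D : Set (EuclideanSpace ℝ (Fin m))}
  {G : EuclideanSpace ℝ (Fin m) → Matrix (Fin m) (Fin m) ℝ}
  {a a₁ a₂ b b₁ b₂ F F₁ F₂ : EuclideanSpace ℝ (Fin m) → ℝ} {x : EuclideanSpace ℝ (Fin m)}

namespace HasRadialDeriv

lemma mono {D' : Set (EuclideanSpace ℝ (Fin m))} (h : HasRadialDeriv D a a₁) (hD : D' ⊆ D) :
    HasRadialDeriv D' a a₁ := fun x hx => (h x (hD hx)).mono hD

/-- Evaluating both derivatives on `x` itself gives the coefficient times `‖x‖²`. So identities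
between radial functions may be differentiated coefficientwise away from the origin. -/
lemma unique (hD : UniqueDiffOn ℝ D) (h : HasRadialDeriv D a a₁) (h' : HasRadialDeriv D b b₁)
    (hab : EqOn a b D) (hx : x ∈ D) (h0 : x ≠ 0) : a₁ x = b₁ x := by
  have h1 := (hD x hx).eq (h x hx) ((h' x hx).congr hab (hab hx))
  have h2 := DFunLike.congr_fun h1 x
  simp only [smul_apply, innerSL_apply_apply, real_inner_self_eq_norm_sq, smul_eq_mul] at h2
  exact mul_right_cancel₀ (pow_ne_zero 2 (norm_ne_zero_iff.2 h0)) h2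

end HasRadialDeriv

/-- A radial metric is warped by `F` if `‖x‖² a = F²`, where `F` is a function of the radius with
first and second derivatives `F₁` and `F₂`. -/
structure IsWarpedMetric (D : Set (EuclideanSpace ℝ (Fin m)))
    (G : EuclideanSpace ℝ (Fin m) → Matrix (Fin m) (Fin m) ℝ)
    (a a₁ a₂ b b₁ b₂ F F₁ F₂ : EuclideanSpace ℝ (Fin m) → ℝ) : Prop
    extends IsRadialMetric D G a a₁ a₂ b b₁ b₂ where
  sq_eq : ∀ x ∈ D, ‖x‖ ^ 2 * a x = F x ^ 2
  warp_pos : ∀ x ∈ D, x ≠ 0 → 0 < F x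
  deriv_warp : HasRadialDeriv (D ∩ {0}ᶜ) F (fun x => F₁ x / ‖x‖)
  deriv_warp₁ : HasRadialDeriv (D ∩ {0}ᶜ) F₁ (fun x => F₂ x / ‖x‖)

lemma HasRadialDeriv.norm : HasRadialDeriv (D ∩ {0}ᶜ) (fun x => ‖x‖) (fun x => 1 / ‖x‖) := by
  intro x hx
  have h0 : ‖x‖ ≠ 0 := norm_ne_zero_iff.2 hx.2
  have h1 := (Real.hasDerivAt_sqrt (pow_ne_zero 2 h0)).comp_hasFDerivWithinAt x
    ((hasStrictFDerivAt_norm_sq x).hasFDerivAt.hasFDerivWithinAt (s := D ∩ {0}ᶜ))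
  have h2 : Real.sqrt ∘ (fun x : EuclideanSpace ℝ (Fin m) => ‖x‖ ^ 2) = fun x => ‖x‖ := by
    ext y; simp
  rw [h2] at h1
  refine h1.congr_fderiv ?_
  ext v
  simp
  field_simp

namespace IsWarpedMetric

/-- Differentiating `‖x‖² a = F²` and `a + ‖x‖² b = 1` twice, and comparing radial derivatives,
expresses every coefficient through `F`, `F'`, `F''` and `‖x‖`. -/
lemma values (h : IsWarpedMetric D G a a₁ a₂ b b₁ b₂ F F₁ F₂) (hx : x ∈ D) (h0 : x ≠ 0) :
    a x = F x ^ 2 / ‖x‖ ^ 2 ∧ a₁ x = 2 * F x * F₁ x / ‖x‖ ^ 3 - 2 * F x ^ 2 / ‖x‖ ^ 4 ∧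
    a₂ x = ((2 * F₁ x ^ 2 + 2 * F x * F₂ x) / ‖x‖ ^ 2 - 2 * F x * F₁ x / ‖x‖ ^ 3 - 4 * a₁ x) /
      ‖x‖ ^ 2 ∧
    b x = (1 - a x) / ‖x‖ ^ 2 ∧ b₁ x = - (a₁ x + 2 * b x) / ‖x‖ ^ 2 ∧
    b₂ x = -(a₂ x + 4 * b₁ x) / ‖x‖ ^ 2 := by
  have hD' : UniqueDiffOn ℝ (D ∩ {0}ᶜ) := h.uniqueDiffOn.inter isOpen_compl_singleton
  have hs : D ∩ {0}ᶜ ⊆ D := inter_subset_left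
  have hne : ∀ y ∈ D ∩ {0}ᶜ, ‖y‖ ≠ 0 := fun y hy => norm_ne_zero_iff.2 hy.2
  have hr := hne x ⟨hx, h0⟩
  have e1 : ∀ y ∈ D ∩ {0}ᶜ, ‖y‖ ^ 2 * a₁ y + 2 * a y = 2 * F y * F₁ y / ‖y‖ := by
    intro y hy
    have := (HasRadialDeriv.normSq.mul (h.deriv_a.mono hs)).unique hD'
      (h.deriv_warp.mul h.deriv_warp) (fun z hz => by
        show ‖z‖ ^ 2 * a z = F z * F z
        rw [h.sq_eq z hz.1, sq]) hy hy.2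
    linear_combination this
  have e2 : ‖x‖ ^ 2 * a₂ x + 4 * a₁ x =
      (2 * F₁ x ^ 2 + 2 * F x * F₂ x) / ‖x‖ ^ 2 - 2 * F x * F₁ x / ‖x‖ ^ 3 := by
    have := ((HasRadialDeriv.normSq.mul (h.deriv_a₁.mono hs)).add
      ((HasRadialDeriv.const 2).mul (h.deriv_a.mono hs))).unique hD'
      ((((HasRadialDeriv.const 2).mul h.deriv_warp).mul h.deriv_warp₁).div HasRadialDeriv.norm hne)
      e1 ⟨hx, h0⟩ h0
    field_simp at this ⊢
    linear_combination this
  have e3 : ∀ y ∈ D ∩ {0}ᶜ, a₁ y + (‖y‖ ^ 2 * b₁ y + b y * 2) = 0 := fun y hy =>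
    ((h.deriv_a.add (HasRadialDeriv.normSq.mul h.deriv_b)).mono hs).unique hD'
      (HasRadialDeriv.const 1) (fun z hz => h.radial_length z hz.1) hy hy.2
  have e4 : a₂ x + 4 * b₁ x + ‖x‖ ^ 2 * b₂ x = 0 := by
    have := ((h.deriv_a₁.add ((HasRadialDeriv.normSq.mul h.deriv_b₁).add
      (h.deriv_b.mul (HasRadialDeriv.const 2)))).mono hs).unique hD'
      (HasRadialDeriv.const 0) e3 ⟨hx, h0⟩ h0
    linear_combination this
  have e0 := h.sq_eq x hx
  have e1' := e1 x ⟨hx, h0⟩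
  have e3' := e3 x ⟨hx, h0⟩
  have e5 := h.radial_length x hx
  refine ⟨?_, ?_, ?_, ?_, ?_, ?_⟩
  · field_simp; linear_combination e0
  · field_simp at e1' ⊢; linear_combination ‖x‖ * e1' - 2 * e0
  · rw [eq_div_iff (pow_ne_zero 2 hr)]; linear_combination e2
  · rw [eq_div_iff (pow_ne_zero 2 hr)]; linear_combination e5
  · rw [eq_div_iff (pow_ne_zero 2 hr)]; linear_combination e3'
  · rw [eq_div_iff (pow_ne_zero 2 hr)]; linear_combination e4

/-- The Ricci curvature in the radial direction is `-(m-1) F'' / F`. -/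
lemma ricciCoeff_radial (h : IsWarpedMetric D G a a₁ a₂ b b₁ b₂ F F₁ F₂) (hx : x ∈ D)
    (h0 : x ≠ 0) :
    ricciCoeff m (‖x‖ ^ 2) (a x) (a₁ x) (a₂ x) (b x) (b₁ x) +
      ‖x‖ ^ 2 * ricciCoeff' m (‖x‖ ^ 2) (a x) (a₁ x) (a₂ x) (b x) (b₁ x) (b₂ x) =
    -(m - 1) * F₂ x / F x := by
  obtain ⟨e0, e1, e2, e3, e4, e5⟩ := h.values hx h0
  have hr : ‖x‖ ≠ 0 := norm_ne_zero_iff.2 h0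
  have hF := (h.warp_pos x hx h0).ne'
  rw [e5, e4, e3, e2, e1, e0]
  generalize ‖x‖ = r at *
  generalize F x = f at *
  generalize F₁ x = f₁ at *
  generalize F₂ x = f₂ at *
  unfold ricciCoeff ricciCoeff'
  field_simp
  ring

/-- The Ricci curvature in the tangential directions of the symmetric spheres. -/
lemma ricciCoeff_tangential (h : IsWarpedMetric D G a a₁ a₂ b b₁ b₂ F F₁ F₂) (hx : x ∈ D)
    (h0 : x ≠ 0) :
    ricciCoeff m (‖x‖ ^ 2) (a x) (a₁ x) (a₂ x) (b x) (b₁ x) / a x =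
      (m - 2) * (1 - F₁ x ^ 2) / F x ^ 2 - F₂ x / F x := by
  obtain ⟨e0, e1, e2, e3, e4, -⟩ := h.values hx h0
  have hr : ‖x‖ ≠ 0 := norm_ne_zero_iff.2 h0
  have hF := (h.warp_pos x hx h0).ne'
  rw [e4, e3, e2, e1, e0]
  generalize ‖x‖ = r at *
  generalize F x = f at *
  generalize F₁ x = f₁ at *
  generalize F₂ x = f₂ at *
  unfold ricciCoeff
  field_simp
  ring

/-- The sum of one radial and `m - 1` tangential Ricci curvatures. The last factor is the one that
appears in `IsSmoothWarp.hasDerivAt_hawkingMass`. -/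
lemma scalarCurvature_eq (h : IsWarpedMetric D G a a₁ a₂ b b₁ b₂ F F₁ F₂) (hx : x ∈ D)
    (h0 : x ≠ 0) :
    scalarCurvature D G x =
      (m - 1) / F x ^ 2 * ((m - 2) * (1 - F₁ x ^ 2) - 2 * F x * F₂ x) := by
  have hF := (h.warp_pos x hx h0).ne'
  rw [h.toIsRadialMetric.scalarCurvature_eq hx, h.ricciCoeff_radial hx h0, mul_div_assoc,
    h.ricciCoeff_tangential hx h0]
  field_simp
  ring

/-- The coefficient of the Christoffel symbols that enters the second fundamental form of the
symmetric spheres. -/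
lemma christoffel_coeff (h : IsWarpedMetric D G a a₁ a₂ b b₁ b₂ F F₁ F₂) (hx : x ∈ D)
    (h0 : x ≠ 0) : ‖x‖ ^ 2 * (b x - a₁ x / 2) = 1 - F x * F₁ x / ‖x‖ := by
  obtain ⟨e0, e1, -, e3, -, -⟩ := h.values hx h0
  have hr : ‖x‖ ≠ 0 := norm_ne_zero_iff.2 h0
  rw [e3, e1, e0]
  field_simp
  ring

end IsWarpedMetric

end RotSym

namespace RotSym

open Set Filter Topology MeasureTheory

variable {m : ℕ} {D : Set (EuclideanSpace ℝ (Fin m))}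
  {G : EuclideanSpace ℝ (Fin m) → Matrix (Fin m) (Fin m) ℝ}
  {a a₁ a₂ b b₁ b₂ F F₁ F₂ : EuclideanSpace ℝ (Fin m) → ℝ} {x : EuclideanSpace ℝ (Fin m)}
  {u : EuclideanSpace ℝ (Fin m) → ℝ} {c : ℝ}

lemma pd_congr_of_eventuallyEq {f g : EuclideanSpace ℝ (Fin m) → ℝ} (h : f =ᶠ[𝓝[D] x] g)
    (hx : x ∈ D) (i : Fin m) : pd D i f x = pd D i g x := by
  rw [pd, pd, h.fderivWithin_eq_of_mem hx]

/-! ### Level sets tangent to the symmetric spheres -/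

namespace IsRadialMetric

/-- Since the radial part has length one, raising the index of the radial covector `x` changes
nothing. -/
lemma sum_inv_mul (h : IsRadialMetric D G a a₁ a₂ b b₁ b₂) (hx : x ∈ D) (i : Fin m) :
    ∑ j, (G x)⁻¹ i j * x j = x i := by
  have ha := (h.pos x hx).ne'
  have key : ∀ j, (G x)⁻¹ i j * x j =
      (if i = j then x j / a x else 0) - b x / a x * x i * (x j * x j) := by
    intro j
    rw [h.inv_apply hx]
    split_ifs <;> ring
  simp only [key, Finset.sum_sub_distrib, Finset.sum_ite_eq, Finset.mem_univ, if_true,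
    ← Finset.mul_sum, sum_mul_self_eq]
  field_simp
  linear_combination (-x i) * h.radial_length x hx

/-- The hypothesis `hu` says that the level set of `u` is tangent at `x` to the symmetric sphere.
Nothing else about the first derivatives is needed, so the formulas serve both spheres and
hypersurfaces touching them. -/
lemma gradInner_eq (h : IsRadialMetric D G a a₁ a₂ b b₁ b₂) (hx : x ∈ D)
    (hu : ∀ j, pd D j u x = c * x j) : gradInner D G u u x = (c * ‖x‖) ^ 2 := by
  have key : ∀ i, ∑ j, (G x)⁻¹ i j * pd D i u x * pd D j u x = c ^ 2 * (x i * x i) := by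
    intro i
    have : ∀ j, (G x)⁻¹ i j * pd D i u x * pd D j u x = c ^ 2 * x i * ((G x)⁻¹ i j * x j) := by
      intro j; rw [hu, hu]; ring
    simp only [this, ← Finset.mul_sum, h.sum_inv_mul hx]
    ring
  simp only [gradInner, key, ← Finset.mul_sum, sum_mul_self_eq]
  ring

lemma unitNormal_eq (h : IsRadialMetric D G a a₁ a₂ b b₁ b₂) (hx : x ∈ D)
    (hu : ∀ j, pd D j u x = c * x j) (i : Fin m) :
    unitNormal D G u i x = c * x i / (|c| * ‖x‖) := by
  have : ∀ j, (G x)⁻¹ i j * pd D j u x = c * ((G x)⁻¹ i j * x j) := by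
    intro j; rw [hu]; ring
  rw [unitNormal, h.gradInner_eq hx hu, Real.sqrt_sq_eq_abs, abs_mul, abs_norm]
  simp only [this, ← Finset.mul_sum, h.sum_inv_mul hx]

lemma unitNormal_mul (h : IsRadialMetric D G a a₁ a₂ b b₁ b₂) (hx : x ∈ D) (h0 : x ≠ 0)
    (hu : ∀ j, pd D j u x = c * x j) (hc : c ≠ 0) (i j : Fin m) :
    unitNormal D G u i x * unitNormal D G u j x = x i * x j / ‖x‖ ^ 2 := by
  have hr : ‖x‖ ≠ 0 := norm_ne_zero_iff.2 h0
  have hc' : |c| ≠ 0 := abs_ne_zero.2 hc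
  rw [h.unitNormal_eq hx hu, h.unitNormal_eq hx hu]
  field_simp
  rw [sq_abs]
  ring

lemma tangentialInv_eq (h : IsRadialMetric D G a a₁ a₂ b b₁ b₂) (hx : x ∈ D) (h0 : x ≠ 0)
    (hu : ∀ j, pd D j u x = c * x j) (hc : c ≠ 0) (i j : Fin m) :
    tangentialInv D G u i j x = ((if i = j then 1 else 0) - x i * x j / ‖x‖ ^ 2) / a x := by
  have hr : ‖x‖ ≠ 0 := norm_ne_zero_iff.2 h0
  have ha := (h.pos x hx).ne'
  rw [tangentialInv, h.unitNormal_mul hx h0 hu hc, h.inv_apply hx]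
  field_simp
  linear_combination (-x i * x j) * h.radial_length x hx

lemma sum_tangentialInv_mul (h : IsRadialMetric D G a a₁ a₂ b b₁ b₂) (hx : x ∈ D) (h0 : x ≠ 0)
    (hu : ∀ j, pd D j u x = c * x j) (hc : c ≠ 0) (i : Fin m) :
    ∑ j, tangentialInv D G u i j x * x j = 0 := by
  have hr : ‖x‖ ≠ 0 := norm_ne_zero_iff.2 h0
  have key : ∀ j, tangentialInv D G u i j x * x j =
      (if i = j then x j / a x else 0) - x i / ‖x‖ ^ 2 / a x * (x j * x j) := by
    intro j
    rw [h.tangentialInv_eq hx h0 hu hc]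
    split_ifs <;> ring
  simp only [key, Finset.sum_sub_distrib, Finset.sum_ite_eq, Finset.mem_univ, if_true,
    ← Finset.mul_sum, sum_mul_self_eq]
  field_simp
  ring

lemma shapeForm_eq (h : IsRadialMetric D G a a₁ a₂ b b₁ b₂) (hx : x ∈ D)
    (hu : ∀ j, pd D j u x = c * x j) (i j : Fin m) :
    shapeForm D G u i j x = (pd D i (pd D j u) x -
      c * (‖x‖ ^ 2 * (b x - a₁ x / 2) * (if i = j then 1 else 0) +
        (2 * (a₁ x / (2 * a x)) + ‖x‖ ^ 2 * (b₁ x / 2 - a₁ x * b x / a x)) * (x i * x j))) /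
      (|c| * ‖x‖) := by
  have key : ∀ k, christoffel D G k i j x * pd D k u x =
      (if j = k then c * (a₁ x / (2 * a x)) * (x i * x k) else 0) +
      (if i = k then c * (a₁ x / (2 * a x)) * (x j * x k) else 0) +
      c * ((b x - a₁ x / 2) * (if i = j then 1 else 0) +
        (b₁ x / 2 - a₁ x * b x / a x) * (x i * x j)) * (x k * x k) := by
    intro k
    rw [h.christoffel_eq hx, hu]
    split_ifs <;> ring
  rw [shapeForm, h.gradInner_eq hx hu, Real.sqrt_sq_eq_abs, abs_mul, abs_norm]
  simp only [key, Finset.sum_add_distrib, Finset.sum_ite_eq, Finset.mem_univ, if_true,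
    ← Finset.mul_sum, sum_mul_self_eq]
  ring

end IsRadialMetric

/-- The projection orthogonal to `x` kills the term `t xᵢ xⱼ`. What remains is the trace of `A` over
the `m - 1` tangential directions, minus `(m - 1) s`. -/
lemma sum_tangential_mul (A : Fin m → Fin m → ℝ) (s t : ℝ) (h0 : x ≠ 0) :
    ∑ i, ∑ j, ((if i = j then 1 else 0) - x i * x j / ‖x‖ ^ 2) *
      (A i j - (s * (if i = j then 1 else 0) + t * (x i * x j))) =
    ∑ i, A i i - (∑ i, ∑ j, x i * x j * A i j) / ‖x‖ ^ 2 - (m - 1) * s := by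
  have hr : ‖x‖ ≠ 0 := norm_ne_zero_iff.2 h0
  have key : ∀ i j, ((if i = j then 1 else 0) - x i * x j / ‖x‖ ^ 2) *
      (A i j - (s * (if i = j then 1 else 0) + t * (x i * x j))) =
      (if i = j then A i j - s - t * (x i * x i) + s / ‖x‖ ^ 2 * (x i * x i) else 0) -
        x i * x j * A i j / ‖x‖ ^ 2 + t / ‖x‖ ^ 2 * (x i * x i) * (x j * x j) := by
    intro i j
    by_cases h : i = j
    · subst h; simp; ring
    · simp [h]; ring
  simp only [key, Finset.sum_add_distrib, Finset.sum_sub_distrib, Finset.sum_ite_eq,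
    Finset.mem_univ, if_true, ← Finset.mul_sum, ← Finset.sum_mul, sum_mul_self_eq,
    Finset.sum_const, Finset.card_univ, Fintype.card_fin, nsmul_eq_mul, ← Finset.sum_div]
  field_simp
  ring

namespace IsWarpedMetric

/-- Only tangency to the sphere at the single point `x` is assumed; the tangential Hessian of `u`
stays free and is compared with that of the sphere later. -/
lemma meanCurvature_eq (h : IsWarpedMetric D G a a₁ a₂ b b₁ b₂ F F₁ F₂) (hx : x ∈ D)
    (h0 : x ≠ 0) (hu : ∀ j, pd D j u x = c * x j) (hc : c ≠ 0) :
    meanCurvature D G u x =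
      (∑ i, pd D i (pd D i u) x - (∑ i, ∑ j, x i * x j * pd D i (pd D j u) x) / ‖x‖ ^ 2
        - (m - 1) * (c * (1 - F x * F₁ x / ‖x‖))) / (a x * (|c| * ‖x‖)) := by
  have ha := (h.pos x hx).ne'
  have hr : ‖x‖ ≠ 0 := norm_ne_zero_iff.2 h0
  have hc' : |c| ≠ 0 := abs_ne_zero.2 hc
  rw [meanCurvature, ← h.christoffel_coeff hx h0,
    ← sum_tangential_mul (fun i j => pd D i (pd D j u) x) (c * (‖x‖ ^ 2 * (b x - a₁ x / 2)))
      (c * (2 * (a₁ x / (2 * a x)) + ‖x‖ ^ 2 * (b₁ x / 2 - a₁ x * b x / a x))) h0]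
  simp only [Finset.sum_div]
  refine Finset.sum_congr rfl fun i _ => Finset.sum_congr rfl fun j _ => ?_
  rw [h.tangentialInv_eq hx h0 hu hc, h.shapeForm_eq hx hu]
  field_simp

/-- The second fundamental form of a symmetric sphere vanishes where `F' = 0`. -/
lemma secondFormSq_eq_zero (h : IsWarpedMetric D G a a₁ a₂ b b₁ b₂ F F₁ F₂) (hx : x ∈ D)
    (h0 : x ≠ 0) (hF : F₁ x = 0) (hu : ∀ j, pd D j u x = c * x j) (hc : c ≠ 0) {t : ℝ}
    (hH : ∀ i j, pd D i (pd D j u) x = c * (if i = j then 1 else 0) + t * (x i * x j)) :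
    secondFormSq D G u x = 0 := by
  have hr : ‖x‖ ≠ 0 := norm_ne_zero_iff.2 h0
  -- For `F' = 0` the Christoffel contribution to the `δᵢⱼ` part is exactly `c`, which cancels the
  -- `c` of the Hessian. The remaining multiple of `xᵢ xⱼ` is killed by the tangential projection.
  obtain ⟨d, hd⟩ : ∃ d, ∀ i j, shapeForm D G u i j x = d * (x i * x j) := by
    refine ⟨(t - c * (2 * (a₁ x / (2 * a x)) + ‖x‖ ^ 2 * (b₁ x / 2 - a₁ x * b x / a x))) /
      (|c| * ‖x‖), fun i j => ?_⟩
    rw [h.shapeForm_eq hx hu, hH, h.christoffel_coeff hx h0, hF]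
    ring
  have key : ∀ i j k, ∑ l, tangentialInv D G u i k x * tangentialInv D G u j l x *
      shapeForm D G u i j x * shapeForm D G u k l x = 0 := by
    intro i j k
    have : ∀ l, tangentialInv D G u i k x * tangentialInv D G u j l x *
        shapeForm D G u i j x * shapeForm D G u k l x =
        tangentialInv D G u i k x * shapeForm D G u i j x * d * x k *
          (tangentialInv D G u j l x * x l) := by
      intro l; rw [hd k l]; ring
    simp only [this, ← Finset.mul_sum, h.sum_tangentialInv_mul hx h0 hu hc, mul_zero]
  simp only [secondFormSq, key, Finset.sum_const_zero]

/-- The unit normal is `± x / ‖x‖`, so the contraction gives the radial Ricci curvature. -/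
lemma ricci_unitNormal (h : IsWarpedMetric D G a a₁ a₂ b b₁ b₂ F F₁ F₂) (hx : x ∈ D)
    (h0 : x ≠ 0) (hu : ∀ j, pd D j u x = c * x j) (hc : c ≠ 0) :
    ∑ i, ∑ j, ricci D G i j x * unitNormal D G u i x * unitNormal D G u j x =
      -(m - 1) * F₂ x / F x := by
  have hr : ‖x‖ ≠ 0 := norm_ne_zero_iff.2 h0
  rw [← h.ricciCoeff_radial hx h0]
  have key : ∀ i j, ricci D G i j x * unitNormal D G u i x * unitNormal D G u j x =
      (if i = j then ricciCoeff m (‖x‖ ^ 2) (a x) (a₁ x) (a₂ x) (b x) (b₁ x) / ‖x‖ ^ 2 *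
        (x i * x i) else 0) +
      ricciCoeff' m (‖x‖ ^ 2) (a x) (a₁ x) (a₂ x) (b x) (b₁ x) (b₂ x) / ‖x‖ ^ 2 *
        (x i * x i) * (x j * x j) := by
    intro i j
    rw [mul_assoc, h.unitNormal_mul hx h0 hu hc, h.ricci_eq hx]
    by_cases h : i = j
    · subst h; simp; ring
    · simp [h]; ring
  simp only [key, Finset.sum_add_distrib, Finset.sum_ite_eq, Finset.mem_univ, if_true,
    ← Finset.mul_sum, ← Finset.sum_mul, sum_mul_self_eq]
  field_simp

end IsWarpedMetric

lemma pd_norm_sub (hD : UniqueDiffOn ℝ D) (hx : x ∈ D) (h0 : x ≠ 0) (r : ℝ) (j : Fin m) :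
    pd D j (fun y => ‖y‖ - r) x = 1 / ‖x‖ * x j := by
  have h1 := (HasRadialDeriv.norm (D := D)).sub (HasRadialDeriv.const r) x ⟨hx, h0⟩
  have h2 := h1.mono_of_mem_nhdsWithin
    (inter_mem_nhdsWithin D (isOpen_compl_singleton.mem_nhds h0))
  refine (pd_eq hD hx h2 j).trans ?_
  simp only [smul_apply, smul_eq_mul, innerSL_single, sub_zero]

lemma pd_pd_norm_sub (hD : UniqueDiffOn ℝ D) (hx : x ∈ D) (h0 : x ≠ 0) (r : ℝ) (i j : Fin m) :
    pd D i (pd D j (fun y => ‖y‖ - r)) x =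
      1 / ‖x‖ * (if i = j then 1 else 0) + -(1 / ‖x‖ ^ 3) * (x i * x j) := by
  have hr : ‖x‖ ≠ 0 := norm_ne_zero_iff.2 h0
  have hmem := inter_mem_nhdsWithin D (isOpen_compl_singleton.mem_nhds h0)
  have h1 : pd D j (fun y => ‖y‖ - r) =ᶠ[𝓝[D] x] fun y => 1 / ‖y‖ * y j := by
    filter_upwards [hmem] with y hy
    exact pd_norm_sub hD hy.1 hy.2 r j
  have h2 := (((HasRadialDeriv.const 1).div (HasRadialDeriv.norm (D := D))
    fun y hy => norm_ne_zero_iff.2 hy.2) x ⟨hx, h0⟩).mono_of_mem_nhdsWithin hmem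
  rw [pd_congr_of_eventuallyEq h1 hx]
  refine (pd_eq hD hx (h2.mul (hasFDerivWithinAt_coord x j)) i).trans ?_
  simp only [add_apply, smul_apply, smul_eq_mul, innerSL_single, proj_single]
  rw [show (if j = i then (1 : ℝ) else 0) = if i = j then 1 else 0 by simp [eq_comm]]
  field_simp
  ring

/-- The mean curvature of the symmetric spheres is `(m-1) F' / F`. -/
lemma IsWarpedMetric.meanCurvature_norm (h : IsWarpedMetric D G a a₁ a₂ b b₁ b₂ F F₁ F₂)
    (hx : x ∈ D) (h0 : x ≠ 0) (r : ℝ) :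
    meanCurvature D G (fun y => ‖y‖ - r) x = (m - 1) * F₁ x / F x := by
  have hr : ‖x‖ ≠ 0 := norm_ne_zero_iff.2 h0
  have hF := (h.warp_pos x hx h0).ne'
  have hD := h.uniqueDiffOn
  have hc : 1 / ‖x‖ ≠ 0 := one_div_ne_zero hr
  have hpos : 0 < 1 / ‖x‖ := by positivity
  rw [h.meanCurvature_eq hx h0 (pd_norm_sub hD hx h0 r) hc, (h.values hx h0).1, abs_of_pos hpos]
  have h1 : ∑ i, pd D i (pd D i (fun y => ‖y‖ - r)) x = (m - 1) / ‖x‖ := by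
    simp only [pd_pd_norm_sub hD hx h0, if_true, Finset.sum_add_distrib, ← Finset.mul_sum,
      sum_mul_self_eq, Finset.sum_const, Finset.card_univ, Fintype.card_fin, nsmul_eq_mul]
    field_simp
    ring
  have h2 : ∑ i, ∑ j, x i * x j * pd D i (pd D j (fun y => ‖y‖ - r)) x = 0 := by
    have key : ∀ i j, x i * x j * pd D i (pd D j (fun y => ‖y‖ - r)) x =
        (if i = j then 1 / ‖x‖ * (x i * x i) else 0) -
          1 / ‖x‖ ^ 3 * (x i * x i) * (x j * x j) := by
      intro i j
      rw [pd_pd_norm_sub hD hx h0]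
      by_cases h : i = j
      · subst h; simp; ring
      · simp [h]; ring
    simp only [key, Finset.sum_sub_distrib, Finset.sum_ite_eq, Finset.mem_univ, if_true,
      ← Finset.mul_sum, ← Finset.sum_mul, sum_mul_self_eq]
    field_simp
    ring
  rw [h1, h2]
  field_simp
  ring

end RotSym

namespace RotSym

open Set Filter Topology MeasureTheory

/-! ### Second order comparison of a level set with a sphere -/

lemma eventually_pos_of_hasDerivAt {φ : ℝ → ℝ} {d : ℝ} (h : HasDerivAt φ d 0) (h0 : φ 0 = 0)
    (hd : 0 < d) : ∀ᶠ t in 𝓝[>] (0 : ℝ), 0 < φ t := by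
  have h1 := (hasDerivAt_iff_tendsto_slope.1 h).mono_left
    (nhdsWithin_mono (0 : ℝ) (fun t (ht : 0 < t) => ht.ne'))
  filter_upwards [h1.eventually_const_lt hd, self_mem_nhdsWithin] with t ht ht0
  rw [slope_def_field, h0, sub_zero, sub_zero] at ht
  exact (div_pos_iff_of_pos_right ht0).1 ht

/-- If the second derivative were negative, `t` would also be a local maximum; then `g` would be
locally constant, with second derivative zero. -/
lemma deriv_deriv_nonneg_of_isLocalMin {g : ℝ → ℝ} {t : ℝ} (h : IsLocalMin g t)
    (hc : ContinuousAt g t) : 0 ≤ deriv (deriv g) t := by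
  by_contra! hneg
  have hmax := isLocalMax_of_deriv_deriv_neg hneg h.deriv_eq_zero hc
  have heq : g =ᶠ[𝓝 t] fun _ => g t := by
    filter_upwards [h, hmax] with s h1 h2 using le_antisymm h2 h1
  have := heq.deriv.deriv_eq
  simp at this
  linarith

section

variable {E : Type*} [NormedAddCommGroup E] [InnerProductSpace ℝ E] {u : E → ℝ} {U : Set E}
  {p w : E}

/-- For `w` orthogonal to `p` and of the same length this curve is a great circle of the sphere
through `p`; it tests `u` against the sphere to second order. -/
lemma norm_cos_smul_add_sin_smul (h : inner ℝ p w = 0) (hn : ‖w‖ = ‖p‖) (t : ℝ) :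
    ‖Real.cos t • p + Real.sin t • w‖ = ‖p‖ := by
  have : ‖Real.cos t • p + Real.sin t • w‖ ^ 2 = ‖p‖ ^ 2 := by
    rw [norm_add_sq_real, inner_smul_left, inner_smul_right, h, norm_smul, norm_smul, hn,
      mul_pow, mul_pow, Real.norm_eq_abs, Real.norm_eq_abs, sq_abs, sq_abs]
    linear_combination ‖p‖ ^ 2 * Real.cos_sq_add_sin_sq t
  exact (pow_left_inj₀ (norm_nonneg _) (norm_nonneg _) two_ne_zero).1 this

lemma hasDerivAt_cos_smul_add_sin_smul (p w : E) (t : ℝ) :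
    HasDerivAt (fun t => Real.cos t • p + Real.sin t • w)
      (-Real.sin t • p + Real.cos t • w) t :=
  ((Real.hasDerivAt_cos t).smul_const p).add ((Real.hasDerivAt_sin t).smul_const w)

lemma hasDerivAt_comp_circle (hU : IsOpen U) (hu : ContDiffOn ℝ ∞ u U) (hp : p ∈ U) :
    HasDerivAt (fun t => u (Real.cos t • p + Real.sin t • w)) (fderiv ℝ u p w) 0 := by
  have hd := ((hu.contDiffAt (hU.mem_nhds hp)).differentiableAt (by simp)).hasFDerivAt
  have := HasFDerivAt.comp_hasDerivAt_of_eq (0 : ℝ) hd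
    (hasDerivAt_cos_smul_add_sin_smul p w 0) (by simp)
  simpa [Function.comp_def] using this

/-- The acceleration of the circle at `p` is `-p`, which produces the first-order term. -/
lemma deriv_deriv_comp_circle (hU : IsOpen U) (hu : ContDiffOn ℝ ∞ u U) (hp : p ∈ U) :
    deriv (deriv fun t => u (Real.cos t • p + Real.sin t • w)) 0 =
      fderiv ℝ (fderiv ℝ u) p w w - fderiv ℝ u p p := by
  have hγ : ContinuousAt (fun t : ℝ => Real.cos t • p + Real.sin t • w) 0 :=
    (hasDerivAt_cos_smul_add_sin_smul p w 0).continuousAt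
  have hmem : ∀ᶠ t in 𝓝 (0 : ℝ), Real.cos t • p + Real.sin t • w ∈ U :=
    hγ.eventually_mem (hU.mem_nhds (by simpa using hp))
  have h1 : deriv (fun t => u (Real.cos t • p + Real.sin t • w)) =ᶠ[𝓝 0] fun t =>
      fderiv ℝ u (Real.cos t • p + Real.sin t • w) (-Real.sin t • p + Real.cos t • w) := by
    filter_upwards [hmem] with t ht
    exact (((hu.contDiffAt (hU.mem_nhds ht)).differentiableAt
      (by simp)).hasFDerivAt.comp_hasDerivAt t (hasDerivAt_cos_smul_add_sin_smul p w t)).deriv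
  rw [h1.deriv_eq]
  have h2 : DifferentiableAt ℝ (fderiv ℝ u) p :=
    ((hu.contDiffAt (hU.mem_nhds hp)).fderiv_right (m := 1) (by norm_cast)).differentiableAt
      (by simp)
  have h3 := HasFDerivAt.comp_hasDerivAt_of_eq (0 : ℝ) h2.hasFDerivAt
    (hasDerivAt_cos_smul_add_sin_smul p w 0) (by simp)
  have h4 : HasDerivAt (fun t : ℝ => -Real.sin t • p + Real.cos t • w)
      (-Real.cos 0 • p + -Real.sin 0 • w) 0 :=
    ((Real.hasDerivAt_sin 0).neg.smul_const p).add ((Real.hasDerivAt_cos 0).smul_const w)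
  have h5 := (h3.clm_apply h4).deriv
  simp only [Function.comp_def] at h5
  rw [h5]
  simp
  ring

/-- If `u` vanishes on the sphere through `p`, then its first and second derivatives in tangential
directions are those of a multiple of the norm. -/
lemma fderiv_of_eq_zero_on_sphere (hU : IsOpen U) (hu : ContDiffOn ℝ ∞ u U) (hp : p ∈ U)
    (hz : ∀ y ∈ U, ‖y‖ = ‖p‖ → u y = 0) (hw : inner ℝ p w = 0) (hn : ‖w‖ = ‖p‖) :
    fderiv ℝ u p w = 0 ∧ fderiv ℝ (fderiv ℝ u) p w w = fderiv ℝ u p p := by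
  have hγ : ContinuousAt (fun t : ℝ => Real.cos t • p + Real.sin t • w) 0 :=
    (hasDerivAt_cos_smul_add_sin_smul p w 0).continuousAt
  have h0 : (fun t => u (Real.cos t • p + Real.sin t • w)) =ᶠ[𝓝 0] fun _ => 0 := by
    filter_upwards [hγ.eventually_mem (hU.mem_nhds (by simpa using hp))] with t ht
    exact hz _ ht (norm_cos_smul_add_sin_smul hw hn t)
  have h1 := h0.deriv_eq
  have h2 := h0.deriv.deriv_eq
  rw [(hasDerivAt_comp_circle hU hu hp).deriv] at h1
  rw [deriv_deriv_comp_circle hU hu hp] at h2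
  simp only [deriv_const, deriv_const'] at h1 h2
  exact ⟨h1, by linarith⟩

/-- If the level set `{u = 0}` lies inside the ball of radius `‖p‖`, then it is tangent at `p` to
every direction that is orthogonal to `p` and to some outward direction. -/
lemma fderiv_eq_zero_of_ne_zero_outside (hU : IsOpen U) (hu : ContDiffOn ℝ ∞ u U) (hp : p ∈ U)
    (h0 : u p = 0) (hz : ∀ y ∈ U, ‖p‖ < ‖y‖ → u y ≠ 0) {e v : E} (he : e ≠ 0)
    (hpe : 0 ≤ inner ℝ p e) (hpv : inner ℝ p v = 0) (hev : inner ℝ e v = 0) :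
    fderiv ℝ u p v = 0 := by
  by_contra hne
  have hd := ((hu.contDiffAt (hU.mem_nhds hp)).differentiableAt (by simp)).hasFDerivAt
  -- If the derivative along `v` were nonzero, then for large `K` the function `u` would increase
  -- along `e + K v` and decrease along `e - K v`. It would then vanish somewhere between the two
  -- endpoints.
  obtain ⟨K, hK⟩ : ∃ K : ℝ, |fderiv ℝ u p e| < fderiv ℝ u p (K • v) := by
    refine ⟨(|fderiv ℝ u p e| + 1) / fderiv ℝ u p v, ?_⟩
    rw [map_smul, smul_eq_mul, div_mul_cancel₀ _ hne]
    linarith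
  have hderiv : ∀ z : E, HasDerivAt (fun t : ℝ => u (p + t • z)) (fderiv ℝ u p z) 0 := by
    intro z
    have h1 : HasDerivAt (fun t : ℝ => p + t • z) z 0 := by
      simpa using ((hasDerivAt_id (0 : ℝ)).smul_const z).const_add p
    exact HasFDerivAt.comp_hasDerivAt_of_eq (0 : ℝ) hd h1 (by simp)
  have h1 := eventually_pos_of_hasDerivAt (hderiv (e + K • v)) (by simpa using h0)
    (by rw [map_add]; linarith [neg_abs_le (fderiv ℝ u p e)])
  have h2 := eventually_pos_of_hasDerivAt (hderiv (e - K • v)).neg (by simpa using h0)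
    (by rw [map_sub]; linarith [le_abs_self (fderiv ℝ u p e)])
  obtain ⟨ε, hε, hball⟩ := Metric.isOpen_iff.1 hU p hp
  have h3 : ∀ᶠ t : ℝ in 𝓝[>] 0, t * (‖e‖ + ‖K • v‖) < ε := by
    have : Tendsto (fun t : ℝ => t * (‖e‖ + ‖K • v‖)) (𝓝[>] 0) (𝓝 (0 * (‖e‖ + ‖K • v‖))) :=
      (continuous_id.mul continuous_const).continuousAt.tendsto.mono_left nhdsWithin_le_nhds
    exact this.eventually_lt_const (by simpa using hε)
  obtain ⟨t, ⟨⟨h1, h2⟩, h3⟩, ht⟩ := ((h1.and h2).and h3 |>.and self_mem_nhdsWithin).exists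
  have ht : 0 < t := ht
  have hin : ∀ τ ∈ uIcc (-1 : ℝ) 1, p + t • (e + τ • K • v) ∈ U := by
    intro τ hτ
    rw [uIcc_of_le (by norm_num)] at hτ
    apply hball
    rw [Metric.mem_ball, dist_eq_norm, add_sub_cancel_left, norm_smul, Real.norm_eq_abs,
      abs_of_pos ht]
    refine lt_of_le_of_lt ?_ h3
    gcongr
    refine (norm_add_le _ _).trans ?_
    gcongr
    rw [norm_smul, Real.norm_eq_abs]
    exact mul_le_of_le_one_left (norm_nonneg _) (abs_le.2 hτ)
  have hcont : ContinuousOn (fun τ : ℝ => u (p + t • (e + τ • K • v))) (uIcc (-1) 1) :=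
    hu.continuousOn.comp (by fun_prop) hin
  have hval : (0 : ℝ) ∈ uIcc (u (p + t • (e + (-1 : ℝ) • K • v)))
      (u (p + t • (e + (1 : ℝ) • K • v))) := by
    rw [one_smul, neg_one_smul, ← sub_eq_add_neg]
    exact mem_uIcc_of_le (by simpa using (neg_pos.1 h2).le) h1.le
  obtain ⟨τ, hτ, hτ0⟩ := intermediate_value_uIcc hcont hval
  refine hz _ (hin τ hτ) ?_ hτ0
  -- That zero lies outside the ball: `e ⟂ v`, `p ⟂ v` and `⟨p, e⟩ ≥ 0`, so `‖p + t(e + τKv)‖² ≥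
  -- ‖p‖² + t²‖e‖²`.
  refine lt_of_pow_lt_pow_left₀ 2 (norm_nonneg _) ?_
  rw [norm_add_sq_real, inner_smul_right, inner_add_right, inner_smul_right, inner_smul_right, hpv,
    norm_smul, mul_pow, norm_add_sq_real, inner_smul_right, inner_smul_right, hev]
  have h4 : 0 < ‖e‖ ^ 2 := by positivity
  have h5 : 0 < ‖t‖ ^ 2 := pow_pos (norm_pos_iff.2 ht.ne') 2
  nlinarith [mul_pos h5 h4, mul_nonneg h5.le (sq_nonneg ‖τ • K • v‖), mul_nonneg ht.le hpe]

/-- If the level set `{u = 0}` lies inside the ball of radius `‖p‖`, then it is curved at `p` at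
least as much as the sphere. -/
lemma fderiv_fderiv_ge_of_ne_zero_outside (hU : IsOpen U) (hu : ContDiffOn ℝ ∞ u U) (hp : p ∈ U)
    (h0 : u p = 0) (hz : ∀ y ∈ U, ‖p‖ < ‖y‖ → u y ≠ 0) (hp0 : p ≠ 0)
    (hpos : 0 < fderiv ℝ u p p) (hw : inner ℝ p w = 0) (hn : ‖w‖ = ‖p‖) :
    fderiv ℝ u p p ≤ fderiv ℝ (fderiv ℝ u) p w w := by
  have hd := ((hu.contDiffAt (hU.mem_nhds hp)).differentiableAt (by simp)).hasFDerivAt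
  let γ : ℝ → E := fun t => Real.cos t • p + Real.sin t • w
  have hγc : Continuous γ := by fun_prop
  have hγ0 : γ 0 = p := by simp [γ]
  -- If `u < 0` at some `γ t` near `p`, then also at `(1 + s) γ t` for small `s > 0`, whereas `u >
  -- 0` at `(1 + s) p`. The circle of radius `(1 + s)‖p‖` would contain a zero of `u`, outside the
  -- ball.
  have hmin : IsLocalMin (fun t => u (γ t)) 0 := by
    have hcont : ContinuousAt (fun q : ℝ × ℝ => (1 + q.1) • γ q.2) (0, 0) := by fun_prop
    have hev : ∀ᶠ q : ℝ × ℝ in 𝓝 (0, 0), (1 + q.1) • γ q.2 ∈ U :=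
      hcont.eventually_mem (hU.mem_nhds (by simpa [hγ0] using hp))
    obtain ⟨η, hη, hηU⟩ := Metric.eventually_nhds_iff.1 hev
    have hηU' : ∀ s t : ℝ, |s| < η → |t| < η → (1 + s) • γ t ∈ U := fun s t hs ht =>
      hηU (y := (s, t)) (by simp [Prod.dist_eq, hs, ht])
    have hp1 : HasDerivAt (fun s : ℝ => u ((1 + s) • p)) (fderiv ℝ u p p) 0 := by
      have h1 : HasDerivAt (fun t : ℝ => (1 + t) • p) p 0 := by
        simpa using ((hasDerivAt_id (0 : ℝ)).const_add 1).smul_const p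
      exact HasFDerivAt.comp_hasDerivAt_of_eq (0 : ℝ) hd h1 (by simp)
    have hp2 := eventually_pos_of_hasDerivAt hp1 (by simpa using h0) hpos
    filter_upwards [Metric.ball_mem_nhds (0 : ℝ) hη] with t ht
    rw [hγ0, h0]
    have ht : |t| < η := by simpa using ht
    by_contra! hneg
    have hU0 : γ t ∈ U := by simpa using hηU' 0 t (by simpa using hη) ht
    have h1 : ContinuousAt (fun s : ℝ => u ((1 + s) • γ t)) 0 := by
      refine ContinuousAt.comp_of_eq (y := γ t) (g := u) ?_ (by fun_prop) (by simp)
      exact (hu.contDiffAt (hU.mem_nhds hU0)).continuousAt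
    have h2 : ∀ᶠ s : ℝ in 𝓝[>] 0, u ((1 + s) • γ t) < 0 :=
      (h1.eventually_lt_const (by simpa using hneg)).filter_mono nhdsWithin_le_nhds
    have h3 : ∀ᶠ s : ℝ in 𝓝[>] 0, s < η :=
      (gt_mem_nhds hη).filter_mono nhdsWithin_le_nhds
    obtain ⟨s, ⟨⟨hs1, hs2⟩, hs3⟩, hs⟩ := ((hp2.and h2).and h3 |>.and self_mem_nhdsWithin).exists
    have hs : 0 < s := hs
    have hin : ∀ τ ∈ uIcc t 0, (1 + s) • γ τ ∈ U := by
      intro τ hτ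
      refine hηU' s τ (by rwa [abs_of_pos hs]) (lt_of_le_of_lt ?_ ht)
      simpa using abs_sub_right_of_mem_uIcc hτ
    have hcont : ContinuousOn (fun τ : ℝ => u ((1 + s) • γ τ)) (uIcc t 0) :=
      hu.continuousOn.comp (by fun_prop) hin
    have hval : (0 : ℝ) ∈ uIcc (u ((1 + s) • γ t)) (u ((1 + s) • γ 0)) := by
      rw [hγ0]
      exact mem_uIcc_of_le hs2.le hs1.le
    obtain ⟨τ, hτ, hτ0⟩ := intermediate_value_uIcc hcont hval
    refine hz _ (hin τ hτ) ?_ hτ0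
    rw [norm_smul, norm_cos_smul_add_sin_smul hw hn, Real.norm_eq_abs,
      abs_of_pos (by linarith : (0 : ℝ) < 1 + s)]
    have := norm_pos_iff.2 hp0
    nlinarith
  have h1 := deriv_deriv_nonneg_of_isLocalMin hmin
    (hasDerivAt_comp_circle (w := w) hU hu hp).continuousAt
  rw [deriv_deriv_comp_circle hU hu hp] at h1
  linarith

end

end RotSym

/-! ### Tangential traces and hypersurfaces touching a symmetric sphere -/

namespace RotSym

open Set Filter Topology MeasureTheory

variable {m : ℕ} {D U : Set (EuclideanSpace ℝ (Fin m))}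
  {G : EuclideanSpace ℝ (Fin m) → Matrix (Fin m) (Fin m) ℝ}
  {a a₁ a₂ b b₁ b₂ F F₁ F₂ : EuclideanSpace ℝ (Fin m) → ℝ} {p : EuclideanSpace ℝ (Fin m)}
  {u : EuclideanSpace ℝ (Fin m) → ℝ} {c : ℝ}

lemma pd_eq_fderiv (hD : UniqueDiffOn ℝ D) (hU : IsOpen U) (hu : ContDiffOn ℝ ∞ u U)
    (hp : p ∈ D) (hpU : p ∈ U) (j : Fin m) :
    pd D j u p = fderiv ℝ u p (EuclideanSpace.single j 1) :=
  pd_eq hD hp (((hu.contDiffAt (hU.mem_nhds hpU)).differentiableAt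
    (by simp)).hasFDerivAt.hasFDerivWithinAt) j

lemma pd_pd_eq_fderiv (hD : UniqueDiffOn ℝ D) (hU : IsOpen U) (hu : ContDiffOn ℝ ∞ u U)
    (hp : p ∈ D) (hpU : p ∈ U) (i j : Fin m) :
    pd D i (pd D j u) p =
      fderiv ℝ (fderiv ℝ u) p (EuclideanSpace.single i 1) (EuclideanSpace.single j 1) := by
  have h1 : pd D j u =ᶠ[𝓝[D] p] fun y => fderiv ℝ u y (EuclideanSpace.single j 1) := by
    filter_upwards [inter_mem_nhdsWithin D (hU.mem_nhds hpU)] with y hy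
    exact pd_eq_fderiv hD hU hu hy.1 hy.2 j
  rw [pd_congr_of_eventuallyEq h1 hp]
  have h2 : DifferentiableAt ℝ (fderiv ℝ u) p :=
    ((hu.contDiffAt (hU.mem_nhds hpU)).fderiv_right (m := 1) (by norm_cast)).differentiableAt
      (by simp)
  refine (pd_eq hD hp (h2.hasFDerivAt.clm_apply
    (hasFDerivAt_const (EuclideanSpace.single j (1 : ℝ)) p)).hasFDerivWithinAt i).trans ?_
  simp

/-- The component of the `i`-th basis vector orthogonal to `p`. -/
noncomputable def tangentVec (p : EuclideanSpace ℝ (Fin m)) (i : Fin m) :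
    EuclideanSpace ℝ (Fin m) :=
  EuclideanSpace.single i 1 - (p i / ‖p‖ ^ 2) • p

lemma inner_tangentVec (hp : p ≠ 0) (i : Fin m) : inner ℝ p (tangentVec p i) = 0 := by
  have hr : ‖p‖ ≠ 0 := norm_ne_zero_iff.2 hp
  rw [tangentVec, inner_sub_right, inner_smul_right, real_inner_self_eq_norm_sq,
    EuclideanSpace.inner_single_right]
  simp
  field_simp
  ring

lemma norm_tangentVec_sq (hp : p ≠ 0) (i : Fin m) :
    ‖tangentVec p i‖ ^ 2 = 1 - p i * p i / ‖p‖ ^ 2 := by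
  have hr : ‖p‖ ≠ 0 := norm_ne_zero_iff.2 hp
  rw [tangentVec, norm_sub_sq_real, inner_smul_right, EuclideanSpace.inner_single_left, norm_smul]
  simp
  field_simp
  rw [sq_abs]
  ring

lemma sum_single_eq (p : EuclideanSpace ℝ (Fin m)) :
    ∑ i, p i • EuclideanSpace.single i (1 : ℝ) = p := by
  ext j
  simp [Finset.sum_apply, Pi.single_apply]

lemma apply_eq_sum (L : EuclideanSpace ℝ (Fin m) →L[ℝ] ℝ) (p : EuclideanSpace ℝ (Fin m)) :
    L p = ∑ i, p i * L (EuclideanSpace.single i 1) := by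
  conv_lhs => rw [← sum_single_eq p]
  simp only [map_sum, map_smul, smul_eq_mul]

/-- Summing over the projected basis vectors computes the trace of `B` on the orthogonal complement
of `p` without choosing an orthonormal basis there. -/
lemma sum_apply_tangentVec (hp : p ≠ 0)
    (B : EuclideanSpace ℝ (Fin m) →L[ℝ] EuclideanSpace ℝ (Fin m) →L[ℝ] ℝ) :
    ∑ i, B (tangentVec p i) (tangentVec p i) =
      ∑ i, B (EuclideanSpace.single i 1) (EuclideanSpace.single i 1) -
      (∑ i, ∑ j, p i * p j * B (EuclideanSpace.single i 1) (EuclideanSpace.single j 1)) /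
        ‖p‖ ^ 2 := by
  have hr : ‖p‖ ≠ 0 := norm_ne_zero_iff.2 hp
  have h1 : ∀ i, B (tangentVec p i) (tangentVec p i) =
      B (EuclideanSpace.single i 1) (EuclideanSpace.single i 1) -
      p i * B.flip p (EuclideanSpace.single i 1) / ‖p‖ ^ 2 -
      p i * B p (EuclideanSpace.single i 1) / ‖p‖ ^ 2 + p i * p i * (B p p / ‖p‖ ^ 4) := by
    intro i
    simp only [tangentVec, map_sub, map_smul, sub_apply, smul_apply, smul_eq_mul,
      ContinuousLinearMap.flip_apply]
    field_simp
    ring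
  have h2 : ∑ i, ∑ j, p i * p j * B (EuclideanSpace.single i 1) (EuclideanSpace.single j 1) =
      B p p := by
    have h3 : B p p = B.flip p p := rfl
    rw [h3, apply_eq_sum (B.flip p) p]
    refine Finset.sum_congr rfl fun i _ => ?_
    rw [ContinuousLinearMap.flip_apply, apply_eq_sum _ p, Finset.mul_sum]
    exact Finset.sum_congr rfl fun j _ => by ring
  simp only [h1, Finset.sum_add_distrib, Finset.sum_sub_distrib, ← Finset.sum_mul,
    ← Finset.sum_div, sum_mul_self_eq, ← apply_eq_sum, h2]
  rw [ContinuousLinearMap.flip_apply]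
  field_simp
  ring

lemma sum_norm_tangentVec_sq (hp : p ≠ 0) : ∑ i, ‖tangentVec p i‖ ^ 2 = (m : ℝ) - 1 := by
  have hr : ‖p‖ ≠ 0 := norm_ne_zero_iff.2 hp
  simp only [norm_tangentVec_sq hp, Finset.sum_sub_distrib, ← Finset.sum_div, sum_mul_self_eq,
    Finset.sum_const, Finset.card_univ, Fintype.card_fin, nsmul_eq_mul]
  field_simp

/-- The bound is assumed for vectors of length `‖p‖`, as the great circles supply it, and is
rescaled to each projected basis vector; the squared lengths of these sum to `m - 1`. -/
lemma trace_ge (hp : p ≠ 0) {κ : ℝ}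
    (B : EuclideanSpace ℝ (Fin m) →L[ℝ] EuclideanSpace ℝ (Fin m) →L[ℝ] ℝ)
    (hB : ∀ w, inner ℝ p w = 0 → ‖w‖ = ‖p‖ → κ * ‖p‖ ^ 2 ≤ B w w) :
    (m - 1) * κ ≤ ∑ i, B (EuclideanSpace.single i 1) (EuclideanSpace.single i 1) -
      (∑ i, ∑ j, p i * p j * B (EuclideanSpace.single i 1) (EuclideanSpace.single j 1)) /
        ‖p‖ ^ 2 := by
  have hr : 0 < ‖p‖ := norm_pos_iff.2 hp
  rw [← sum_apply_tangentVec hp, ← sum_norm_tangentVec_sq hp, Finset.sum_mul]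
  refine Finset.sum_le_sum fun i _ => ?_
  rcases eq_or_ne (tangentVec p i) 0 with h | h
  · simp [h]
  · have hv : 0 < ‖tangentVec p i‖ := norm_pos_iff.2 h
    have h1 := hB ((‖p‖ / ‖tangentVec p i‖) • tangentVec p i)
      (by rw [inner_smul_right, inner_tangentVec hp, mul_zero])
      (by rw [norm_smul, norm_div, norm_norm, norm_norm, div_mul_cancel₀ _ hv.ne'])
    simp only [map_smul, smul_apply, smul_eq_mul] at h1
    rw [← mul_assoc, ← sq, div_pow, div_mul_eq_mul_div, le_div_iff₀ (by positivity)] at h1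
    nlinarith [pow_pos hr 2]

lemma fderiv_single_of_tangent (hp : p ≠ 0) (L : EuclideanSpace ℝ (Fin m) →L[ℝ] ℝ)
    (hL : ∀ v, inner ℝ p v = 0 → L v = 0) (j : Fin m) :
    L (EuclideanSpace.single j 1) = L p / ‖p‖ ^ 2 * p j := by
  have := hL _ (inner_tangentVec hp j)
  rw [tangentVec, map_sub, map_smul, smul_eq_mul] at this
  linear_combination this

namespace IsWarpedMetric

/-- Where `F' > 0`, a minimal hypersurface cannot touch a symmetric sphere from the inside. -/
lemma meanCurvature_ne_zero (h : IsWarpedMetric D G a a₁ a₂ b b₁ b₂ F F₁ F₂) (hm : 2 ≤ m)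
    (hU : IsOpen U) (hUD : U ⊆ D) (hu : ContDiffOn ℝ ∞ u U) (hp : p ∈ U) (hp0 : p ≠ 0)
    (h0 : u p = 0) (hz : ∀ y ∈ U, ‖p‖ < ‖y‖ → u y ≠ 0) (hdu : fderiv ℝ u p ≠ 0)
    (hF : 0 < F₁ p) : meanCurvature D G u p ≠ 0 := by
  have hr : 0 < ‖p‖ := norm_pos_iff.2 hp0
  have hD := h.uniqueDiffOn
  have hm' : (0 : ℝ) < m - 1 := by
    have : (2 : ℝ) ≤ m := by exact_mod_cast hm
    linarith
  have htan : ∀ v, inner ℝ p v = 0 → fderiv ℝ u p v = 0 := fun v hv =>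
    fderiv_eq_zero_of_ne_zero_outside hU hu hp h0 hz hp0
      (by rw [real_inner_self_eq_norm_sq]; positivity) hv hv
  set c := fderiv ℝ u p p / ‖p‖ ^ 2 with hc
  have hL := fderiv_single_of_tangent hp0 (fderiv ℝ u p) htan
  have hpd : ∀ j, pd D j u p = c * p j := fun j => by
    rw [pd_eq_fderiv hD hU hu (hUD hp) hp, hL]
  have hc0 : c ≠ 0 := by
    intro h0
    apply hdu
    ext v
    rw [apply_eq_sum]
    simp [hL, ← hc, h0]
  have hcp : fderiv ℝ u p p = c * ‖p‖ ^ 2 := by rw [hc]; field_simp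
  rw [h.meanCurvature_eq (hUD hp) hp0 hpd hc0]
  simp only [pd_pd_eq_fderiv hD hU hu (hUD hp) hp]
  have hpos := h.pos p (hUD hp)
  have hFp := h.warp_pos p (hUD hp) hp0
  refine div_ne_zero ?_ (by positivity)
  -- For `c < 0` the comparison is applied to `-u`. In either case the trace bound cancels the
  -- Euclidean part of the sphere, and what remains has the strict sign of `c F F' / ‖p‖`.
  rcases lt_or_gt_of_ne hc0 with hneg | hposc
  · have h1 : ∀ w, inner ℝ p w = 0 → ‖w‖ = ‖p‖ →
        -c * ‖p‖ ^ 2 ≤ (-fderiv ℝ (fderiv ℝ u) p) w w := by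
      intro w hw hn
      have h2 : fderiv ℝ (fun x => -u x) = fun x => -fderiv ℝ u x := by
        ext x : 1; exact fderiv_neg
      have h3 := fderiv_fderiv_ge_of_ne_zero_outside hU hu.neg hp (by simpa using h0)
        (fun y hy hy' => by simpa using hz y hy hy') hp0
        (by rw [h2, neg_apply, hcp, ← neg_mul]; exact mul_pos (by linarith) (by positivity)) hw hn
      rw [h2, neg_apply, hcp] at h3
      have h4 : fderiv ℝ (fun x => -fderiv ℝ u x) p = -fderiv ℝ (fderiv ℝ u) p := fderiv_neg
      rw [h4] at h3
      linarith
    have h2 := trace_ge hp0 _ h1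
    simp only [neg_apply, mul_neg, Finset.sum_neg_distrib] at h2
    have h3 : 0 < (m - 1) * (-c * (F p * F₁ p / ‖p‖)) :=
      mul_pos hm' (mul_pos (by linarith) (by positivity))
    refine ne_of_lt ?_
    rw [neg_div] at h2
    linarith
  · have h1 : ∀ w, inner ℝ p w = 0 → ‖w‖ = ‖p‖ →
        c * ‖p‖ ^ 2 ≤ (fderiv ℝ (fderiv ℝ u) p) w w := by
      intro w hw hn
      rw [← hcp]
      exact fderiv_fderiv_ge_of_ne_zero_outside hU hu hp h0 hz hp0
        (by rw [hcp]; positivity) hw hn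
    have h2 := trace_ge hp0 _ h1
    have h3 : 0 < (m - 1) * (c * (F p * F₁ p / ‖p‖)) :=
      mul_pos hm' (mul_pos hposc (by positivity))
    refine ne_of_gt ?_
    linarith

/-- If `F' > 0` in the interior, there is no closed minimal hypersurface in the interior. -/
lemma not_isClosedInteriorMinimal (h : IsWarpedMetric D G a a₁ a₂ b b₁ b₂ F F₁ F₂) (hm : 2 ≤ m)
    (hF : ∀ x ∈ interior D, x ≠ 0 → 0 < F₁ x) : ¬ ∃ S, IsClosedInteriorMinimal D G S := by
  rintro ⟨S, hne, hcomp, hint, -, hmin⟩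
  obtain ⟨p, hpS, hpmax⟩ := hcomp.exists_isMaxOn hne continuous_norm.continuousOn
  obtain ⟨U, u, hU, hpU, hu, hSU, hmc⟩ := hmin p hpS
  obtain ⟨hdu, hH⟩ := hmc p ⟨hpS, hpU⟩
  have hU' : IsOpen (U ∩ interior D) := hU.inter isOpen_interior
  have hp' : p ∈ U ∩ interior D := ⟨hpU, hint hpS⟩
  have hu' : ContDiffOn ℝ ∞ u (U ∩ interior D) := hu.mono inter_subset_left
  have h0 : u p = 0 := (hSU.subset ⟨hpS, hpU⟩).2
  have hz : ∀ y ∈ U ∩ interior D, ‖p‖ < ‖y‖ → u y ≠ 0 := by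
    intro y hy hlt hy0
    have : y ∈ S ∩ U := hSU.superset ⟨⟨interior_subset hy.2, hy.1⟩, hy0⟩
    exact absurd (hpmax this.1) (not_le.2 hlt)
  -- At `p = 0` every direction is orthogonal to `p`. For the `i`-th basis vector any other basis
  -- vector serves as outward direction, so `u` would have zero gradient.
  have hp0 : p ≠ 0 := by
    rintro rfl
    apply hdu
    ext v
    rw [apply_eq_sum]
    refine Finset.sum_eq_zero fun i _ => ?_
    obtain ⟨j, hj⟩ : ∃ j : Fin m, j ≠ i := by
      have : Nontrivial (Fin m) := Fin.nontrivial_iff_two_le.2 hm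
      exact exists_ne i
    rw [fderiv_eq_zero_of_ne_zero_outside hU' hu' hp' h0 hz
      (e := EuclideanSpace.single j (1 : ℝ)) (by simp) (by simp) (by simp)
      (by simp [EuclideanSpace.inner_single_right, hj.symm]), mul_zero]
  exact h.meanCurvature_ne_zero hm hU' (inter_subset_right.trans interior_subset) hu' hp' hp0 h0
    hz hdu (hF p (hint hpS) hp0) hH

/-- A symmetric sphere is minimal where `F' = 0`. -/
lemma isMinimalHypersurface_sphere (h : IsWarpedMetric D G a a₁ a₂ b b₁ b₂ F F₁ F₂) {r : ℝ}
    (hr : 0 < r) (hs : Metric.sphere 0 r ⊆ D) (hF : ∀ x ∈ Metric.sphere 0 r, F₁ x = 0) :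
    IsMinimalHypersurface D G (Metric.sphere 0 r) := by
  have hne : ∀ x ∈ Metric.sphere (0 : EuclideanSpace ℝ (Fin m)) r, x ≠ 0 := by
    rintro x hx rfl
    simp at hx
    linarith
  refine ⟨hs, fun p hp => ⟨{0}ᶜ, fun y => ‖y‖ - r, isOpen_compl_singleton, hne p hp, ?_, ?_, ?_⟩⟩
  · exact fun y hy => ((contDiffAt_norm ℝ hy).sub contDiffAt_const).contDiffWithinAt
  · ext x
    simp only [mem_inter_iff, mem_sphere_zero_iff_norm, mem_ofPred_eq, sub_eq_zero]
    constructor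
    · rintro ⟨h1, h2⟩
      exact ⟨⟨hs (by simpa using h1), h2⟩, h1⟩
    · rintro ⟨⟨h1, h2⟩, h3⟩
      exact ⟨h3, h2⟩
  · rintro x ⟨hx, hx0⟩
    refine ⟨fun h0 => ?_, ?_⟩
    · have h1 : HasFDerivAt (fun y : EuclideanSpace ℝ (Fin m) => ‖y‖ - r)
          ((1 / ‖x‖ - 0) • innerSL ℝ x) x := by
        have := (HasRadialDeriv.norm (D := univ)).sub (HasRadialDeriv.const r) x ⟨trivial, hx0⟩
        exact this.hasFDerivAt (by simpa using isOpen_compl_singleton.mem_nhds hx0)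
      rw [h1.fderiv] at h0
      have h2 := DFunLike.congr_fun h0 x
      have hr : ‖x‖ ≠ 0 := norm_ne_zero_iff.2 hx0
      simp [hr] at h2
    · rw [h.meanCurvature_norm (hs hx) hx0, hF x hx]
      simp

/-- If a symmetric sphere is minimal, then `F' = 0` on it. -/
lemma eq_zero_of_isMinimalHypersurface_sphere
    (h : IsWarpedMetric D G a a₁ a₂ b b₁ b₂ F F₁ F₂) (hm : 2 ≤ m) {r : ℝ}
    (hmin : IsMinimalHypersurface D G (Metric.sphere 0 r)) (hp : p ∈ Metric.sphere 0 r)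
    (hp0 : p ≠ 0) : F₁ p = 0 := by
  obtain ⟨U, u, hU, hpU, hu, hSU, hmc⟩ := hmin.2 p hp
  obtain ⟨hdu, hH⟩ := hmc p ⟨hp, hpU⟩
  have hpr : ‖p‖ = r := by simpa using hp
  have hpD : p ∈ D := hmin.1 hp
  have hD := h.uniqueDiffOn
  have hr : 0 < ‖p‖ := norm_pos_iff.2 hp0
  have hz : ∀ y ∈ U, ‖y‖ = ‖p‖ → u y = 0 := fun y hy hyp =>
    (hSU.subset ⟨by simpa [hpr] using hyp, hy⟩).2
  have htan : ∀ v, inner ℝ p v = 0 → fderiv ℝ u p v = 0 := by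
    intro v hv
    rcases eq_or_ne v 0 with rfl | hv0
    · simp
    have hv' : ‖v‖ ≠ 0 := norm_ne_zero_iff.2 hv0
    have := (fderiv_of_eq_zero_on_sphere hU hu hpU hz (w := (‖p‖ / ‖v‖) • v)
      (by rw [inner_smul_right, hv, mul_zero])
      (by rw [norm_smul, norm_div, norm_norm, norm_norm, div_mul_cancel₀ _ hv'])).1
    rw [map_smul, smul_eq_mul] at this
    exact (mul_eq_zero.1 this).resolve_left (by positivity)
  set c := fderiv ℝ u p p / ‖p‖ ^ 2 with hc
  have hL := fderiv_single_of_tangent hp0 (fderiv ℝ u p) htan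
  have hpd : ∀ j, pd D j u p = c * p j := fun j => by
    rw [pd_eq_fderiv hD hU hu hpD hpU, hL]
  have hc0 : c ≠ 0 := by
    intro h0
    apply hdu
    ext v
    rw [apply_eq_sum]
    simp [hL, ← hc, h0]
  have hcp : fderiv ℝ u p p = c * ‖p‖ ^ 2 := by rw [hc]; field_simp
  rw [h.meanCurvature_eq hpD hp0 hpd hc0] at hH
  simp only [pd_pd_eq_fderiv hD hU hu hpD hpU] at hH
  have hpos := h.pos p hpD
  have hFp := h.warp_pos p hpD hp0
  have hden : a p * (|c| * ‖p‖) ≠ 0 := by positivity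
  have hH := (div_eq_zero_iff.1 hH).resolve_right hden
  -- On the sphere the second-order comparison is an equality. Applying `trace_ge` to the Hessian
  -- and to its negative then determines the tangential trace as `(m - 1) c`.
  have h1 : ∀ w, inner ℝ p w = 0 → ‖w‖ = ‖p‖ → fderiv ℝ (fderiv ℝ u) p w w = c * ‖p‖ ^ 2 :=
    fun w hw hn => by rw [← hcp]; exact (fderiv_of_eq_zero_on_sphere hU hu hpU hz hw hn).2
  have h2 := trace_ge hp0 _ fun w hw hn => (h1 w hw hn).ge
  have h3 := trace_ge (κ := -c) hp0 (-fderiv ℝ (fderiv ℝ u) p) fun w hw hn => by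
    rw [neg_apply, neg_apply, h1 w hw hn, neg_mul]
  simp only [neg_apply, mul_neg, Finset.sum_neg_distrib, neg_div] at h3
  have hm' : (m : ℝ) - 1 ≠ 0 := by
    have : (2 : ℝ) ≤ m := by exact_mod_cast hm
    linarith
  have h4 : (m - 1 : ℝ) * (c * (F p * F₁ p / ‖p‖)) = 0 := by linarith
  have h5 := (mul_eq_zero.1 ((mul_eq_zero.1 h4).resolve_left hm')).resolve_left hc0
  have h6 := (div_eq_zero_iff.1 h5).resolve_right hr.ne'
  exact (mul_eq_zero.1 h6).resolve_left hFp.ne'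

/-- The stability inequality on a symmetric sphere with `F' = 0` and `F'' ≥ 0`. -/
lemma isStableUnitSphere (h : IsWarpedMetric D G a a₁ a₂ b b₁ b₂ F F₁ F₂) (hm : 2 ≤ m)
    (hs : Metric.sphere 0 1 ⊆ D) (hF : ∀ x ∈ Metric.sphere 0 1, F₁ x = 0)
    (hF₂ : ∀ x ∈ Metric.sphere 0 1, 0 ≤ F₂ x) : IsStableUnitSphere D G := by
  intro φ _
  refine integral_nonneg fun ⟨x, hxs⟩ => ?_
  have hx : x ∈ D := hs hxs
  have hn : ‖x‖ = 1 := by simpa using hxs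
  have h0 : x ≠ 0 := by rintro rfl; simp at hn
  have hD := h.uniqueDiffOn
  have hu : ∀ j, pd D j (fun y => ‖y‖) x = 1 * x j := fun j => by
    simpa [hn] using pd_norm_sub hD hx h0 0 j
  have hH : ∀ i j, pd D i (pd D j (fun y => ‖y‖)) x =
      1 * (if i = j then 1 else 0) + (-1) * (x i * x j) := fun i j => by
    simpa [hn] using pd_pd_norm_sub hD hx h0 0 i j
  have h1 := h.secondFormSq_eq_zero hx h0 (hF x hxs) hu one_ne_zero hH
  have h2 := h.ricci_unitNormal hx h0 hu one_ne_zero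
  have hpos := h.pos x hx
  have hFp := h.warp_pos x hx h0
  have hm' : (0 : ℝ) < m - 1 := by
    have : (2 : ℝ) ≤ m := by exact_mod_cast hm
    linarith
  have h3 : 0 ≤ ∑ i, ∑ j, tangentialInv D G (fun y => ‖y‖) i j x * pd D i φ x * pd D j φ x := by
    have key : ∀ i j, tangentialInv D G (fun y => ‖y‖) i j x * pd D i φ x * pd D j φ x =
        ((if i = j then pd D i φ x * pd D i φ x else 0) -
          (x i * pd D i φ x) * (x j * pd D j φ x)) * (1 / a x) := by
      intro i j
      rw [h.tangentialInv_eq hx h0 hu one_ne_zero, hn]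
      by_cases h : i = j
      · subst h; simp; ring
      · simp [h]; ring
    simp only [key, ← Finset.sum_mul, Finset.sum_sub_distrib, Finset.sum_ite_eq, Finset.mem_univ,
      if_true, ← Finset.mul_sum]
    refine mul_nonneg ?_ (by positivity)
    -- Cauchy–Schwarz with `‖x‖ = 1`: removing the radial component of the gradient leaves a
    -- nonnegative square.
    have h4 := Finset.sum_mul_sq_le_sq_mul_sq Finset.univ (fun i => x i) (fun i => pd D i φ x)
    have h5 : ∑ i, x i ^ 2 = 1 := by rw [← EuclideanSpace.real_norm_sq_eq, hn, one_pow]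
    rw [h5, one_mul] at h4
    simp only [← sq]
    linarith
  show 0 ≤ _ - (secondFormSq D G (fun y => ‖y‖) x + _) * φ x ^ 2
  rw [h1, h2, zero_add]
  have h6 : -(m - 1) * F₂ x / F x * φ x ^ 2 ≤ 0 := by
    have h7 : 0 ≤ (m - 1) * F₂ x / F x * φ x ^ 2 := by
      have := hF₂ x hxs
      positivity
    calc _ = -((m - 1) * F₂ x / F x * φ x ^ 2) := by ring
      _ ≤ 0 := by linarith
  linarith

end IsWarpedMetric

end RotSym

namespace RotSym

open Set Filter Topology MeasureTheory

variable {m : ℕ}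

/-! ### Smooth functions of the radius -/

lemma hasRadialDeriv_comp_norm_sub {D : Set (EuclideanSpace ℝ (Fin m))} {φ φ' : ℝ → ℝ} {c d : ℝ}
    (hφ : ∀ s, d ≤ s → HasDerivWithinAt φ (φ' s) (Ici d) s) (hD : ∀ x ∈ D, d ≤ ‖x‖ - c) :
    HasRadialDeriv (D ∩ {0}ᶜ) (fun x => φ (‖x‖ - c)) (fun x => φ' (‖x‖ - c) / ‖x‖) := by
  intro x hx
  have h1 := (HasRadialDeriv.norm (D := D)).sub (HasRadialDeriv.const c) x hx
  have h2 := (hφ _ (hD x hx.1)).comp_hasFDerivWithinAt x h1 fun y hy => hD y hy.1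
  refine h2.congr_fderiv ?_
  rw [smul_smul]
  congr 1
  ring

/-- Away from the origin this is the chain rule. At the origin the factor `t` forces `α'(0) = 0`,
which makes `α(‖x‖)` differentiable there with zero derivative. -/
lemma hasRadialDeriv_comp_norm {α α₁ : ℝ → ℝ} (h : ∀ t, HasDerivAt α (t * α₁ t) t) :
    HasRadialDeriv (univ : Set (EuclideanSpace ℝ (Fin m))) (fun x => α ‖x‖)
      (fun x => α₁ ‖x‖) := by
  intro x _
  rcases eq_or_ne x 0 with rfl | hx
  · have h0 : HasDerivAt α 0 0 := by simpa using h 0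
    have h1 := (hasDerivAt_iff_isLittleO.1 h0).comp_tendsto
      (k := fun x : EuclideanSpace ℝ (Fin m) => ‖x‖) (l := 𝓝 0)
      (by simpa using (continuous_norm (E := EuclideanSpace ℝ (Fin m))).tendsto 0)
    refine HasFDerivAt.hasFDerivWithinAt ?_
    rw [hasFDerivAt_iff_isLittleO]
    refine (h1.congr_left fun y => ?_).trans_isBigO ?_
    · simp
    · exact Asymptotics.IsBigO.of_bound 1 (Eventually.of_forall fun y => by simp)
  · have h1 := hasRadialDeriv_comp_norm_sub (D := (univ : Set (EuclideanSpace ℝ (Fin m))))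
      (φ := α) (φ' := fun t => t * α₁ t) (c := 0) (d := 0)
      (fun s _ => (h s).hasDerivWithinAt) (fun y _ => by simp) x ⟨trivial, hx⟩
    have hr : ‖x‖ ≠ 0 := norm_ne_zero_iff.2 hx
    simp only [sub_zero, mul_div_cancel_left₀ _ hr] at h1
    exact h1.mono_of_mem_nhdsWithin (inter_mem_nhdsWithin _ (isOpen_compl_singleton.mem_nhds hx))

/-- A smooth even function of the norm is smooth. -/
lemma contDiff_comp_norm_of_even {α : ℝ → ℝ} (hα : ContDiff ℝ ∞ α) (he : ∀ t, α (-t) = α t) :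
    ContDiff ℝ ∞ fun x : EuclideanSpace ℝ (Fin m) => α ‖x‖ := by
  rw [contDiff_infty]
  intro n
  induction n generalizing α with
  | zero =>
    simp only [Nat.cast_zero, contDiff_zero]
    exact hα.continuous.comp continuous_norm
  | succ n ih =>
    obtain ⟨α₁, hα₁, he₁, hd⟩ := exists_even_deriv_eq hα he
    have h1 : ∀ x : EuclideanSpace ℝ (Fin m),
        HasFDerivAt (fun x => α ‖x‖) (α₁ ‖x‖ • innerSL ℝ x) x := fun x =>
      (hasRadialDeriv_comp_norm hd x trivial).hasFDerivAt univ_mem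
    rw [Nat.cast_succ, contDiff_succ_iff_fderiv]
    refine ⟨fun x => (h1 x).differentiableAt, by simp, ?_⟩
    rw [funext fun x => (h1 x).fderiv]
    -- The derivative is `α₁(‖x‖) ⟨x, ·⟩` with `α₁` again smooth and even, so the induction
    -- continues.
    exact (ih hα₁ he₁).smul (innerSL ℝ).contDiff

/-- The region is not convex, but the closed ball about `2x` of radius `‖x‖` lies in it and contains
`x`. -/
lemma uniqueDiffOn_one_le_norm :
    UniqueDiffOn ℝ {x : EuclideanSpace ℝ (Fin m) | 1 ≤ ‖x‖} := by
  intro x hx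
  have hx : 1 ≤ ‖x‖ := hx
  have h1 : UniqueDiffOn ℝ (Metric.closedBall ((2 : ℝ) • x) ‖x‖) :=
    uniqueDiffOn_convex (convex_closedBall _ _)
      ⟨(2 : ℝ) • x, interior_mono Metric.ball_subset_closedBall
        (by rw [Metric.isOpen_ball.interior_eq]; exact Metric.mem_ball_self (by linarith))⟩
  have hnorm : ‖(2 : ℝ) • x‖ = 2 * ‖x‖ := by rw [norm_smul]; simp
  refine (h1 x ?_).mono fun y hy => ?_
  · rw [Metric.mem_closedBall, dist_eq_norm, two_smul, sub_add_cancel_left, norm_neg]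
  · rw [Metric.mem_closedBall, dist_comm, dist_eq_norm] at hy
    have := norm_sub_norm_le ((2 : ℝ) • x) y
    show 1 ≤ ‖y‖
    linarith

lemma contDiffOn_comp_norm {α : ℝ → ℝ} (hα : ContDiffOn ℝ ∞ α (Ici 1)) :
    ContDiffOn ℝ ∞ (fun x => α ‖x‖) {x : EuclideanSpace ℝ (Fin m) | 1 ≤ ‖x‖} := by
  refine hα.comp (fun x hx => ?_) fun x hx => hx
  have h0 : x ≠ 0 := by rintro rfl; simp at hx; linarith
  exact (contDiffAt_norm ℝ h0).contDiffWithinAt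

lemma exists_hasRadialDeriv_of_contDiffOn {α : ℝ → ℝ} (hα : ContDiffOn ℝ ∞ α (Ici 1)) :
    ∃ α₁ : ℝ → ℝ, ContDiffOn ℝ ∞ α₁ (Ici 1) ∧
      HasRadialDeriv {x : EuclideanSpace ℝ (Fin m) | 1 ≤ ‖x‖} (fun x => α ‖x‖)
        (fun x => α₁ ‖x‖) := by
  refine ⟨fun r => derivWithin α (Ici 1) r / r, ?_, ?_⟩
  · refine ((contDiffOn_infty_iff_derivWithin (uniqueDiffOn_Ici 1)).1 hα).2.div contDiffOn_id
      fun r (hr : 1 ≤ r) => by linarith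
  · have h1 := hasRadialDeriv_comp_norm_sub (c := 0) (d := 1)
      (D := {x : EuclideanSpace ℝ (Fin m) | 1 ≤ ‖x‖})
      (fun s hs => ((hα.differentiableOn (by simp)) s hs).hasDerivWithinAt)
      (fun x hx => by simpa using hx)
    simp only [sub_zero] at h1
    refine h1.mono fun x hx => ⟨hx, ?_⟩
    rintro rfl
    simp at hx
    linarith

/-! ### Smooth warping functions -/

/-- The warping functions `f` for which `ds² + f(s)² g₀` is a smooth Riemannian metric. -/
structure IsSmoothWarp (f : Ici (0 : ℝ) → ℝ) : Prop where
  boundary : f ⟨0, self_mem_Ici⟩ ≠ 0 →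
    ContDiffOn ℝ ∞ (IciExtend f) (Ici 0) ∧ ∀ s, 0 ≤ s → 0 < IciExtend f s
  pole : f ⟨0, self_mem_Ici⟩ = 0 → ∃ k : ℝ → ℝ, ContDiff ℝ ∞ k ∧ (∀ t, k (-t) = k t) ∧ k 0 = 1 ∧
    (∀ t, 0 < k t) ∧ ∀ s, 0 ≤ s → IciExtend f s = s * k s

namespace IsSmoothWarp

variable {f : Ici (0 : ℝ) → ℝ}

lemma contDiffOn (hf : IsSmoothWarp f) : ContDiffOn ℝ ∞ (IciExtend f) (Ici 0) := by
  by_cases h0 : f ⟨0, self_mem_Ici⟩ = 0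
  · obtain ⟨k, hk, -, -, -, hF⟩ := hf.pole h0
    exact (contDiff_id.mul hk).contDiffOn.congr hF
  · exact (hf.boundary h0).1

lemma pos (hf : IsSmoothWarp f) {s : ℝ} (hs : 0 < s) : 0 < IciExtend f s := by
  by_cases h0 : f ⟨0, self_mem_Ici⟩ = 0
  · obtain ⟨k, -, -, -, hk, hF⟩ := hf.pole h0
    rw [hF s hs.le]
    exact mul_pos hs (hk s)
  · exact (hf.boundary h0).2 s hs.le

end IsSmoothWarp

/-- The derivative `f'`, one-sided at `0`. -/
noncomputable def warpDeriv (f : Ici (0 : ℝ) → ℝ) : ℝ → ℝ := derivWithin (IciExtend f) (Ici 0)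

/-- The second derivative `f''`, one-sided at `0`. -/
noncomputable def warpDeriv₂ (f : Ici (0 : ℝ) → ℝ) : ℝ → ℝ := derivWithin (warpDeriv f) (Ici 0)

namespace IsSmoothWarp

variable {f : Ici (0 : ℝ) → ℝ}

lemma hasDerivWithinAt (hf : IsSmoothWarp f) {s : ℝ} (hs : 0 ≤ s) :
    HasDerivWithinAt (IciExtend f) (warpDeriv f s) (Ici 0) s :=
  (hf.contDiffOn.differentiableOn (by simp) s hs).hasDerivWithinAt

lemma contDiffOn_warpDeriv (hf : IsSmoothWarp f) : ContDiffOn ℝ ∞ (warpDeriv f) (Ici 0) :=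
  ((contDiffOn_infty_iff_derivWithin (uniqueDiffOn_Ici 0)).1 hf.contDiffOn).2

lemma hasDerivWithinAt_warpDeriv (hf : IsSmoothWarp f) {s : ℝ} (hs : 0 ≤ s) :
    HasDerivWithinAt (warpDeriv f) (warpDeriv₂ f s) (Ici 0) s :=
  (hf.contDiffOn_warpDeriv.differentiableOn (by simp) s hs).hasDerivWithinAt

lemma hasDerivAt (hf : IsSmoothWarp f) {s : ℝ} (hs : 0 < s) :
    HasDerivAt (IciExtend f) (warpDeriv f s) s :=
  (hf.hasDerivWithinAt hs.le).hasDerivAt (Ici_mem_nhds hs)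

end IsSmoothWarp

lemma offset_of_eq {f : Ici (0 : ℝ) → ℝ} (h : f ⟨0, self_mem_Ici⟩ = 0) : offset f = 0 := if_pos h

lemma offset_of_ne {f : Ici (0 : ℝ) → ℝ} (h : f ⟨0, self_mem_Ici⟩ ≠ 0) : offset f = 1 := if_neg h

lemma region_of_eq {f : Ici (0 : ℝ) → ℝ} (h : f ⟨0, self_mem_Ici⟩ = 0) : region m f = univ := by
  ext x
  simp [region, offset_of_eq h]

lemma region_of_ne {f : Ici (0 : ℝ) → ℝ} (h : f ⟨0, self_mem_Ici⟩ ≠ 0) :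
    region m f = {x | 1 ≤ ‖x‖} := by
  rw [region, offset_of_ne h]

lemma metric_of_ne_zero (f : Ici (0 : ℝ) → ℝ) {x : EuclideanSpace ℝ (Fin m)} (hx : x ≠ 0)
    (i j : Fin m) : metric m f x i j = x i * x j / ‖x‖ ^ 2 +
      (areaRadius f x / ‖x‖) ^ 2 * ((if i = j then 1 else 0) - x i * x j / ‖x‖ ^ 2) := by
  rw [metric, if_neg (norm_ne_zero_iff.2 hx), Matrix.of_apply]

/-- The coefficients are `a = (f / ‖x‖)²` and `b = (1 - a) / ‖x‖²`. At a pole `a = k²`, and `b` is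
smooth because `1 - k²` is even and vanishes at `0`. -/
theorem IsSmoothWarp.exists_isWarpedMetric {f : Ici (0 : ℝ) → ℝ} (hf : IsSmoothWarp f) (m : ℕ) :
    ∃ a a₁ a₂ b b₁ b₂ : EuclideanSpace ℝ (Fin m) → ℝ,
      IsWarpedMetric (region m f) (metric m f) a a₁ a₂ b b₁ b₂ (areaRadius f)
        (fun x => warpDeriv f (‖x‖ - offset f)) (fun x => warpDeriv₂ f (‖x‖ - offset f)) ∧
      ContDiffOn ℝ ∞ a (region m f) ∧ ContDiffOn ℝ ∞ b (region m f) ∧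
      ContinuousOn a₂ (region m f) ∧ ContinuousOn b₂ (region m f) := by
  have hsub : ∀ x ∈ region m f, 0 ≤ ‖x‖ - offset f := fun x hx => sub_nonneg.2 hx
  have hw := hasRadialDeriv_comp_norm_sub (D := region m f) (c := offset f)
    (fun s hs => hf.hasDerivWithinAt hs) hsub
  have hw₁ := hasRadialDeriv_comp_norm_sub (D := region m f) (c := offset f)
    (fun s hs => hf.hasDerivWithinAt_warpDeriv hs) hsub
  by_cases h0 : f ⟨0, self_mem_Ici⟩ = 0
  · obtain ⟨k, hk, hke, hk0, hkpos, hF⟩ := hf.pole h0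
    have hα : ContDiff ℝ ∞ fun t => k t ^ 2 := hk.pow 2
    have hαe : ∀ t, k (-t) ^ 2 = k t ^ 2 := fun t => by rw [hke]
    obtain ⟨α₁, hα₁, hα₁e, hd₁⟩ := exists_even_deriv_eq hα hαe
    obtain ⟨α₂, hα₂, -, hd₂⟩ := exists_even_deriv_eq hα₁ hα₁e
    obtain ⟨β, hβ, hβe, hβt⟩ := exists_even_mul_sq_of_even (contDiff_const.sub hα :
      ContDiff ℝ ∞ fun t => 1 - k t ^ 2) (fun t => by rw [hke]) (by rw [hk0]; norm_num)
    obtain ⟨β₁, hβ₁, hβ₁e, hd₃⟩ := exists_even_deriv_eq hβ hβe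
    obtain ⟨β₂, hβ₂, -, hd₄⟩ := exists_even_deriv_eq hβ₁ hβ₁e
    have hrad : ∀ x : EuclideanSpace ℝ (Fin m), areaRadius f x = ‖x‖ * k ‖x‖ := fun x => by
      rw [areaRadius, offset_of_eq h0, sub_zero, hF _ (norm_nonneg x)]
    refine ⟨fun x => k ‖x‖ ^ 2, fun x => α₁ ‖x‖, fun x => α₂ ‖x‖, fun x => β ‖x‖, fun x => β₁ ‖x‖,
      fun x => β₂ ‖x‖, ⟨⟨?_, ?_, ?_, ?_, ?_, ?_, ?_, ?_⟩, ?_, ?_, hw, hw₁⟩, ?_, ?_, ?_, ?_⟩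
    · rw [region_of_eq h0]; exact uniqueDiffOn_univ
    · intro x _ i j
      rcases eq_or_ne x 0 with rfl | hx
      · simp [metric, hk0, Matrix.one_apply]
      · have hr : ‖x‖ ≠ 0 := norm_ne_zero_iff.2 hx
        have := hβt ‖x‖
        rw [metric_of_ne_zero f hx, hrad, mul_div_cancel_left₀ _ hr]
        generalize (if i = j then (1 : ℝ) else 0) = δ
        field_simp
        linear_combination (x i * x j) * this
    · exact fun x _ => by linarith [hβt ‖x‖]
    · exact fun x _ => pow_pos (hkpos _) 2
    · rw [region_of_eq h0]; exact hasRadialDeriv_comp_norm (α := fun t => k t ^ 2) hd₁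
    · rw [region_of_eq h0]; exact hasRadialDeriv_comp_norm hd₂
    · rw [region_of_eq h0]; exact hasRadialDeriv_comp_norm hd₃
    · rw [region_of_eq h0]; exact hasRadialDeriv_comp_norm hd₄
    · exact fun x _ => by rw [hrad]; ring
    · exact fun x _ hx => by rw [hrad]; exact mul_pos (norm_pos_iff.2 hx) (hkpos _)
    · exact (contDiff_comp_norm_of_even (α := fun t => k t ^ 2) hα hαe).contDiffOn
    · exact (contDiff_comp_norm_of_even hβ hβe).contDiffOn
    · exact (hα₂.continuous.comp continuous_norm).continuousOn
    · exact (hβ₂.continuous.comp continuous_norm).continuousOn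
  · obtain ⟨hF, hpos⟩ := hf.boundary h0
    have hsm : ContDiffOn ℝ ∞ (fun r => IciExtend f (r - 1)) (Ici 1) :=
      hF.comp (contDiff_id.sub contDiff_const).contDiffOn fun r hr => mem_Ici.2 (sub_nonneg.2 hr)
    have hne : ∀ r ∈ Ici (1 : ℝ), r ^ 2 ≠ 0 := fun r (hr : 1 ≤ r) => by positivity
    have hα : ContDiffOn ℝ ∞ (fun r => IciExtend f (r - 1) ^ 2 / r ^ 2) (Ici 1) :=
      (hsm.pow 2).div (contDiffOn_id.pow 2) hne
    have hβ : ContDiffOn ℝ ∞ (fun r => (1 - IciExtend f (r - 1) ^ 2 / r ^ 2) / r ^ 2) (Ici 1) :=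
      (contDiffOn_const.sub hα).div (contDiffOn_id.pow 2) hne
    obtain ⟨α₁, hα₁, hd₁⟩ := exists_hasRadialDeriv_of_contDiffOn (m := m) hα
    obtain ⟨α₂, hα₂, hd₂⟩ := exists_hasRadialDeriv_of_contDiffOn (m := m) hα₁
    obtain ⟨β₁, hβ₁, hd₃⟩ := exists_hasRadialDeriv_of_contDiffOn (m := m) hβ
    obtain ⟨β₂, hβ₂, hd₄⟩ := exists_hasRadialDeriv_of_contDiffOn (m := m) hβ₁
    rw [region_of_ne h0] at *
    have hrad : ∀ x : EuclideanSpace ℝ (Fin m), areaRadius f x = IciExtend f (‖x‖ - 1) :=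
      fun x => by
      rw [areaRadius, offset_of_ne h0]
    have hx0 : ∀ x ∈ {x : EuclideanSpace ℝ (Fin m) | 1 ≤ ‖x‖}, x ≠ 0 := by
      rintro x hx rfl
      simp at hx
      linarith
    have hp : ∀ x ∈ {x : EuclideanSpace ℝ (Fin m) | 1 ≤ ‖x‖}, 0 < IciExtend f (‖x‖ - 1) :=
      fun x hx => hpos _ (sub_nonneg.2 hx)
    refine ⟨fun x => IciExtend f (‖x‖ - 1) ^ 2 / ‖x‖ ^ 2, fun x => α₁ ‖x‖, fun x => α₂ ‖x‖,
      fun x => (1 - IciExtend f (‖x‖ - 1) ^ 2 / ‖x‖ ^ 2) / ‖x‖ ^ 2, fun x => β₁ ‖x‖,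
      fun x => β₂ ‖x‖, ⟨⟨uniqueDiffOn_one_le_norm, ?_, ?_, ?_, hd₁, hd₂, hd₃, hd₄⟩, ?_, ?_, hw, hw₁⟩,
      contDiffOn_comp_norm hα, contDiffOn_comp_norm hβ, (contDiffOn_comp_norm hα₂).continuousOn,
      (contDiffOn_comp_norm hβ₂).continuousOn⟩
    · intro x hx i j
      have hr : ‖x‖ ≠ 0 := norm_ne_zero_iff.2 (hx0 x hx)
      rw [metric_of_ne_zero f (hx0 x hx), hrad]
      generalize (if i = j then (1 : ℝ) else 0) = δ
      field_simp
      ring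
    · intro x hx
      have hr : ‖x‖ ≠ 0 := norm_ne_zero_iff.2 (hx0 x hx)
      field_simp
      ring
    · intro x hx
      have hr : 0 < ‖x‖ := norm_pos_iff.2 (hx0 x hx)
      have := hp x hx
      positivity
    · intro x hx
      have hr : ‖x‖ ≠ 0 := norm_ne_zero_iff.2 (hx0 x hx)
      rw [hrad]
      field_simp
    · exact fun x hx _ => by rw [hrad]; exact hp x hx

end RotSym

namespace RotSym

open Set Filter Topology MeasureTheory

variable {m : ℕ}

/-! ### The manifolds in terms of their warping functions -/

lemma isRiemannianMetric_of_isSmoothWarp {f : Ici (0 : ℝ) → ℝ} (hf : IsSmoothWarp f) (m : ℕ) :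
    IsRiemannianMetric (region m f) (metric m f) := by
  obtain ⟨a, a₁, a₂, b, b₁, b₂, h, ha, hb, -, -⟩ := hf.exists_isWarpedMetric m
  refine ⟨fun i j => ?_, fun x hx => ?_⟩
  · refine ContDiffOn.congr ?_ fun x hx => h.eq_of_mem x hx i j
    exact (ha.mul contDiffOn_const).add (hb.mul (by fun_prop))
  · refine Matrix.PosDef.of_dotProduct_mulVec_pos ?_ fun v hv => ?_
    · ext i j
      simp only [Matrix.conjTranspose_apply, star_trivial, h.eq_of_mem x hx]
      rw [show (if j = i then (1 : ℝ) else 0) = if i = j then 1 else 0 by simp [eq_comm]]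
      ring
    · have h1 : star v ⬝ᵥ (metric m f x).mulVec v =
          a x * ∑ i, v i ^ 2 + b x * (∑ i, x i * v i) ^ 2 := by
        have key : ∀ i j, v i * (metric m f x i j * v j) =
            (if i = j then a x * v i ^ 2 else 0) + b x * (x i * v i) * (x j * v j) := by
          intro i j
          rw [h.eq_of_mem x hx]
          by_cases h : i = j
          · subst h; simp; ring
          · simp [h]; ring
        simp only [dotProduct, Matrix.mulVec, star_trivial, Finset.mul_sum, key,
          Finset.sum_add_distrib, Finset.sum_ite_eq, Finset.mem_univ, if_true]
        simp only [← Finset.mul_sum, ← Finset.sum_mul]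
        ring
      have h2 : 0 < ∑ i, v i ^ 2 := by
        obtain ⟨i, hi⟩ := Function.ne_iff.1 hv
        exact Finset.sum_pos' (fun _ _ => sq_nonneg _)
          ⟨i, Finset.mem_univ i, by have : v i ≠ 0 := hi; positivity⟩
      have h3 : (∑ i, x i * v i) ^ 2 ≤ ‖x‖ ^ 2 * ∑ i, v i ^ 2 := by
        rw [EuclideanSpace.real_norm_sq_eq]
        exact Finset.sum_mul_sq_le_sq_mul_sq _ _ _
      have ha := h.pos x hx
      have hr := h.radial_length x hx
      rw [h1]
      -- For `b < 0`, Cauchy–Schwarz bounds the quadratic form below by `(a + ‖x‖² b)|v|² = |v|²`.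
      rcases le_or_gt 0 (b x) with hb | hb
      · have := mul_nonneg hb (sq_nonneg (∑ i, x i * v i))
        nlinarith [mul_pos ha h2]
      · have h4 := mul_le_mul_of_nonpos_left h3 hb.le
        have h5 : (a x + ‖x‖ ^ 2 * b x) * ∑ i, v i ^ 2 = ∑ i, v i ^ 2 := by rw [hr, one_mul]
        linarith

/-- The warping function of a smooth Riemannian metric is smooth. -/
lemma isSmoothWarp_of_isRiemannianMetric {f : Ici (0 : ℝ) → ℝ} (hm : 2 ≤ m)
    (hnn : ∀ s, 0 ≤ f s) (hG : IsRiemannianMetric (region m f) (metric m f)) :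
    IsSmoothWarp f := by
  let e : EuclideanSpace ℝ (Fin m) := EuclideanSpace.single ⟨0, by omega⟩ 1
  let i₁ : Fin m := ⟨1, by omega⟩
  have he : ‖e‖ = 1 := by simp [e]
  have he1 : e i₁ = 0 := by simp [e, i₁]
  have hnorm : ∀ t : ℝ, ‖t • e‖ = |t| := fun t => by rw [norm_smul, he, mul_one, Real.norm_eq_abs]
  -- Along the line `t e`, a diagonal entry in a direction orthogonal to `e` is `(f / |t|)²`. It is
  -- smooth and positive, so its square root recovers `f` smoothly.
  have hval : ∀ t : ℝ, t ≠ 0 →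
      metric m f (t • e) i₁ i₁ = (IciExtend f (|t| - offset f) / |t|) ^ 2 := by
    intro t ht
    have hte : t • e ≠ 0 := by rw [← norm_ne_zero_iff, hnorm]; exact abs_ne_zero.2 ht
    rw [metric_of_ne_zero f hte, areaRadius, hnorm]
    simp [he1]
  have hFnn : ∀ s, 0 ≤ IciExtend f s := fun s => hnn _
  refine ⟨fun h0 => ?_, fun h0 => ?_⟩
  · have hmem : ∀ s : ℝ, 0 ≤ s → (1 + s) • e ∈ region m f := fun s hs => by
      rw [region_of_ne h0]
      show 1 ≤ ‖(1 + s) • e‖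
      rw [hnorm, abs_of_pos (by linarith)]
      linarith
    have hval' : ∀ s : ℝ, 0 ≤ s →
        metric m f ((1 + s) • e) i₁ i₁ = (IciExtend f s / (1 + s)) ^ 2 := fun s hs => by
      rw [hval _ (by linarith), abs_of_pos (by linarith), offset_of_ne h0, add_sub_cancel_left]
    have hpos : ∀ s : ℝ, 0 ≤ s → 0 < IciExtend f s := fun s hs => by
      have := (hG.2 _ (hmem s hs)).diag_pos (i := i₁)
      rw [hval' s hs] at this
      refine lt_of_le_of_ne (hFnn s) fun h => ?_
      rw [← h] at this
      simp at this
    refine ⟨?_, hpos⟩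
    have h1 : ContDiffOn ℝ ∞ (fun s : ℝ => metric m f ((1 + s) • e) i₁ i₁) (Ici 0) :=
      (hG.1 i₁ i₁).comp (((contDiff_const.add contDiff_id).smul contDiff_const).contDiffOn)
        fun s hs => hmem s hs
    have h2 := (h1.sqrt fun s hs => (hG.2 _ (hmem s hs)).diag_pos.ne').mul
      ((contDiff_const.add contDiff_id).contDiffOn : ContDiffOn ℝ ∞ (fun s : ℝ => 1 + s) (Ici 0))
    refine h2.congr fun s (hs : 0 ≤ s) => ?_
    have hs' : 0 < 1 + s := by linarith
    simp only [hval' s hs]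
    rw [Real.sqrt_sq (div_nonneg (hFnn s) hs'.le), id, div_mul_cancel₀ _ hs'.ne']
  · have hmem : ∀ x, x ∈ region m f := fun x => by rw [region_of_eq h0]; trivial
    have h1 : ContDiff ℝ ∞ fun t : ℝ => metric m f (t • e) i₁ i₁ := by
      have := hG.1 i₁ i₁
      rw [region_of_eq h0, contDiffOn_univ] at this
      exact this.comp (contDiff_id.smul contDiff_const)
    have hpos : ∀ t : ℝ, 0 < metric m f (t • e) i₁ i₁ := fun t => (hG.2 _ (hmem _)).diag_pos
    -- At a pole this entry is defined for all real `t` and depends only on `|t|`, which makes `k`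
    -- even; `k(0) = 1` since the metric matrix at the origin is the identity.
    refine ⟨fun t => Real.sqrt (metric m f (t • e) i₁ i₁), h1.sqrt fun t => (hpos t).ne', ?_, ?_, ?_,
      ?_⟩
    · intro t
      rcases eq_or_ne t 0 with rfl | ht
      · simp
      · simp only [hval t ht, hval (-t) (neg_ne_zero.2 ht), abs_neg]
    · simp [metric]
    · exact fun t => Real.sqrt_pos.2 (hpos t)
    · intro s hs
      rcases hs.eq_or_lt with rfl | hs'
      · rw [IciExtend_self, h0, zero_mul]
      · simp only [hval s hs'.ne', offset_of_eq h0, sub_zero, abs_of_pos hs']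
        rw [Real.sqrt_sq (div_nonneg (hFnn s) hs), mul_div_cancel₀ _ hs'.ne']

/-- The warping functions of the manifolds of the class `RS m`. -/
structure IsProfile (m : ℕ) (f : Ici (0 : ℝ) → ℝ) : Prop extends IsSmoothWarp f where
  nonneg : 0 ≤ f ⟨0, self_mem_Ici⟩
  warpDeriv_zero : f ⟨0, self_mem_Ici⟩ ≠ 0 → warpDeriv f 0 = 0
  warpDeriv_pos : ∀ s, 0 < s → 0 < warpDeriv f s
  monotone_mass : Monotone (hawkingMass m f)
  unbounded : ¬ BddAbove (range f)

lemma hawkingMass_eq (m : ℕ) (f : Ici (0 : ℝ) → ℝ) (s : Ici (0 : ℝ)) :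
    hawkingMass m f s = IciExtend f s ^ (m - 2) / 2 * (1 - warpDeriv f s ^ 2) := by
  rw [hawkingMass, IciExtend_coe, warpDeriv]

/-- The derivative of the Hawking mass in terms of the scalar curvature. -/
lemma IsSmoothWarp.hasDerivAt_hawkingMass {f : Ici (0 : ℝ) → ℝ} (hf : IsSmoothWarp f) (hm : 3 ≤ m)
    {s : ℝ} (hs : 0 < s) :
    HasDerivAt (fun s => IciExtend f s ^ (m - 2) / 2 * (1 - warpDeriv f s ^ 2))
      (IciExtend f s ^ (m - 3) * warpDeriv f s / 2 *
        ((m - 2) * (1 - warpDeriv f s ^ 2) - 2 * IciExtend f s * warpDeriv₂ f s)) s := by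
  have h1 := hf.hasDerivAt hs
  have h2 := (hf.hasDerivWithinAt_warpDeriv hs.le).hasDerivAt (Ici_mem_nhds hs)
  refine (((h1.fun_pow (m - 2)).div_const 2).mul ((h2.fun_pow 2).const_sub 1)).congr_deriv ?_
  obtain ⟨n, rfl⟩ : ∃ n, m = n + 3 := ⟨m - 3, by omega⟩
  simp only [show n + 3 - 2 = n + 1 from rfl, Nat.add_sub_cancel]
  push_cast
  ring

lemma monotone_hawkingMass_iff {f : Ici (0 : ℝ) → ℝ} :
    Monotone (hawkingMass m f) ↔
      MonotoneOn (fun s => IciExtend f s ^ (m - 2) / 2 * (1 - warpDeriv f s ^ 2)) (Ici 0) := by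
  constructor
  · intro h s hs t ht hst
    have := h (show (⟨s, hs⟩ : Ici (0 : ℝ)) ≤ ⟨t, ht⟩ from hst)
    rwa [hawkingMass_eq, hawkingMass_eq] at this
  · intro h s t hst
    rw [hawkingMass_eq, hawkingMass_eq]
    exact h s.2 t.2 hst

lemma lt_norm_of_mem_interior_region {f : Ici (0 : ℝ) → ℝ} {x : EuclideanSpace ℝ (Fin m)}
    (hx : x ∈ interior (region m f)) (h0 : x ≠ 0) : offset f < ‖x‖ := by
  by_cases hf : f ⟨0, self_mem_Ici⟩ = 0
  · rw [offset_of_eq hf]; exact norm_pos_iff.2 h0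
  · have : region m f = (Metric.ball 0 1)ᶜ := by
      rw [region_of_ne hf]
      ext y
      simp
    rw [this, interior_compl, closure_ball _ one_ne_zero] at hx
    rw [offset_of_ne hf]
    simpa using hx

theorem isProfile_warp (hm : 3 ≤ m) (M : RS m) : IsProfile m M.warp := by
  set f := M.warp with hfdef
  have hf : IsSmoothWarp f :=
    isSmoothWarp_of_isRiemannianMetric (by omega) M.warp_nonneg M.isRiemannianMetric
  obtain ⟨a, a₁, a₂, b, b₁, b₂, h, -, -, -, -⟩ := hf.exists_isWarpedMetric m
  let e : EuclideanSpace ℝ (Fin m) := EuclideanSpace.single ⟨0, by omega⟩ 1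
  have he : ‖e‖ = 1 := by simp [e]
  have hc : 0 ≤ offset f := by rw [offset]; split_ifs <;> norm_num
  -- A zero of `f'` would give a symmetric sphere that is minimal and lies in the interior.
  have hne : ∀ s, 0 < s → warpDeriv f s ≠ 0 := by
    intro s hs h0
    have hr : 0 < s + offset f := by linarith
    have hsub : Metric.sphere 0 (s + offset f) ⊆
        {x : EuclideanSpace ℝ (Fin m) | offset f < ‖x‖} := fun x hx => by
      have : ‖x‖ = s + offset f := by simpa using hx
      show offset f < ‖x‖
      linarith
    have hint : {x : EuclideanSpace ℝ (Fin m) | offset f < ‖x‖} ⊆ interior (region m f) :=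
      interior_maximal (fun x (hx : offset f < ‖x‖) => hx.le)
        (isOpen_lt continuous_const continuous_norm)
    refine M.no_closed_interior_minimal ⟨Metric.sphere 0 (s + offset f),
      ⟨(s + offset f) • e, ?_⟩, isCompact_sphere _ _, hsub.trans hint, ?_⟩
    · simp [norm_smul, he, abs_of_pos hr]
    · refine h.isMinimalHypersurface_sphere hr ((hsub.trans hint).trans interior_subset) ?_
      intro x hx
      have : ‖x‖ = s + offset f := by simpa using hx
      rw [this, add_sub_cancel_right, h0]
  -- Having no zeros, `f'` keeps one sign on `(0, ∞)`; the negative sign would bound `f` by `f(0)`.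
  have hpos : ∀ s, 0 < s → 0 < warpDeriv f s := by
    by_contra! hcon
    obtain ⟨s, hs, hs0⟩ := hcon
    have hs0 : warpDeriv f s < 0 := lt_of_le_of_ne hs0 (hne s hs)
    have hcont : ContinuousOn (warpDeriv f) (Ioi 0) :=
      hf.contDiffOn_warpDeriv.continuousOn.mono Ioi_subset_Ici_self
    have hneg : ∀ t, 0 < t → warpDeriv f t ≤ 0 := by
      intro t ht
      by_contra! htpos
      obtain ⟨r, hr, hr0⟩ := isPreconnected_Ioi.intermediate_value (mem_Ioi.2 hs) (mem_Ioi.2 ht) hcont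
        (show (0 : ℝ) ∈ Icc _ _ from ⟨hs0.le, htpos.le⟩)
      exact hne r hr hr0
    have hanti : AntitoneOn (IciExtend f) (Ici 0) := by
      refine antitoneOn_of_deriv_nonpos (convex_Ici 0) hf.contDiffOn.continuousOn ?_ ?_
      · rw [interior_Ici]
        exact fun t ht => (hf.hasDerivAt ht).differentiableAt.differentiableWithinAt
      · rw [interior_Ici]
        intro t ht
        rw [(hf.hasDerivAt ht).deriv]
        exact hneg t ht
    refine M.unbounded_area ⟨IciExtend f 0, ?_⟩
    rintro _ ⟨t, rfl⟩
    have := hanti self_mem_Ici t.2 t.2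
    rwa [IciExtend_coe] at this
  refine ⟨hf, M.warp_nonneg _, fun h0 => ?_, hpos, ?_, M.unbounded_area⟩
  · have h1 := h.eq_zero_of_isMinimalHypersurface_sphere (by omega) (M.boundary_minimal h0)
      (p := e) (by simp [he]) (by rw [← norm_ne_zero_iff, he]; norm_num)
    simpa [he, offset_of_ne h0] using h1
  · rw [monotone_hawkingMass_iff]
    refine monotoneOn_of_deriv_nonneg (convex_Ici 0) ?_ ?_ ?_
    · exact ((hf.contDiffOn.continuousOn.pow _).div_const _).mul
        (continuousOn_const.sub (hf.contDiffOn_warpDeriv.continuousOn.pow 2))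
    · rw [interior_Ici]
      exact fun t ht => (hf.hasDerivAt_hawkingMass hm ht).differentiableAt.differentiableWithinAt
    · rw [interior_Ici]
      intro s hs
      have hs : 0 < s := hs
      have hF := hf.pos hs
      rw [(hf.hasDerivAt_hawkingMass hm hs).deriv]
      refine mul_nonneg (by have := hpos s hs; positivity) ?_
      have hn : ‖(s + offset f) • e‖ = s + offset f := by
        rw [norm_smul, he, mul_one, Real.norm_eq_abs, abs_of_pos (by linarith)]
      have hx : (s + offset f) • e ∈ region m f := by
        show offset f ≤ _
        rw [hn]; linarith
      have hx0 : (s + offset f) • e ≠ 0 := by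
        rw [← norm_ne_zero_iff, hn]; linarith
      have h1 := M.scalarCurvature_nonneg _ hx
      rw [h.scalarCurvature_eq hx hx0, areaRadius, hn, add_sub_cancel_right] at h1
      have hm' : (0 : ℝ) < m - 1 := by
        have : (3 : ℝ) ≤ m := by exact_mod_cast hm
        linarith
      exact nonneg_of_mul_nonneg_right h1 (by positivity)

/-- `f''(0)` is the limit of `f'(s)/s > 0`. It yields the stability of the boundary. -/
lemma IsProfile.warpDeriv₂_zero_nonneg {f : Ici (0 : ℝ) → ℝ} (hf : IsProfile m f)
    (h0 : f ⟨0, self_mem_Ici⟩ ≠ 0) : 0 ≤ warpDeriv₂ f 0 := by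
  have h1 := hasDerivWithinAt_iff_tendsto_slope.1 (hf.hasDerivWithinAt_warpDeriv le_rfl)
  rw [Ici_sdiff_left] at h1
  refine ge_of_tendsto h1 ?_
  filter_upwards [self_mem_nhdsWithin] with s (hs : 0 < s)
  rw [slope_def_field, hf.warpDeriv_zero h0, sub_zero, sub_zero]
  exact div_nonneg (hf.warpDeriv_pos s hs).le hs.le

/-- For `s > 0` the derivative of the mass is the scalar curvature times a positive factor, because
`f' > 0`. The pole and the boundary are reached by continuity. -/
lemma IsProfile.scalarCurvature_nonneg {f : Ici (0 : ℝ) → ℝ} (hf : IsProfile m f) (hm : 3 ≤ m) :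
    ∀ x ∈ region m f, 0 ≤ scalarCurvature (region m f) (metric m f) x := by
  obtain ⟨a, a₁, a₂, b, b₁, b₂, h, -, -, ha, hb⟩ := hf.exists_isWarpedMetric m
  have hc : 0 ≤ offset f := by rw [offset]; split_ifs <;> norm_num
  have hint : ∀ x, offset f < ‖x‖ → 0 ≤ scalarCurvature (region m f) (metric m f) x := by
    intro x hx
    have hx0 : x ≠ 0 := by rw [← norm_ne_zero_iff]; linarith
    have hs : 0 < ‖x‖ - offset f := sub_pos.2 hx
    have hm' : (0 : ℝ) < m - 1 := by
      have : (3 : ℝ) ≤ m := by exact_mod_cast hm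
      linarith
    rw [h.scalarCurvature_eq hx.le hx0]
    refine mul_nonneg (by positivity) ?_
    have h1 := (hf.hasDerivAt_hawkingMass hm hs).hasDerivWithinAt (s := Ici 0)
    have h2 := (monotone_hawkingMass_iff.1 hf.monotone_mass).derivWithin_nonneg
      (x := ‖x‖ - offset f)
    rw [h1.derivWithin (uniqueDiffOn_Ici 0 _ hs.le)] at h2
    have := hf.pos hs
    have := hf.warpDeriv_pos _ hs
    exact nonneg_of_mul_nonneg_right h2 (by positivity)
  intro x hx
  -- `w` is a direction in which the norm increases: `x` itself, or any nonzero vector at the pole.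
  obtain ⟨w, hw⟩ : ∃ w : EuclideanSpace ℝ (Fin m), ∀ t : ℝ, 0 < t → ‖x‖ < ‖x + t • w‖ := by
    rcases eq_or_ne x 0 with rfl | hx0
    · refine ⟨EuclideanSpace.single ⟨0, by omega⟩ 1, fun t ht => ?_⟩
      rw [zero_add, norm_zero, norm_smul]
      simpa using ht.ne'
    · refine ⟨x, fun t ht => ?_⟩
      have h1 : x + t • x = (1 + t) • x := by rw [add_smul, one_smul]
      have h2 : 0 < ‖x‖ := norm_pos_iff.2 hx0
      rw [h1, norm_smul, Real.norm_eq_abs, abs_of_pos (by linarith)]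
      nlinarith
  have hxc : offset f ≤ ‖x‖ := hx
  have hcont := h.continuousOn_scalarCurvature ha hb x hx
  have hlim : Tendsto (fun t : ℝ => x + t • w) (𝓝[>] 0) (𝓝[region m f] x) := by
    refine tendsto_nhdsWithin_iff.2 ⟨?_, ?_⟩
    · have : Continuous fun t : ℝ => x + t • w := by fun_prop
      exact (this.tendsto' 0 x (by simp)).mono_left nhdsWithin_le_nhds
    · filter_upwards [self_mem_nhdsWithin] with t ht
      exact hxc.trans (hw t ht).le
  refine ge_of_tendsto (hcont.tendsto.comp hlim) ?_
  filter_upwards [self_mem_nhdsWithin] with t ht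
  exact hint _ (hxc.trans_lt (hw t ht))

/-- A profile is the warping function of a manifold of the class `RS m`. -/
noncomputable def IsProfile.toRS {f : Ici (0 : ℝ) → ℝ} (hf : IsProfile m f) (hm : 3 ≤ m) :
    RS m where
  warp := f
  warp_nonneg s := by
    rcases (mem_Ici.1 s.2).eq_or_lt with h | h
    · rw [show s = ⟨0, self_mem_Ici⟩ from Subtype.ext h.symm]
      exact hf.nonneg
    · rw [← IciExtend_coe f]
      exact (hf.pos h).le
  isRiemannianMetric := isRiemannianMetric_of_isSmoothWarp hf.toIsSmoothWarp m
  scalarCurvature_nonneg := hf.scalarCurvature_nonneg hm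
  no_closed_interior_minimal := by
    obtain ⟨a, a₁, a₂, b, b₁, b₂, h, -⟩ := hf.exists_isWarpedMetric m
    refine h.not_isClosedInteriorMinimal (by omega) fun x hx hx0 => ?_
    exact hf.warpDeriv_pos _ (sub_pos.2 (lt_norm_of_mem_interior_region hx hx0))
  boundary_minimal h0 := by
    obtain ⟨a, a₁, a₂, b, b₁, b₂, h, -⟩ := hf.exists_isWarpedMetric m
    refine h.isMinimalHypersurface_sphere one_pos (fun x hx => ?_) fun x hx => ?_
    · rw [region_of_ne h0]
      exact (show ‖x‖ = 1 by simpa using hx).ge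
    · rw [show ‖x‖ = 1 by simpa using hx, offset_of_ne h0, sub_self, hf.warpDeriv_zero h0]
  boundary_stable h0 := by
    obtain ⟨a, a₁, a₂, b, b₁, b₂, h, -⟩ := hf.exists_isWarpedMetric m
    refine h.isStableUnitSphere (by omega) (fun x hx => ?_) (fun x hx => ?_) fun x hx => ?_
    · rw [region_of_ne h0]
      exact (show ‖x‖ = 1 by simpa using hx).ge
    · rw [show ‖x‖ = 1 by simpa using hx, offset_of_ne h0, sub_self, hf.warpDeriv_zero h0]
    · rw [show ‖x‖ = 1 by simpa using hx, offset_of_ne h0, sub_self]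
      exact hf.warpDeriv₂_zero_nonneg h0
  unbounded_area := hf.unbounded

end RotSym

/-! ### From a warping function to an admissible mass -/

namespace RotSym

open Set Filter Topology MeasureTheory

variable {m : ℕ}

/-- A smooth odd function with positive derivative, unbounded above, has a smooth odd inverse. -/
lemma exists_odd_inverse {h : ℝ → ℝ} (hh : ContDiff ℝ ∞ h) (ho : ∀ t, h (-t) = -h t)
    (hpos : ∀ t, 0 < deriv h t) (hunb : ∀ C, ∃ t, C ≤ h t) :
    ∃ g : ℝ → ℝ, ContDiff ℝ ∞ g ∧ (∀ r, g (-r) = -g r) ∧ StrictMono g ∧ (∀ t, g (h t) = t) ∧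
      ∀ r, h (g r) = r := by
  have hmono : StrictMono h := strictMono_of_deriv_pos hpos
  have hs : Function.Surjective h := by
    refine hh.continuous.surjective ?_ ?_
    · refine tendsto_atTop_atTop.2 fun C => ?_
      obtain ⟨t, ht⟩ := hunb C
      exact ⟨t, fun s hs => ht.trans (hmono.monotone hs)⟩
    · refine tendsto_atBot_atBot.2 fun C => ?_
      obtain ⟨t, ht⟩ := hunb (-C)
      refine ⟨-t, fun s hs => (hmono.monotone hs).trans ?_⟩
      rw [ho]; linarith
  let e := hmono.orderIsoOfSurjective h hs
  have h1 : ∀ t, e.symm (h t) = t := fun t => e.symm_apply_apply t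
  have h2 : ∀ r, h (e.symm r) = r := fun r => e.apply_symm_apply r
  refine ⟨e.symm, ?_, fun r => ?_, e.symm.strictMono, h1, h2⟩
  · rw [← contDiffOn_univ]
    refine contDiffOn_of_hasDerivAt_comp (Ψ := fun t => (deriv h t)⁻¹) (V := univ) isOpen_univ
      ?_ (fun r _ => ?_) (mapsTo_univ _ _)
    · exact ((contDiff_infty_iff_deriv.1 hh).2.inv fun t => (hpos t).ne').contDiffOn
    · exact HasDerivAt.of_local_left_inverse e.symm.continuous.continuousAt
        (hh.differentiable (by simp) _).hasDerivAt (hpos _).ne' (Eventually.of_forall h2)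
  · apply hmono.injective
    rw [ho, h2, h2]

namespace IsProfile

variable {f : Ici (0 : ℝ) → ℝ}

lemma strictMonoOn (hf : IsProfile m f) : StrictMonoOn (IciExtend f) (Ici 0) := by
  refine strictMonoOn_of_deriv_pos (convex_Ici 0) hf.contDiffOn.continuousOn fun s hs => ?_
  rw [interior_Ici] at hs
  rw [(hf.hasDerivAt hs).deriv]
  exact hf.warpDeriv_pos s hs

lemma exists_le (hf : IsProfile m f) (C : ℝ) : ∃ s, 0 ≤ s ∧ C ≤ IciExtend f s := by
  have := hf.unbounded
  rw [not_bddAbove_iff] at this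
  obtain ⟨_, ⟨s, rfl⟩, hs⟩ := this C
  exact ⟨s, s.2, by rw [IciExtend_coe]; exact hs.le⟩

lemma exists_inv (hf : IsProfile m f) :
    ∃ g : ℝ → ℝ, Continuous g ∧ StrictMono g ∧ (∀ s, 0 ≤ s → g (IciExtend f s) = s) ∧
      ∀ r, f ⟨0, self_mem_Ici⟩ ≤ r → IciExtend f (g r) = r ∧ 0 ≤ g r := by
  have := exists_continuous_inverse hf.contDiffOn.continuousOn hf.strictMonoOn hf.exists_le
  rwa [IciExtend_self] at this

/-- The distance from the pole or the boundary as a function of the area radius. -/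
noncomputable def inv (hf : IsProfile m f) : ℝ → ℝ := hf.exists_inv.choose

lemma continuous_inv (hf : IsProfile m f) : Continuous hf.inv := hf.exists_inv.choose_spec.1

lemma strictMono_inv (hf : IsProfile m f) : StrictMono hf.inv := hf.exists_inv.choose_spec.2.1

lemma inv_warp (hf : IsProfile m f) {s : ℝ} (hs : 0 ≤ s) : hf.inv (IciExtend f s) = s :=
  hf.exists_inv.choose_spec.2.2.1 s hs

lemma warp_inv (hf : IsProfile m f) {r : ℝ} (hr : f ⟨0, self_mem_Ici⟩ ≤ r) :
    IciExtend f (hf.inv r) = r :=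
  (hf.exists_inv.choose_spec.2.2.2 r hr).1

lemma inv_nonneg (hf : IsProfile m f) {r : ℝ} (hr : f ⟨0, self_mem_Ici⟩ ≤ r) : 0 ≤ hf.inv r :=
  (hf.exists_inv.choose_spec.2.2.2 r hr).2

lemma inv_zero (hf : IsProfile m f) : hf.inv (f ⟨0, self_mem_Ici⟩) = 0 := by
  rw [← IciExtend_self f, hf.inv_warp le_rfl]

lemma inv_pos (hf : IsProfile m f) {r : ℝ} (hr : f ⟨0, self_mem_Ici⟩ < r) : 0 < hf.inv r := by
  rw [← hf.inv_zero]
  exact hf.strictMono_inv hr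

lemma warp_zero_le (hf : IsProfile m f) {s : ℝ} (hs : 0 ≤ s) :
    f ⟨0, self_mem_Ici⟩ ≤ IciExtend f s := by
  rw [← IciExtend_self f]
  exact hf.strictMonoOn.monotoneOn self_mem_Ici hs hs

lemma hasDerivAt_inv (hf : IsProfile m f) {r : ℝ} (hr : f ⟨0, self_mem_Ici⟩ < r) :
    HasDerivAt hf.inv (warpDeriv f (hf.inv r))⁻¹ r := by
  refine HasDerivAt.of_local_left_inverse hf.continuous_inv.continuousAt
    (hf.hasDerivAt (hf.inv_pos hr)) (hf.warpDeriv_pos _ (hf.inv_pos hr)).ne' ?_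
  filter_upwards [lt_mem_nhds hr] with y hy using hf.warp_inv hy.le

lemma contDiffOn_inv (hf : IsProfile m f) :
    ContDiffOn ℝ ∞ hf.inv (Ioi (f ⟨0, self_mem_Ici⟩)) :=
  contDiffOn_of_hasDerivAt_comp (Ψ := fun s => (warpDeriv f s)⁻¹) (V := Ioi 0) isOpen_Ioi
    ((hf.contDiffOn_warpDeriv.mono Ioi_subset_Ici_self).inv fun s hs =>
      (hf.warpDeriv_pos s hs).ne')
    (fun _ hr => hf.hasDerivAt_inv hr) fun _ hr => hf.inv_pos hr

/-- The Hawking mass as a function of the area radius. -/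
noncomputable def mass (hf : IsProfile m f) (r : Ici (f ⟨0, self_mem_Ici⟩)) : ℝ :=
  hawkingMass m f ⟨hf.inv r, hf.inv_nonneg r.2⟩

lemma mass_extend (hf : IsProfile m f) {r : ℝ} (hr : f ⟨0, self_mem_Ici⟩ ≤ r) :
    IciExtend hf.mass r = r ^ (m - 2) / 2 * (1 - warpDeriv f (hf.inv r) ^ 2) := by
  rw [IciExtend_of_mem _ hr, mass, hawkingMass_eq, hf.warp_inv hr]

lemma hawkingMass_zero (hf : IsProfile m f) (hm : 3 ≤ m) :
    hawkingMass m f ⟨0, self_mem_Ici⟩ = f ⟨0, self_mem_Ici⟩ ^ (m - 2) / 2 := by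
  rw [hawkingMass_eq, IciExtend_self]
  by_cases h0 : f ⟨0, self_mem_Ici⟩ = 0
  · rw [h0, zero_pow (by omega)]; ring
  · rw [hf.warpDeriv_zero h0]; ring

/-- The mass is nonnegative at `s = 0` and monotone, hence nonnegative throughout. -/
lemma warpDeriv_sq_le_one (hf : IsProfile m f) (hm : 3 ≤ m) {s : ℝ} (hs : 0 < s) :
    warpDeriv f s ^ 2 ≤ 1 := by
  have h1 := hf.monotone_mass (show (⟨0, self_mem_Ici⟩ : Ici (0 : ℝ)) ≤ ⟨s, hs.le⟩ from hs.le)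
  rw [hf.hawkingMass_zero hm, hawkingMass_eq] at h1
  have h2 : 0 ≤ f ⟨0, self_mem_Ici⟩ ^ (m - 2) / 2 := by have := hf.nonneg; positivity
  have h3 : 0 < IciExtend f s ^ (m - 2) / 2 := by have := hf.pos hs; positivity
  have := nonneg_of_mul_nonneg_right (h2.trans h1) h3
  linarith

/-- With `r = f(s)`, the definition of the mass gives `2 m_H = r^(m-2) (1 - f'²)` and `r^(m-2) - 2
m_H = r^(m-2) f'²`. -/
lemma slope_mass (hf : IsProfile m f) {r : ℝ} (hr : f ⟨0, self_mem_Ici⟩ < r) :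
    slope m hf.mass r = Real.sqrt (1 - warpDeriv f (hf.inv r) ^ 2) / warpDeriv f (hf.inv r) := by
  have h1 := hf.warpDeriv_pos _ (hf.inv_pos hr)
  have h2 : 0 < r ^ (m - 2) := pow_pos (hf.nonneg.trans_lt hr) _
  rw [slope, hf.mass_extend hr.le]
  rw [← Real.sqrt_sq h1.le, ← Real.sqrt_div' _ (sq_nonneg _), Real.sqrt_sq h1.le]
  congr 1
  field_simp
  ring_nf

lemma one_add_slope_sq (hf : IsProfile m f) (hm : 3 ≤ m) {r : ℝ}
    (hr : f ⟨0, self_mem_Ici⟩ < r) :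
    Real.sqrt (1 + slope m hf.mass r ^ 2) = (warpDeriv f (hf.inv r))⁻¹ := by
  have h1 := hf.warpDeriv_pos _ (hf.inv_pos hr)
  have h2 := hf.warpDeriv_sq_le_one hm (hf.inv_pos hr)
  rw [hf.slope_mass hr, div_pow, Real.sq_sqrt (by linarith)]
  rw [show 1 + (1 - warpDeriv f (hf.inv r) ^ 2) / warpDeriv f (hf.inv r) ^ 2 =
    ((warpDeriv f (hf.inv r))⁻¹) ^ 2 by field_simp; ring, Real.sqrt_sq (by positivity)]

/-- The integrand may blow up at the left end, where `f'(0) = 0` at a boundary, but it is the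
nonnegative derivative of the continuous function `hf.inv`. -/
lemma intervalIntegrable_sqrt (hf : IsProfile m f) (hm : 3 ≤ m) {r : ℝ}
    (hr : f ⟨0, self_mem_Ici⟩ ≤ r) :
    IntervalIntegrable (fun t => Real.sqrt (1 + slope m hf.mass t ^ 2)) volume
      (f ⟨0, self_mem_Ici⟩) r := by
  refine intervalIntegral.intervalIntegrable_deriv_of_nonneg hf.continuous_inv.continuousOn ?_
    fun _ _ => Real.sqrt_nonneg _
  intro t ht
  rw [min_eq_left hr] at ht
  rw [hf.one_add_slope_sq hm ht.1]
  exact hf.hasDerivAt_inv ht.1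

/-- The distance from the pole or the boundary is the length of the profile curve. -/
lemma arcLength_mass (hf : IsProfile m f) (hm : 3 ≤ m) {r : ℝ}
    (hr : f ⟨0, self_mem_Ici⟩ ≤ r) : arcLength m hf.mass r = hf.inv r := by
  rw [arcLength, intervalIntegral.integral_eq_sub_of_hasDerivAt_of_le hr
    hf.continuous_inv.continuousOn (fun t ht => ?_) (hf.intervalIntegrable_sqrt hm hr), hf.inv_zero,
    sub_zero]
  rw [hf.one_add_slope_sq hm ht.1]
  exact hf.hasDerivAt_inv ht.1

/-- The odd extension `t k(t)` of `f` has a smooth odd inverse `g`. Hence `1 - f'(g(r))²` is smooth,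
even and zero at `0`, so it equals `r² χ(r)`, and `ψ = χ / 2`. -/
lemma exists_even_mass (hf : IsProfile m f) (hm : 3 ≤ m) (h0 : f ⟨0, self_mem_Ici⟩ = 0) :
    ∃ ψ : ℝ → ℝ, ContDiff ℝ ∞ ψ ∧ (∀ t, ψ (-t) = ψ t) ∧
      ∀ r, 0 ≤ r → IciExtend hf.mass r = r ^ m * ψ r := by
  obtain ⟨k, hk, hke, hk0, hkpos, hF⟩ := hf.pole h0
  have hh : ContDiff ℝ ∞ fun t => t * k t := contDiff_id.mul hk
  have ho : ∀ t, -t * k (-t) = -(t * k t) := fun t => by rw [hke]; ring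
  have hd : ∀ s, 0 ≤ s → warpDeriv f s = deriv (fun t => t * k t) s := by
    intro s hs
    have h1 := (hh.differentiable (by simp) s).hasDerivAt.hasDerivWithinAt (s := Ici 0)
    exact (h1.congr hF (hF s hs)).derivWithin (uniqueDiffOn_Ici 0 s hs)
  have hd0 : deriv (fun t => t * k t) 0 = 1 := by
    have := (hasDerivAt_id (0 : ℝ)).mul (hk.differentiable (by simp) 0).hasDerivAt
    rw [show (fun t => t * k t) = id * k from rfl, this.deriv]
    simp [hk0]
  have hde : ∀ t, deriv (fun t => t * k t) (-t) = deriv (fun t => t * k t) t :=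
    deriv_neg_of_odd ho
  have hpos : ∀ t, 0 < deriv (fun t => t * k t) t := by
    intro t
    rcases lt_trichotomy t 0 with ht | rfl | ht
    · rw [← hde, ← hd _ (by linarith)]
      exact hf.warpDeriv_pos _ (by linarith)
    · rw [hd0]; exact one_pos
    · rw [← hd _ ht.le]
      exact hf.warpDeriv_pos _ ht
  obtain ⟨g, hg, hgo, hgm, -, hgr⟩ := exists_odd_inverse hh ho hpos fun C => by
    obtain ⟨s, hs, hC⟩ := hf.exists_le C
    exact ⟨s, by rwa [← hF s hs]⟩
  have hg0 : g 0 = 0 := by have := hgo 0; simp at this; linarith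
  have hdg : ContDiff ℝ ∞ fun r => 1 - deriv (fun t => t * k t) (g r) ^ 2 :=
    contDiff_const.sub (((contDiff_infty_iff_deriv.1 hh).2.comp hg).pow 2)
  obtain ⟨χ, hχ, hχe, hχr⟩ := exists_even_mul_sq_of_even hdg (fun r => by rw [hgo, hde])
    (by rw [hg0, hd0]; norm_num)
  refine ⟨fun r => χ r / 2, hχ.div_const 2, fun t => by simp only [hχe], fun r hr => ?_⟩
  have hgnn : 0 ≤ g r := by rw [← hg0]; exact hgm.monotone hr
  have hinv : hf.inv r = g r := by
    rw [← hf.inv_warp hgnn, hF _ hgnn, hgr]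
  rw [hf.mass_extend (by rwa [h0]), hinv, hd _ hgnn, hχr]
  obtain ⟨n, rfl⟩ : ∃ n, m = n + 2 := ⟨m - 2, by omega⟩
  rw [Nat.add_sub_cancel]
  ring

/-- The Hawking mass of a manifold of the class `RS m` is admissible. -/
noncomputable def toAdmissibleMass (hf : IsProfile m f) (hm : 3 ≤ m) : AdmissibleMass m where
  rmin := f ⟨0, self_mem_Ici⟩
  mass := hf.mass
  rmin_nonneg := hf.nonneg
  monotone_mass r r' h := hf.monotone_mass (hf.strictMono_inv.monotone h)
  mass_rmin := by
    rw [← hf.hawkingMass_zero hm, mass]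
    congr 2
    exact hf.inv_zero
  mass_lt r hr := by
    rw [← IciExtend_coe hf.mass, hf.mass_extend hr.le]
    have h1 := hf.warpDeriv_pos _ (hf.inv_pos hr)
    have h2 : 0 < (r : ℝ) ^ (m - 2) := pow_pos (hf.nonneg.trans_lt hr) _
    nlinarith [mul_pos h2 (pow_pos h1 2)]
  smooth_mass := by
    refine ContDiffOn.congr ?_ fun r hr => hf.mass_extend (le_of_lt hr)
    have h1 : ContDiffOn ℝ ∞ (fun r => warpDeriv f (hf.inv r)) (Ioi (f ⟨0, self_mem_Ici⟩)) :=
      hf.contDiffOn_warpDeriv.comp hf.contDiffOn_inv fun r hr => hf.inv_nonneg (le_of_lt hr)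
    exact ((contDiff_id.pow _).div_const 2).contDiffOn.mul (contDiffOn_const.sub (h1.pow 2))
  smooth_pole h0 := by
    obtain ⟨ψ, hψ, hψe, hψr⟩ := hf.exists_even_mass hm h0
    exact ⟨ψ, hψ, hψe, fun r => by
      rw [← IciExtend_coe hf.mass, hψr _ (hf.nonneg.trans r.2)]⟩
  smooth_boundary h0 := by
    -- The arc length is the inverse of `f`, so `f` itself expresses `r` through the arc length.
    refine ⟨fun r hr => hf.intervalIntegrable_sqrt hm hr, IciExtend f, hf.contDiffOn,
      fun r hr => ?_⟩
    rw [hf.arcLength_mass hm hr, hf.warp_inv hr]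

end IsProfile

end RotSym

/-! ### From an admissible mass to a warping function -/

section

open RotSym Set Filter Topology MeasureTheory

variable {m : ℕ}

lemma continuousOn_primitive_Ici {φ : ℝ → ℝ} {a : ℝ}
    (hφ : ∀ r, a ≤ r → IntervalIntegrable φ volume a r) :
    ContinuousOn (fun r => ∫ t in a..r, φ t) (Ici a) := by
  intro r hr
  have hr : a ≤ r := hr
  have h1 : ContinuousOn (fun r => ∫ t in a..r, φ t) (uIcc a (r + 1)) :=
    intervalIntegral.continuousOn_primitive_interval
      (by
        have := (intervalIntegrable_iff_integrableOn_Icc_of_le (by linarith) (by simp)).1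
          (hφ (r + 1) (by linarith))
        rwa [uIcc_of_le (by linarith)])
  rw [uIcc_of_le (by linarith)] at h1
  refine (h1 r ⟨hr, by linarith⟩).mono_of_mem_nhdsWithin ?_
  rw [← Ici_inter_Iic]
  exact inter_mem_nhdsWithin _ (Iic_mem_nhds (by linarith))

/-- The domain of `mass` depends on `rmin`; comparing extensions to `ℝ` avoids transport between the
domains. -/
lemma AdmissibleMass.ext_of_eq {μ ν : AdmissibleMass m} (h : μ.rmin = ν.rmin)
    (hmass : ∀ r, μ.rmin ≤ r → IciExtend μ.mass r = IciExtend ν.mass r) : μ = ν := by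
  obtain ⟨a, μ, _, _, _, _, _, _, _⟩ := μ
  obtain ⟨b, ν, _, _, _, _, _, _, _⟩ := ν
  obtain rfl : a = b := h
  obtain rfl : μ = ν := by
    ext ⟨r, hr⟩
    simpa [IciExtend_of_mem _ hr] using hmass r hr
  rfl

namespace AdmissibleMass

variable (μ : AdmissibleMass m)

lemma extend_lt {r : ℝ} (hr : μ.rmin < r) : IciExtend μ.mass r < r ^ (m - 2) / 2 := by
  rw [IciExtend_of_mem _ (mem_Ici.2 hr.le)]
  exact μ.mass_lt ⟨r, hr.le⟩ hr

lemma le_extend {r : ℝ} (hr : μ.rmin ≤ r) : μ.rmin ^ (m - 2) / 2 ≤ IciExtend μ.mass r := by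
  rw [IciExtend_of_mem _ hr, ← μ.mass_rmin]
  exact μ.monotone_mass (Subtype.mk_le_mk.2 hr)

lemma extend_nonneg {r : ℝ} (hr : μ.rmin ≤ r) : 0 ≤ IciExtend μ.mass r :=
  le_trans (by have := μ.rmin_nonneg; positivity) (μ.le_extend hr)

lemma one_add_slope_sq {r : ℝ} (hr : μ.rmin < r) :
    1 + slope m μ.mass r ^ 2 = r ^ (m - 2) / (r ^ (m - 2) - 2 * IciExtend μ.mass r) := by
  have h1 := μ.extend_lt hr
  have h2 : 0 < r ^ (m - 2) - 2 * IciExtend μ.mass r := by linarith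
  rw [RotSym.slope,
    Real.sq_sqrt (div_nonneg (mul_nonneg zero_le_two (μ.extend_nonneg hr.le)) h2.le)]
  field_simp
  ring

lemma continuousAt_slope {r : ℝ} (hr : μ.rmin < r) : ContinuousAt (RotSym.slope m μ.mass) r := by
  have h1 := μ.extend_lt hr
  have h2 : ContinuousAt (IciExtend μ.mass) r :=
    (μ.smooth_mass.contDiffAt (Ioi_mem_nhds hr)).continuousAt
  refine ContinuousAt.sqrt ?_
  refine (h2.const_mul 2).div ((continuousAt_id.pow _).sub (h2.const_mul 2)) ?_
  intro h
  have : r ^ (m - 2) - 2 * IciExtend μ.mass r = 0 := h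
  linarith

lemma continuousAt_sqrt {r : ℝ} (hr : μ.rmin < r) :
    ContinuousAt (fun t => Real.sqrt (1 + slope m μ.mass t ^ 2)) r :=
  (((μ.continuousAt_slope hr).pow 2).const_add 1).sqrt

lemma one_le_sqrt (r : ℝ) : 1 ≤ Real.sqrt (1 + slope m μ.mass r ^ 2) := by
  rw [Real.one_le_sqrt]
  linarith [sq_nonneg (slope m μ.mass r)]

/-- At a pole, the speed of the profile curve is a smooth even function of the area radius. -/
lemma exists_even_speed (hm : 3 ≤ m) (h0 : μ.rmin = 0) :
    ∃ v : ℝ → ℝ, ContDiff ℝ ∞ v ∧ (∀ t, v (-t) = v t) ∧ v 0 = 1 ∧ (∀ t, 1 ≤ v t) ∧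
      ∀ t, 0 < t → Real.sqrt (1 + slope m μ.mass t ^ 2) = v t := by
  obtain ⟨ψ, hψ, hψe, hmass⟩ := μ.smooth_pole h0
  obtain ⟨n, rfl⟩ : ∃ n, m = n + 2 := ⟨m - 2, by omega⟩
  have hext : ∀ t, 0 < t → IciExtend μ.mass t = t ^ (n + 2) * ψ t := fun t ht => by
    rw [IciExtend_of_mem _ (mem_Ici.2 (h0 ▸ ht.le)), hmass]
  have hpos : ∀ t, 0 < t → 0 ≤ t ^ 2 * ψ t ∧ 2 * (t ^ 2 * ψ t) < 1 := by
    intro t ht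
    have h1 := μ.extend_nonneg (h0 ▸ ht.le : μ.rmin ≤ t)
    have h2 := μ.extend_lt (h0 ▸ ht : μ.rmin < t)
    have h3 : 0 < t ^ n := pow_pos ht n
    rw [hext t ht] at h1 h2
    rw [Nat.add_sub_cancel] at h2
    constructor
    · refine nonneg_of_mul_nonneg_right (a := t ^ n) ?_ h3
      rwa [← mul_assoc, ← pow_add]
    · have : t ^ n * (2 * (t ^ 2 * ψ t)) < t ^ n * 1 := by
        rw [pow_add] at h2; linarith
      exact lt_of_mul_lt_mul_left this h3.le
  -- Evenness of `ψ` carries the bound to negative `t`, so `1 - 2t²ψ(t)` is positive on all of `ℝ`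
  -- and its inverse square root is smooth.
  have hall : ∀ t, 0 ≤ t ^ 2 * ψ t ∧ 2 * (t ^ 2 * ψ t) < 1 := by
    intro t
    rcases lt_trichotomy t 0 with ht | rfl | ht
    · have := hpos (-t) (by linarith)
      rwa [hψe, neg_sq] at this
    · simp
    · exact hpos t ht
  have hsm : ContDiff ℝ ∞ fun t => (1 - 2 * (t ^ 2 * ψ t)) :=
    contDiff_const.sub (contDiff_const.mul ((contDiff_id.pow 2).mul hψ))
  refine ⟨fun t => (Real.sqrt (1 - 2 * (t ^ 2 * ψ t)))⁻¹, ?_, fun t => ?_, by simp, fun t => ?_,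
    fun t ht => ?_⟩
  · refine (hsm.sqrt fun t => ?_).inv fun t => ?_
    · have := (hall t).2
      intro h; linarith
    · have := (hall t).2
      exact (Real.sqrt_pos.2 (by linarith)).ne'
  · simp only [hψe, neg_sq]
  · have := hall t
    rw [one_le_inv₀ (Real.sqrt_pos.2 (by linarith)), Real.sqrt_le_one]
    linarith
  · have h3 : 0 < t ^ n := pow_pos ht n
    have h4 := (hall t).2
    have h5 : 0 < 1 - 2 * (t ^ 2 * ψ t) := by linarith
    show _ = (Real.sqrt (1 - 2 * (t ^ 2 * ψ t)))⁻¹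
    rw [μ.one_add_slope_sq (h0 ▸ ht), hext t ht, ← Real.sqrt_inv, Nat.add_sub_cancel]
    congr 1
    rw [show t ^ n - 2 * (t ^ (n + 2) * ψ t) = t ^ n * (1 - 2 * (t ^ 2 * ψ t)) by ring,
      div_mul_cancel_left₀ h3.ne']

lemma intervalIntegrable_sqrt (hm : 3 ≤ m) {r : ℝ} (hr : μ.rmin ≤ r) :
    IntervalIntegrable (fun t => Real.sqrt (1 + slope m μ.mass t ^ 2)) volume μ.rmin r := by
  rcases μ.rmin_nonneg.eq_or_lt with h0 | h0
  · obtain ⟨v, hv, -, -, -, hvt⟩ := μ.exists_even_speed hm h0.symm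
    refine (hv.continuous.intervalIntegrable μ.rmin r).congr fun t ht => ?_
    rw [uIoc_of_le hr] at ht
    exact (hvt t (h0 ▸ ht.1)).symm
  · exact (μ.smooth_boundary h0).1 r hr

lemma hasDerivAt_arcLength (hm : 3 ≤ m) {r : ℝ} (hr : μ.rmin < r) :
    HasDerivAt (arcLength m μ.mass) (Real.sqrt (1 + slope m μ.mass r ^ 2)) r := by
  refine intervalIntegral.integral_hasDerivAt_right (μ.intervalIntegrable_sqrt hm hr.le) ?_
    (μ.continuousAt_sqrt hr)
  exact ContinuousOn.stronglyMeasurableAtFilter isOpen_Ioi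
    (fun t ht => (μ.continuousAt_sqrt ht).continuousWithinAt) r hr

lemma continuousOn_arcLength (hm : 3 ≤ m) : ContinuousOn (arcLength m μ.mass) (Ici μ.rmin) :=
  continuousOn_primitive_Ici fun _ hr => μ.intervalIntegrable_sqrt hm hr

lemma arcLength_rmin : arcLength m μ.mass μ.rmin = 0 := by
  rw [arcLength, intervalIntegral.integral_same]

lemma strictMonoOn_arcLength (hm : 3 ≤ m) : StrictMonoOn (arcLength m μ.mass) (Ici μ.rmin) := by
  refine strictMonoOn_of_deriv_pos (convex_Ici _) (μ.continuousOn_arcLength hm) fun r hr => ?_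
  rw [interior_Ici] at hr
  rw [(μ.hasDerivAt_arcLength hm hr).deriv]
  linarith [μ.one_le_sqrt r]

/-- The integrand is at least one. Hence the arc length is unbounded and its inverse is defined on
all of `[0, ∞)`. -/
lemma le_arcLength (hm : 3 ≤ m) {r : ℝ} (hr : μ.rmin ≤ r) : r - μ.rmin ≤ arcLength m μ.mass r := by
  have := intervalIntegral.integral_mono_on hr (intervalIntegrable_const (c := (1 : ℝ)))
    (μ.intervalIntegrable_sqrt hm hr) fun t _ => μ.one_le_sqrt t
  rwa [intervalIntegral.integral_const, smul_eq_mul, mul_one] at this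

lemma intervalIntegrable_slope (hm : 3 ≤ m) {r : ℝ} (hr : μ.rmin ≤ r) :
    IntervalIntegrable (RotSym.slope m μ.mass) volume μ.rmin r := by
  refine (μ.intervalIntegrable_sqrt hm hr).mono_fun' ?_ ?_
  · refine ContinuousOn.aestronglyMeasurable (fun t ht => ?_) measurableSet_uIoc
    rw [uIoc_of_le hr] at ht
    exact (μ.continuousAt_slope ht.1).continuousWithinAt
  · refine Eventually.of_forall fun t => ?_
    exact Real.abs_le_sqrt (by linarith)

lemma hasDerivAt_height (hm : 3 ≤ m) {r : ℝ} (hr : μ.rmin < r) :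
    HasDerivAt (height m μ.mass) (RotSym.slope m μ.mass r) r := by
  refine intervalIntegral.integral_hasDerivAt_right (μ.intervalIntegrable_slope hm hr.le) ?_
    (μ.continuousAt_slope hr)
  exact ContinuousOn.stronglyMeasurableAtFilter isOpen_Ioi
    (fun t ht => (μ.continuousAt_slope ht).continuousWithinAt) r hr

lemma continuousOn_height (hm : 3 ≤ m) : ContinuousOn (height m μ.mass) (Ici μ.rmin) :=
  continuousOn_primitive_Ici fun _ hr => μ.intervalIntegrable_slope hm hr

lemma exists_warp (hm : 3 ≤ m) :
    ∃ g : ℝ → ℝ, Continuous g ∧ StrictMono g ∧ (∀ r, μ.rmin ≤ r → g (arcLength m μ.mass r) = r) ∧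
      ∀ s, 0 ≤ s → arcLength m μ.mass (g s) = s ∧ μ.rmin ≤ g s := by
  have := exists_continuous_inverse (μ.continuousOn_arcLength hm) (μ.strictMonoOn_arcLength hm)
    fun C => ⟨max μ.rmin (C + μ.rmin), le_max_left _ _, by
      have := μ.le_arcLength hm (le_max_left μ.rmin (C + μ.rmin))
      linarith [le_max_right μ.rmin (C + μ.rmin)]⟩
  rwa [μ.arcLength_rmin] at this

/-- The warping function is the inverse `g` of the arc length. Its derivative `1/√(1 + ζ²)` is
positive, and squaring gives `f'² = 1 - 2 m_H / f^(m-2)`, so its Hawking mass is the given one. -/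
theorem exists_isProfile (hm : 3 ≤ m) :
    ∃ f : Ici (0 : ℝ) → ℝ, ∃ hf : IsProfile m f, hf.toAdmissibleMass hm = μ := by
  obtain ⟨g, hgc, hgm, hgL, hLg⟩ := μ.exists_warp hm
  have hg0 : g 0 = μ.rmin := by rw [← μ.arcLength_rmin, hgL _ le_rfl]
  have hgpos : ∀ s, 0 < s → μ.rmin < g s := fun s hs => hg0 ▸ hgm hs
  have hgd : ∀ s, 0 < s →
      HasDerivAt g (Real.sqrt (1 + slope m μ.mass (g s) ^ 2))⁻¹ s := by
    intro s hs
    refine HasDerivAt.of_local_left_inverse hgc.continuousAt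
      (μ.hasDerivAt_arcLength hm (hgpos s hs)) (by linarith [μ.one_le_sqrt (g s)]) ?_
    filter_upwards [lt_mem_nhds hs] with y hy using (hLg y hy.le).1
  let f : Ici (0 : ℝ) → ℝ := fun s => g s
  have hF : ∀ s, 0 ≤ s → IciExtend f s = g s := fun s hs => IciExtend_of_mem f hs
  have hf0 : f ⟨0, self_mem_Ici⟩ = μ.rmin := hg0
  have hd : ∀ s, 0 < s → warpDeriv f s = (Real.sqrt (1 + slope m μ.mass (g s) ^ 2))⁻¹ := by
    intro s hs
    refine HasDerivWithinAt.derivWithin ?_ (uniqueDiffOn_Ici 0 s hs.le)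
    exact (hgd s hs).hasDerivWithinAt.congr hF (hF s hs.le)
  have hdsq : ∀ s, 0 < s →
      warpDeriv f s ^ 2 = 1 - 2 * IciExtend μ.mass (g s) / g s ^ (m - 2) := by
    intro s hs
    have h1 := hgpos s hs
    have h2 : 0 < g s ^ (m - 2) := pow_pos (μ.rmin_nonneg.trans_lt h1) _
    have h3 := μ.extend_lt h1
    rw [hd s hs, inv_pow, Real.sq_sqrt (by positivity), μ.one_add_slope_sq h1, inv_div, sub_div,
      div_self h2.ne']
  have hsmooth : IsSmoothWarp f := by
    refine ⟨fun h0 => ?_, fun h0 => ?_⟩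
    · rw [hf0] at h0
      have h0 : 0 < μ.rmin := lt_of_le_of_ne μ.rmin_nonneg (Ne.symm h0)
      obtain ⟨-, ρ, hρ, hρL⟩ := μ.smooth_boundary h0
      -- On `[0, ∞)` the smooth function `ρ` also inverts the arc length, so it agrees with `f`.
      refine ⟨hρ.congr fun s (hs : 0 ≤ s) => ?_, fun s hs => ?_⟩
      · obtain ⟨h1, h2⟩ := hLg s hs
        rw [hF s hs, ← hρL _ h2, h1]
      · rw [hF s hs]
        exact h0.trans_le (hLg s hs).2
    · rw [hf0] at h0
      obtain ⟨v, hv, hve, hv0, hv1, hvt⟩ := μ.exists_even_speed hm h0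
      -- At a pole the arc length extends to the odd primitive of the even speed `v`; its smooth odd
      -- inverse `q` has the form `s k(s)`, with `k(0) = q'(0) = 1 / v(0) = 1`.
      have hLd : ∀ r, HasDerivAt (fun r => ∫ t in (0 : ℝ)..r, v t) (v r) r := fun r =>
        intervalIntegral.integral_hasDerivAt_right (hv.continuous.intervalIntegrable _ _)
          hv.continuous.stronglyMeasurable.stronglyMeasurableAtFilter hv.continuous.continuousAt
      have hLs : ContDiff ℝ ∞ fun r => ∫ t in (0 : ℝ)..r, v t := by
        rw [contDiff_infty_iff_deriv]
        refine ⟨fun r => (hLd r).differentiableAt, ?_⟩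
        rwa [funext fun r => (hLd r).deriv]
      have hLo : ∀ r, ∫ t in (0 : ℝ)..(-r), v t = -∫ t in (0 : ℝ)..r, v t := by
        intro r
        have h1 := intervalIntegral.integral_comp_neg (a := 0) (b := -r) v
        simp only [hve, neg_neg, neg_zero] at h1
        rw [h1, intervalIntegral.integral_symm]
      have hLeq : ∀ r, 0 ≤ r → arcLength m μ.mass r = ∫ t in (0 : ℝ)..r, v t := by
        intro r hr
        have h1 : arcLength m μ.mass r =
            ∫ t in (0 : ℝ)..r, Real.sqrt (1 + RotSym.slope m μ.mass t ^ 2) :=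
          congrArg (fun a => ∫ t in a..r, Real.sqrt (1 + RotSym.slope m μ.mass t ^ 2)) h0
        rw [h1]
        refine intervalIntegral.integral_congr_ae (Eventually.of_forall fun t ht => ?_)
        rw [uIoc_of_le hr] at ht
        exact hvt t ht.1
      obtain ⟨q, hq, hqo, hqm, hqL, -⟩ := exists_odd_inverse hLs hLo
        (fun t => by rw [(hLd t).deriv]; linarith [hv1 t]) fun C => by
          refine ⟨max 0 C, ?_⟩
          rw [← hLeq _ (le_max_left _ _)]
          have := μ.le_arcLength hm (h0 ▸ le_max_left 0 C : μ.rmin ≤ max 0 C)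
          linarith [le_max_right 0 C]
      obtain ⟨k, hk, hke, hkq, hk0⟩ := exists_even_mul_of_odd hq hqo
      have hq0 : q 0 = 0 := by have := hqo 0; simp at this; linarith
      have hFk : ∀ s, 0 ≤ s → IciExtend f s = s * k s := by
        intro s hs
        obtain ⟨h1, h2⟩ := hLg s hs
        have h3 := hqL (g s)
        rw [← hLeq _ (h0 ▸ h2), h1] at h3
        rw [hF s hs, ← hkq, h3]
      have hk0' : k 0 = 1 := by
        rw [hk0]
        have h1 : HasDerivAt q (v 0)⁻¹ 0 := by
          refine HasDerivAt.of_local_left_inverse (f := fun r => ∫ t in (0 : ℝ)..r, v t)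
            hq.continuous.continuousAt ?_ (by rw [hv0]; exact one_ne_zero) ?_
          · rw [hq0]; exact hLd 0
          · have hinj : Function.Injective q := hqm.injective
            exact Eventually.of_forall fun y => hinj (hqL (q y))
        rw [h1.deriv, hv0, inv_one]
      refine ⟨k, hk, hke, hk0', ?_, hFk⟩
      have hpos : ∀ t, 0 < t → 0 < k t := by
        intro t ht
        have h1 := hFk t ht.le
        have h2 := hgpos t ht
        rw [hF t ht.le] at h1
        rw [h0, h1] at h2
        exact pos_of_mul_pos_right h2 ht.le
      intro t
      rcases lt_trichotomy t 0 with ht | rfl | ht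
      · rw [← hke]; exact hpos _ (by linarith)
      · rw [hk0']; exact one_pos
      · exact hpos t ht
  -- Monotonicity gives `2 m_H ≥ rmin^(m-2)`, so `f'² ≤ 1 - (rmin / f)^(m-2)`, which tends to `0` as
  -- `s → 0`.
  have hd0 : f ⟨0, self_mem_Ici⟩ ≠ 0 → warpDeriv f 0 = 0 := by
    intro h0
    rw [hf0] at h0
    have h0 : 0 < μ.rmin := lt_of_le_of_ne μ.rmin_nonneg (Ne.symm h0)
    have h1 : Tendsto (fun s => warpDeriv f s ^ 2) (𝓝[>] 0) (𝓝 (warpDeriv f 0 ^ 2)) :=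
      ((hsmooth.contDiffOn_warpDeriv.continuousOn 0 self_mem_Ici).pow 2).tendsto.mono_left
        (nhdsWithin_mono 0 Ioi_subset_Ici_self)
    have h2 : Tendsto (fun s => 1 - μ.rmin ^ (m - 2) / g s ^ (m - 2)) (𝓝[>] 0) (𝓝 0) := by
      have h3 : ContinuousAt (fun s => 1 - μ.rmin ^ (m - 2) / g s ^ (m - 2)) 0 :=
        continuousAt_const.sub (continuousAt_const.div (hgc.pow _).continuousAt
          (by rw [hg0]; positivity))
      have h4 := h3.tendsto.mono_left (nhdsWithin_le_nhds (s := Ioi 0))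
      rwa [hg0, div_self (by positivity), sub_self] at h4
    have h3 : warpDeriv f 0 ^ 2 ≤ 0 := by
      refine le_of_tendsto_of_tendsto h1 h2 ?_
      filter_upwards [self_mem_nhdsWithin] with s (hs : 0 < s)
      have h4 := μ.le_extend (hgpos s hs).le
      have h5 : 0 < g s ^ (m - 2) := pow_pos (h0.trans (hgpos s hs)) _
      rw [hdsq s hs]
      gcongr
      linarith
    exact pow_eq_zero_iff two_ne_zero |>.1 (le_antisymm h3 (sq_nonneg _))
  have hmass : ∀ s : Ici (0 : ℝ), hawkingMass m f s = IciExtend μ.mass (g s) := by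
    intro s
    rw [hawkingMass_eq, hF s s.2]
    rcases (mem_Ici.1 s.2).eq_or_lt with h | h
    · rw [← h, hg0, IciExtend_self, μ.mass_rmin]
      rcases eq_or_ne μ.rmin 0 with h1 | h1
      · rw [h1, zero_pow (by omega)]; ring
      · rw [hd0 (by rwa [hf0])]; ring
    · have h1 : 0 < g s ^ (m - 2) := pow_pos (μ.rmin_nonneg.trans_lt (hgpos s h)) _
      rw [hdsq s h]
      field_simp
      ring
  have hext : ∀ r r', μ.rmin ≤ r → r ≤ r' → IciExtend μ.mass r ≤ IciExtend μ.mass r' := by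
    intro r r' hr hrr
    rw [IciExtend_of_mem _ hr, IciExtend_of_mem _ (mem_Ici.2 (hr.trans hrr))]
    exact μ.monotone_mass (Subtype.mk_le_mk.2 hrr)
  have hprof : IsProfile m f := by
    refine ⟨hsmooth, hf0 ▸ μ.rmin_nonneg, hd0, fun s hs => ?_, fun s t hst => ?_, ?_⟩
    · rw [hd s hs]
      exact inv_pos.2 (by linarith [μ.one_le_sqrt (g s)])
    · rw [hmass, hmass]
      exact hext _ _ (hLg s s.2).2 (hgm.monotone hst)
    · rintro ⟨C, hC⟩
      have h1 : μ.rmin ≤ max μ.rmin (C + 1) := le_max_left _ _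
      have h2 : 0 ≤ arcLength m μ.mass (max μ.rmin (C + 1)) := by
        linarith [μ.le_arcLength hm h1]
      have h3 := hC ⟨⟨_, h2⟩, hgL _ h1⟩
      linarith [le_max_right μ.rmin (C + 1)]
  refine ⟨f, hprof, ext_of_eq hf0 fun r hr => ?_⟩
  have hr' : f ⟨0, self_mem_Ici⟩ ≤ r := hr
  show IciExtend hprof.mass r = _
  rw [IciExtend_of_mem _ hr, IsProfile.mass, hmass, ← hF _ (hprof.inv_nonneg hr'),
    hprof.warp_inv hr']

end AdmissibleMass

end

namespace RotSym

open Set Filter Topology MeasureTheory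

variable {m : ℕ} {f : Ici (0 : ℝ) → ℝ}

/-! ### The conformal factor of the tangential part -/

/-- The factor `f(s) / ‖x‖` extends smoothly over the pole. -/
lemma IsSmoothWarp.exists_factor (hf : IsSmoothWarp f) (m : ℕ) :
    ∃ κ κ₁ : EuclideanSpace ℝ (Fin m) → ℝ, ContDiffOn ℝ ∞ κ (region m f) ∧
      HasRadialDeriv (region m f) κ κ₁ ∧ (0 ∈ region m f → κ 0 = 1) ∧
      (∀ x ∈ region m f, x ≠ 0 → areaRadius f x / ‖x‖ = κ x) ∧
      ∀ x ∈ region m f, x ≠ 0 → κ x + κ₁ x * ‖x‖ ^ 2 = warpDeriv f (‖x‖ - offset f) := by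
  suffices h : ∃ κ κ₁ : EuclideanSpace ℝ (Fin m) → ℝ, ContDiffOn ℝ ∞ κ (region m f) ∧
      HasRadialDeriv (region m f) κ κ₁ ∧ (0 ∈ region m f → κ 0 = 1) ∧
      (∀ x ∈ region m f, x ≠ 0 → areaRadius f x / ‖x‖ = κ x) by
    obtain ⟨κ, κ₁, hκ, hκ₁, h0, hκr⟩ := h
    refine ⟨κ, κ₁, hκ, hκ₁, h0, hκr, fun x hx hx0 => ?_⟩
    have hr : ‖x‖ ≠ 0 := norm_ne_zero_iff.2 hx0
    have hD : UniqueDiffWithinAt ℝ (region m f ∩ {0}ᶜ) x := by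
      obtain ⟨a, a₁, a₂, b, b₁, b₂, h, -⟩ := hf.exists_isWarpedMetric m
      exact (h.uniqueDiffOn x hx).inter (isOpen_compl_singleton.mem_nhds hx0)
    -- Differentiating `areaRadius f` directly and as `‖x‖ κ(x)`, and comparing, gives `κ + κ₁ ‖x‖²
    -- = f'`.
    have h1 : HasFDerivWithinAt (areaRadius f)
        ((warpDeriv f (‖x‖ - offset f) / ‖x‖) • innerSL ℝ x) (region m f ∩ {0}ᶜ) x :=
      hasRadialDeriv_comp_norm_sub (c := offset f) (fun s hs => hf.hasDerivWithinAt hs)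
        (fun x (hx : offset f ≤ ‖x‖) => sub_nonneg.2 hx) x ⟨hx, hx0⟩
    have h2 : HasFDerivWithinAt (areaRadius f) ((‖x‖ * κ₁ x + κ x * (1 / ‖x‖)) • innerSL ℝ x)
        (region m f ∩ {0}ᶜ) x := by
      refine HasFDerivWithinAt.congr
        ((HasRadialDeriv.norm.mul (hκ₁.mono inter_subset_left)) x ⟨hx, hx0⟩) (fun y hy => ?_) ?_
      · rw [← hκr y hy.1 hy.2, mul_div_cancel₀ _ (norm_ne_zero_iff.2 hy.2)]
      · rw [← hκr x hx hx0, mul_div_cancel₀ _ hr]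
    have h3 := congrArg (fun L => L x) (hD.eq h1 h2)
    simp only [_root_.smul_apply, innerSL_apply_apply, real_inner_self_eq_norm_sq,
      smul_eq_mul] at h3
    have h4 := mul_right_cancel₀ (pow_ne_zero 2 hr) h3
    field_simp at h4
    linarith
  by_cases h0 : f ⟨0, self_mem_Ici⟩ = 0
  · obtain ⟨k, hk, hke, hk0, -, hF⟩ := hf.pole h0
    obtain ⟨k₁, -, -, hd⟩ := exists_even_deriv_eq hk hke
    rw [region_of_eq h0]
    refine ⟨fun x => k ‖x‖, fun x => k₁ ‖x‖, (contDiff_comp_norm_of_even hk hke).contDiffOn,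
      hasRadialDeriv_comp_norm hd, fun _ => by simp [hk0], fun x _ hx => ?_⟩
    rw [areaRadius, offset_of_eq h0, sub_zero, hF _ (norm_nonneg x),
      mul_div_cancel_left₀ _ (norm_ne_zero_iff.2 hx)]
  · have hsm : ContDiffOn ℝ ∞ (fun r => IciExtend f (r - 1) / r) (Ici 1) :=
      ((hf.boundary h0).1.comp (contDiff_id.sub contDiff_const).contDiffOn
        fun r hr => mem_Ici.2 (sub_nonneg.2 hr)).div contDiffOn_id
        fun r (hr : 1 ≤ r) => by linarith
    obtain ⟨α₁, -, hd⟩ := exists_hasRadialDeriv_of_contDiffOn (m := m) hsm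
    rw [region_of_ne h0]
    refine ⟨_, _, contDiffOn_comp_norm hsm, hd, fun h => ?_, fun x _ _ => ?_⟩
    · simp at h
      linarith
    · rw [areaRadius, offset_of_ne h0]

namespace IsProfile

lemma areaRadius_pos (hf : IsProfile m f) {x : EuclideanSpace ℝ (Fin m)} (hx : x ∈ region m f)
    (hx0 : x ≠ 0) : 0 < areaRadius f x := by
  have hx : offset f ≤ ‖x‖ := hx
  rw [areaRadius]
  by_cases h0 : f ⟨0, self_mem_Ici⟩ = 0
  · rw [offset_of_eq h0, sub_zero]
    exact hf.pos (norm_pos_iff.2 hx0)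
  · exact (hf.boundary h0).2 _ (sub_nonneg.2 hx)

lemma norm_graphMap_fst (hf : IsProfile m f) {a : ℝ} (μ : Ici a → ℝ)
    {x : EuclideanSpace ℝ (Fin m)} (hx : x ∈ region m f) :
    ‖(graphMap m f μ x).fst‖ = areaRadius f x := by
  show ‖(areaRadius f x / ‖x‖) • x‖ = _
  rcases eq_or_ne x 0 with rfl | hx0
  · have hx : offset f ≤ ‖(0 : EuclideanSpace ℝ (Fin m))‖ := hx
    have h0 : f ⟨0, self_mem_Ici⟩ = 0 := by
      by_contra h0
      rw [offset_of_ne h0, norm_zero] at hx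
      linarith
    rw [areaRadius, offset_of_eq h0, smul_zero, norm_zero, sub_zero, IciExtend_self, h0]
  · have := hf.areaRadius_pos hx hx0
    rw [norm_smul, Real.norm_of_nonneg (by positivity),
      div_mul_cancel₀ _ (norm_ne_zero_iff.2 hx0)]

lemma bijOn_graphMap (hf : IsProfile m f) :
    BijOn (graphMap m f hf.mass) (region m f) (radialGraph m hf.mass) := by
  refine ⟨fun x hx => ?_, fun x hx y hy hxy => ?_, fun p hp => ?_⟩
  · have hx' : 0 ≤ ‖x‖ - offset f := sub_nonneg.2 hx
    refine ⟨?_, ?_⟩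
    · rw [hf.norm_graphMap_fst _ hx]
      exact hf.warp_zero_le hx'
    · rw [hf.norm_graphMap_fst _ hx]
      rfl
  · have h1 : areaRadius f x = areaRadius f y := by
      rw [← hf.norm_graphMap_fst hf.mass hx, hxy, hf.norm_graphMap_fst _ hy]
    have h2 : ‖x‖ = ‖y‖ := by
      have := hf.strictMonoOn.injOn (sub_nonneg.2 hx : 0 ≤ ‖x‖ - offset f)
        (sub_nonneg.2 hy : 0 ≤ ‖y‖ - offset f) h1
      linarith
    rcases eq_or_ne x 0 with rfl | hx0
    · rw [norm_zero] at h2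
      exact (norm_eq_zero.1 h2.symm).symm
    · have h3 : (areaRadius f x / ‖x‖) • x = (areaRadius f y / ‖y‖) • y :=
        congrArg (fun p => p.fst) hxy
      rw [← h1, ← h2] at h3
      exact smul_right_injective _
        (div_pos (hf.areaRadius_pos hx hx0) (norm_pos_iff.2 hx0)).ne' h3
  · obtain ⟨hp1, hp2⟩ := hp
    suffices h : ∃ x ∈ region m f, (areaRadius f x / ‖x‖) • x = p.fst by
      obtain ⟨x, hx, hxp⟩ := h
      refine ⟨x, hx, ?_⟩
      have h1 : (graphMap m f hf.mass x).fst = p.fst := hxp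
      have h2 : (graphMap m f hf.mass x).snd = p.snd := by
        rw [hp2, ← h1, hf.norm_graphMap_fst _ hx]
        rfl
      exact WithLp.ofLp_injective 2 (Prod.ext h1 h2)
    rcases eq_or_ne p.fst 0 with h0 | h0
    · rw [h0, norm_zero] at hp1
      refine ⟨0, ?_, by rw [h0, smul_zero]⟩
      rw [region_of_eq (le_antisymm hp1 hf.nonneg)]
      trivial
    · have hy : 0 < ‖p.fst‖ := norm_pos_iff.2 h0
      have hs := hf.inv_nonneg hp1
      have hρ : 0 < hf.inv ‖p.fst‖ + offset f := by
        by_cases hf0 : f ⟨0, self_mem_Ici⟩ = 0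
        · rw [offset_of_eq hf0, add_zero]
          exact hf.inv_pos (by rwa [hf0])
        · rw [offset_of_ne hf0]
          linarith
      have hnorm : ‖((hf.inv ‖p.fst‖ + offset f) / ‖p.fst‖) • p.fst‖ =
          hf.inv ‖p.fst‖ + offset f := by
        rw [norm_smul, Real.norm_of_nonneg (by positivity), div_mul_cancel₀ _ hy.ne']
      -- The preimage has the direction of `p.fst` and lies at distance `s = hf.inv ‖p.fst‖`.
      refine ⟨((hf.inv ‖p.fst‖ + offset f) / ‖p.fst‖) • p.fst, ?_, ?_⟩
      · show offset f ≤ _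
        rw [hnorm]
        linarith
      · rw [areaRadius, hnorm, add_sub_cancel_right, hf.warp_inv hp1, smul_smul,
          div_mul_div_cancel₀ hρ.ne', div_self hy.ne', one_smul]

/-! ### The height as a function of the distance -/

lemma warpDeriv_sq_le_one_of_nonneg (hf : IsProfile m f) (hm : 3 ≤ m) {s : ℝ} (hs : 0 ≤ s) :
    warpDeriv f s ^ 2 ≤ 1 := by
  have h1 : Tendsto (fun t => warpDeriv f t ^ 2) (𝓝[>] s) (𝓝 (warpDeriv f s ^ 2)) :=
    ((hf.contDiffOn_warpDeriv.continuousOn s hs).pow 2).tendsto.mono_left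
      (nhdsWithin_mono s fun t ht => hs.trans (le_of_lt ht))
  refine le_of_tendsto h1 ?_
  filter_upwards [self_mem_nhdsWithin] with t ht
  exact hf.warpDeriv_sq_le_one hm (hs.trans_lt ht)

lemma warpDeriv_zero_of_eq (hf : IsProfile m f) (h0 : f ⟨0, self_mem_Ici⟩ = 0) :
    warpDeriv f 0 = 1 := by
  obtain ⟨k, hk, -, hk0, -, hF⟩ := hf.pole h0
  have h1 := (hasDerivAt_id (0 : ℝ)).mul (hk.differentiable (by simp) 0).hasDerivAt
  have h2 := (h1.hasDerivWithinAt (s := Ici 0)).congr hF (hF 0 le_rfl)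
  rw [warpDeriv, h2.derivWithin (uniqueDiffOn_Ici 0 0 self_mem_Ici)]
  simp [hk0]

lemma continuousOn_sqrt_one_sub (hf : IsProfile m f) :
    ContinuousOn (fun s => Real.sqrt (1 - warpDeriv f s ^ 2)) (Ici 0) :=
  (continuousOn_const.sub (hf.contDiffOn_warpDeriv.continuousOn.pow 2)).sqrt

/-- The chain rule gives `ζ(f) f' = √(1 - f'²)`, the vertical speed of the profile curve
parametrised by arc length. At `s = 0` the slope `ζ` can be infinite, so the one-sided derivative is
taken as the limit of the derivatives. -/
lemma hasDerivWithinAt_height (hf : IsProfile m f) (hm : 3 ≤ m) {s : ℝ} (hs : 0 ≤ s) :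
    HasDerivWithinAt (fun s => height m hf.mass (IciExtend f s))
      (Real.sqrt (1 - warpDeriv f s ^ 2)) (Ici 0) s := by
  have hpos : ∀ s, 0 < s → HasDerivAt (fun s => height m hf.mass (IciExtend f s))
      (Real.sqrt (1 - warpDeriv f s ^ 2)) s := by
    intro s hs
    have h0 : f ⟨0, self_mem_Ici⟩ < IciExtend f s := by
      rw [← IciExtend_self f]
      exact hf.strictMonoOn self_mem_Ici (mem_Ici.2 hs.le) hs
    have h1 : HasDerivAt (height m hf.mass) (slope m hf.mass (IciExtend f s)) (IciExtend f s) :=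
      (hf.toAdmissibleMass hm).hasDerivAt_height hm h0
    have h2 := h1.comp s (hf.hasDerivAt hs)
    rwa [hf.slope_mass h0, hf.inv_warp hs.le, div_mul_cancel₀ _ (hf.warpDeriv_pos s hs).ne'] at h2
  rcases hs.eq_or_lt with rfl | hs
  · refine hasDerivWithinAt_Ici_of_tendsto_deriv (s := Ioi 0)
      (fun s hs => (hpos s hs).differentiableAt.differentiableWithinAt) ?_ self_mem_nhdsWithin ?_
    · have h1 : ContinuousOn (height m hf.mass) (Ici (f ⟨0, self_mem_Ici⟩)) :=
        (hf.toAdmissibleMass hm).continuousOn_height hm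
      exact (h1.comp hf.contDiffOn.continuousOn (fun s hs => hf.warp_zero_le hs) 0
        self_mem_Ici).mono Ioi_subset_Ici_self
    · have h1 := (hf.continuousOn_sqrt_one_sub 0 self_mem_Ici).tendsto.mono_left
        (nhdsWithin_mono 0 Ioi_subset_Ici_self)
      refine h1.congr' ?_
      filter_upwards [self_mem_nhdsWithin] with s hs using (hpos s hs).deriv.symm
  · exact (hpos s hs).hasDerivWithinAt

/-- At the pole `f'(0) = 1`, so the vertical speed vanishes and the derivative is zero. The value of
the quotient at `x = 0` is immaterial, since it multiplies `innerSL ℝ 0 = 0`. -/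
lemma hasRadialDeriv_height (hf : IsProfile m f) (hm : 3 ≤ m) :
    HasRadialDeriv (region m f) (fun x => height m hf.mass (areaRadius f x))
      (fun x => Real.sqrt (1 - warpDeriv f (‖x‖ - offset f) ^ 2) / ‖x‖) := by
  intro x hx
  rcases eq_or_ne x 0 with rfl | hx0
  · have hx : offset f ≤ ‖(0 : EuclideanSpace ℝ (Fin m))‖ := hx
    have h0 : f ⟨0, self_mem_Ici⟩ = 0 := by
      by_contra h0
      rw [offset_of_ne h0, norm_zero] at hx
      linarith
    have h1 := hf.hasDerivWithinAt_height hm le_rfl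
    rw [hf.warpDeriv_zero_of_eq h0, one_pow, sub_self, Real.sqrt_zero] at h1
    have h2 := (hasDerivWithinAt_iff_isLittleO.1 h1).comp_tendsto
      (k := fun x : EuclideanSpace ℝ (Fin m) => ‖x‖) (l' := 𝓝 0)
      (tendsto_nhdsWithin_iff.2 ⟨by simpa using
        (continuous_norm (E := EuclideanSpace ℝ (Fin m))).tendsto 0,
        Eventually.of_forall fun x => norm_nonneg x⟩)
    refine HasFDerivAt.hasFDerivWithinAt ?_
    rw [hasFDerivAt_iff_isLittleO]
    refine (h2.congr_left fun y => ?_).trans_isBigO ?_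
    · simp [areaRadius, offset_of_eq h0]
    · exact Asymptotics.IsBigO.of_bound 1 (Eventually.of_forall fun y => by simp)
  · have h1 := hasRadialDeriv_comp_norm_sub (D := region m f) (c := offset f)
      (fun s hs => hf.hasDerivWithinAt_height hm hs)
      (fun x (hx : offset f ≤ ‖x‖) => sub_nonneg.2 hx) x ⟨hx, hx0⟩
    exact h1.mono_of_mem_nhdsWithin (inter_mem_nhdsWithin _ (isOpen_compl_singleton.mem_nhds hx0))

lemma uniqueDiffOn_region (f : Ici (0 : ℝ) → ℝ) : UniqueDiffOn ℝ (region m f) := by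
  by_cases h0 : f ⟨0, self_mem_Ici⟩ = 0
  · rw [region_of_eq h0]; exact uniqueDiffOn_univ
  · rw [region_of_ne h0]; exact uniqueDiffOn_one_le_norm

lemma contDiffOn_height (hf : IsProfile m f) (hm : 3 ≤ m) :
    ContDiffOn ℝ 1 (fun x => height m hf.mass (areaRadius f x)) (region m f) := by
  have hd := hf.hasRadialDeriv_height hm
  rw [show (1 : WithTop ℕ∞) = 0 + 1 by simp,
    contDiffOn_succ_iff_fderivWithin (uniqueDiffOn_region f), contDiffOn_zero]
  refine ⟨fun x hx => (hd x hx).differentiableWithinAt, by simp, ?_⟩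
  refine ContinuousOn.congr ?_ fun x hx => (hd x hx).fderivWithin (uniqueDiffOn_region f x hx)
  have hq : ContinuousOn (fun x : EuclideanSpace ℝ (Fin m) =>
      Real.sqrt (1 - warpDeriv f (‖x‖ - offset f) ^ 2)) (region m f) :=
    hf.continuousOn_sqrt_one_sub.comp (continuous_norm.sub continuous_const).continuousOn
      fun x (hx : offset f ≤ ‖x‖) => sub_nonneg.2 hx
  intro x hx
  rcases eq_or_ne x 0 with rfl | hx0
  · have hx' : offset f ≤ ‖(0 : EuclideanSpace ℝ (Fin m))‖ := hx
    have h0 : f ⟨0, self_mem_Ici⟩ = 0 := by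
      by_contra h0
      rw [offset_of_ne h0, norm_zero] at hx'
      linarith
    have h1 := (hq 0 hx).tendsto
    simp only [norm_zero, offset_of_eq h0, sub_zero, hf.warpDeriv_zero_of_eq h0, one_pow, sub_self,
      Real.sqrt_zero] at h1
    rw [ContinuousWithinAt, map_zero, smul_zero]
    -- The norm of the derivative is at most `√(1 - f'²)`, which tends to zero at the pole.
    refine squeeze_zero_norm (fun y => ?_) h1
    rw [norm_smul, innerSL_apply_norm, offset_of_eq h0]
    simp only [sub_zero, norm_div, norm_norm, Real.norm_of_nonneg (Real.sqrt_nonneg _)]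
    rcases eq_or_ne ‖y‖ 0 with hy | hy
    · rw [hy, mul_zero]
      exact Real.sqrt_nonneg _
    · rw [div_mul_cancel₀ _ hy]
  · exact ((hq x hx).div continuous_norm.continuousWithinAt (norm_ne_zero_iff.2 hx0)).smul
      (innerSL ℝ).continuous.continuousWithinAt

/-! ### The isometric embedding -/

lemma fderivWithin_toLp_prodMk {E F G : Type*} [NormedAddCommGroup E] [NormedSpace ℝ E]
    [NormedAddCommGroup F] [NormedSpace ℝ F] [NormedAddCommGroup G] [NormedSpace ℝ G]
    {φ : E → F} {χ : E → G} {φ' : E →L[ℝ] F} {χ' : E →L[ℝ] G} {D : Set E} {x : E}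
    (hφ : HasFDerivWithinAt φ φ' D x) (hχ : HasFDerivWithinAt χ χ' D x)
    (hD : UniqueDiffWithinAt ℝ D x) (v : E) :
    fderivWithin ℝ (fun y => WithLp.toLp 2 (φ y, χ y)) D x v = WithLp.toLp 2 (φ' v, χ' v) := by
  have h := (WithLp.prodContinuousLinearEquiv 2 ℝ F G).symm.hasFDerivAt.comp_hasFDerivWithinAt x
    (hφ.prodMk hχ)
  exact congrArg (fun L => L v) (h.fderivWithin hD)

lemma contDiffOn_graphMap (hf : IsProfile m f) (hm : 3 ≤ m) :
    ContDiffOn ℝ 1 (graphMap m f hf.mass) (region m f) := by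
  obtain ⟨κ, -, hκ, -, -, hκr, -⟩ := hf.exists_factor m
  have h1 : ContDiffOn ℝ 1 (fun x : EuclideanSpace ℝ (Fin m) => (areaRadius f x / ‖x‖) • x)
      (region m f) := by
    refine ((hκ.of_le (by simp)).smul contDiffOn_id).congr fun x hx => ?_
    rcases eq_or_ne x 0 with rfl | hx0
    · simp
    · rw [hκr x hx hx0]; rfl
  exact (WithLp.prodContinuousLinearEquiv 2 ℝ (EuclideanSpace ℝ (Fin m))
    ℝ).symm.contDiff.comp_contDiffOn
    (h1.prodMk (hf.contDiffOn_height hm))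

lemma fderivWithin_graphMap (hf : IsProfile m f) (hm : 3 ≤ m)
    {κ κ₁ : EuclideanSpace ℝ (Fin m) → ℝ} (hκ : HasRadialDeriv (region m f) κ κ₁)
    (hκr : ∀ x ∈ region m f, x ≠ 0 → areaRadius f x / ‖x‖ = κ x)
    {x : EuclideanSpace ℝ (Fin m)} (hx : x ∈ region m f) (v : EuclideanSpace ℝ (Fin m)) :
    fderivWithin ℝ (graphMap m f hf.mass) (region m f) x v =
      WithLp.toLp 2 (κ x • v + (κ₁ x * inner ℝ x v) • x,
        Real.sqrt (1 - warpDeriv f (‖x‖ - offset f) ^ 2) / ‖x‖ * inner ℝ x v) := by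
  have h1 : HasFDerivWithinAt (fun x : EuclideanSpace ℝ (Fin m) => (areaRadius f x / ‖x‖) • x)
      (κ x • ContinuousLinearMap.id ℝ _ + (κ₁ x • innerSL ℝ x).smulRight x) (region m f) x := by
    have hc : ∀ y ∈ region m f, (areaRadius f y / ‖y‖) • y = κ y • y := fun y hy => by
      rcases eq_or_ne y 0 with rfl | hy0
      · simp
      · rw [hκr y hy hy0]
    exact ((hκ x hx).smul (hasFDerivWithinAt_id x _)).congr hc (hc x hx)
  rw [show graphMap m f hf.mass = fun x => WithLp.toLp 2 ((areaRadius f x / ‖x‖) • x,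
      height m hf.mass (areaRadius f x)) from rfl,
    fderivWithin_toLp_prodMk h1 (hf.hasRadialDeriv_height hm x hx) (uniqueDiffOn_region f x hx)]
  simp only [add_apply, _root_.smul_apply, ContinuousLinearMap.smulRight_apply,
    ContinuousLinearMap.id_apply, innerSL_apply_apply, smul_eq_mul]

/-- The horizontal part scales tangential vectors by `κ = f / ‖x‖` and radial ones by `κ + κ₁ ‖x‖² =
f'`. The vertical part adds `1 - f'²` to the squared length of radial unit vectors, which becomes
one. -/
lemma inner_fderivWithin_graphMap (hf : IsProfile m f) (hm : 3 ≤ m)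
    {x : EuclideanSpace ℝ (Fin m)} (hx : x ∈ region m f) (i j : Fin m) :
    inner ℝ (fderivWithin ℝ (graphMap m f hf.mass) (region m f) x (EuclideanSpace.single i 1))
      (fderivWithin ℝ (graphMap m f hf.mass) (region m f) x (EuclideanSpace.single j 1)) =
    metric m f x i j := by
  obtain ⟨κ, κ₁, -, hκ, hκ0, hκr, hκ₁⟩ := hf.exists_factor m
  have hip : ∀ k, inner ℝ x (EuclideanSpace.single k (1 : ℝ)) = x k := fun k => by
    simp [EuclideanSpace.inner_single_right]
  have hip' : ∀ k, inner ℝ (EuclideanSpace.single k (1 : ℝ)) x = x k := fun k => by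
    simp [EuclideanSpace.inner_single_left]
  have hii : inner ℝ (EuclideanSpace.single i (1 : ℝ)) (EuclideanSpace.single j (1 : ℝ)) =
      if i = j then (1 : ℝ) else 0 := by
    simp [EuclideanSpace.inner_single_left]
  have hnn : 0 ≤ 1 - warpDeriv f (‖x‖ - offset f) ^ 2 :=
    sub_nonneg.2 (hf.warpDeriv_sq_le_one_of_nonneg hm (sub_nonneg.2 hx))
  have hq := Real.sq_sqrt hnn
  rw [hf.fderivWithin_graphMap hm hκ hκr hx, hf.fderivWithin_graphMap hm hκ hκr hx,
    WithLp.prod_inner_apply]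
  generalize Real.sqrt (1 - warpDeriv f (‖x‖ - offset f) ^ 2) = q at hq ⊢
  simp only [inner_add_left, inner_add_right, real_inner_smul_left, real_inner_smul_right, hip,
    hip', hii, real_inner_self_eq_norm_sq]
  rcases eq_or_ne x 0 with rfl | hx0
  · simp [metric, hκ0 hx, Matrix.one_apply]
  · have hr : ‖x‖ ≠ 0 := norm_ne_zero_iff.2 hx0
    rw [metric_of_ne_zero f hx0, hκr x hx hx0]
    rw [← hκ₁ x hx hx0] at hq
    generalize (if i = j then (1 : ℝ) else 0) = δ
    simp only [RCLike.inner_apply, conj_trivial]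
    field_simp
    linear_combination (x i * x j) * hq

end IsProfile

/-! ### The bijection and the main theorem -/

/-- The mass determines the arc length, and the arc length is the inverse of `f`. -/
lemma toAdmissibleMass_warp_injective (hm : 3 ≤ m) {f g : Ici (0 : ℝ) → ℝ} (hf : IsProfile m f)
    (hg : IsProfile m g) (h : hf.toAdmissibleMass hm = hg.toAdmissibleMass hm) : f = g := by
  have h0 : f ⟨0, self_mem_Ici⟩ = g ⟨0, self_mem_Ici⟩ := congrArg AdmissibleMass.rmin h
  have hL : arcLength m hf.mass = arcLength m hg.mass :=
    congrArg (fun μ : AdmissibleMass m => arcLength m μ.mass) h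
  have hinv : ∀ r, f ⟨0, self_mem_Ici⟩ ≤ r → hf.inv r = hg.inv r := fun r hr => by
    rw [← hf.arcLength_mass hm hr, hL, hg.arcLength_mass hm (h0 ▸ hr)]
  ext s
  have h1 := hf.warp_zero_le s.2
  have h2 := hinv _ h1
  rw [hf.inv_warp s.2] at h2
  have h3 := hg.warp_inv (h0 ▸ h1 : g ⟨0, self_mem_Ici⟩ ≤ IciExtend f s)
  rw [← h2, IciExtend_coe, IciExtend_coe] at h3
  exact h3.symm

/-- A manifold of the class `RS m` is determined by its Hawking mass, as a function of the area
radius, and every admissible Hawking mass function occurs. -/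
lemma bijective_toAdmissibleMass (hm : 3 ≤ m) :
    Function.Bijective fun M : RS m => (isProfile_warp hm M).toAdmissibleMass hm := by
  refine ⟨fun M N h => ?_, fun μ => ?_⟩
  · have h1 : M.warp = N.warp := toAdmissibleMass_warp_injective hm _ _ h
    -- Apart from `warp`, the fields of `RS` are propositions.
    cases M
    cases N
    congr
  · obtain ⟨f, hf, rfl⟩ := μ.exists_isProfile hm
    exact ⟨hf.toRS hm, rfl⟩

end RotSym

open RotSym in
theorem lemma2p5 (m : ℕ) (hm : 3 ≤ m) :
    ∃ Φ : RS m ≃ AdmissibleMass m,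
      -- `Φ M` is the Hawking mass of `M`, as a function of the area radius `r = f(s)`
      (∀ M : RS m,
        (Φ M).rmin = M.warp ⟨0, Set.self_mem_Ici⟩ ∧
        Set.range M.warp = Set.Ici (Φ M).rmin ∧
        ∀ s, Set.IciExtend (Φ M).mass (M.warp s) = hawkingMass m M.warp s) ∧
      -- the manifold with Hawking mass `μ` is the radial graph of `z`
      (∀ μ : AdmissibleMass m,
        (∀ r, μ.rmin ≤ r →
          IntervalIntegrable (slope m μ.mass) MeasureTheory.volume μ.rmin r) ∧
        (∀ r, μ.rmin < r → HasDerivAt (height m μ.mass) (slope m μ.mass r) r) ∧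
        ContDiffOn ℝ 1 (graphMap m (Φ.symm μ).warp μ.mass) (region m (Φ.symm μ).warp) ∧
        Set.BijOn (graphMap m (Φ.symm μ).warp μ.mass) (region m (Φ.symm μ).warp)
          (radialGraph m μ.mass) ∧
        ∀ x ∈ region m (Φ.symm μ).warp, ∀ i j : Fin m,
          inner ℝ
            (fderivWithin ℝ (graphMap m (Φ.symm μ).warp μ.mass) (region m (Φ.symm μ).warp) x
              (EuclideanSpace.single i 1))
            (fderivWithin ℝ (graphMap m (Φ.symm μ).warp μ.mass) (region m (Φ.symm μ).warp) x
              (EuclideanSpace.single j 1)) = metric m (Φ.symm μ).warp x i j) := by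
  refine ⟨Equiv.ofBijective _ (bijective_toAdmissibleMass hm), fun M => ?_, fun μ => ?_⟩
  · have hf := isProfile_warp hm M
    have h0 : ∀ s : Set.Ici (0 : ℝ), M.warp ⟨0, Set.self_mem_Ici⟩ ≤ M.warp s := fun s => by
      rw [← Set.IciExtend_coe M.warp s]
      exact hf.warp_zero_le s.2
    refine ⟨rfl, Set.Subset.antisymm ?_ fun r hr => ?_, fun s => ?_⟩
    · rintro _ ⟨s, rfl⟩
      exact h0 s
    · have hr : M.warp ⟨0, Set.self_mem_Ici⟩ ≤ r := hr
      exact ⟨⟨hf.inv r, hf.inv_nonneg hr⟩, by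
        rw [← Set.IciExtend_of_mem M.warp (Set.mem_Ici.2 (hf.inv_nonneg hr)), hf.warp_inv hr]⟩
    · show Set.IciExtend hf.mass (M.warp s) = _
      rw [Set.IciExtend_of_mem _ (Set.mem_Ici.2 (h0 s)), IsProfile.mass]
      congr 1
      refine Subtype.ext ?_
      show hf.inv (M.warp s) = s
      rw [← Set.IciExtend_coe M.warp s, hf.inv_warp s.2]
  · obtain ⟨M, rfl⟩ := (Equiv.ofBijective _ (bijective_toAdmissibleMass hm)).surjective μ
    rw [Equiv.symm_apply_apply]
    have hf := isProfile_warp hm M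
    exact ⟨fun r hr => (hf.toAdmissibleMass hm).intervalIntegrable_slope hm hr,
      fun r hr => (hf.toAdmissibleMass hm).hasDerivAt_height hm hr, hf.contDiffOn_graphMap hm,
      hf.bijOn_graphMap, fun x hx i j => hf.inner_fderivWithin_graphMap hm hx i j⟩
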